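/- **Setting.** Let $2\le b_1<b_2<b_3$ be pairwise coprime integers, $p=b_1b_2b_3$, and let $\Sigma=\Sigma(b_1,b_2,b_3)$ be the Brieskorn sphere. Let $\Gamma$ be its negative definite star-shaped plumbing tree in normal form: there are integers $e$ and $0<\omega_i<b_i$ with $e+\sum_i\omega_i/b_i=-1/p$; the central vertex has weight $e$, and the weights on the $i$-th of the three legs, read from the centre outwards, are $-a_1,\dots,-a_n$, where $b_i/\omega_i=a_1-1/(a_2-\cdots-1/a_n)$ with all $a_r\ge 2$. Let $M$ be the plumbing matrix, $m_v$ the weights, $\delta_v$ the degrees, $s$ the number of vertices, $u=(1,\dots,1)$, $\langle x,y\rangle=x^TMy$, and let $k\in m+2\mathbb Z^s$ represent the spin$^c$ structure. With $q=e^{2\pi i\tau}$, $\operatorname{Im}\tau>0$, $q^r=e^{2\pi i r\tau}$, put $$\widehat{\widehat Z}_\Sigma(t,q)=\sum_{x\in\mathbb Z^s}\Big(\prod_v\widehat F_{\delta_v}\big((2Mx+k-Mu)_v\big)\Big)\,q^{\varepsilon_k(x)}\,t^{\Theta_k+\langle x,u\rangle},$$ where $\widehat F_n(r)$ is the coefficient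 of $z^{-r}$ in $(z-z^{-1})^{2-n}$ (for $n\ge3$, the average of the expansions at $0$ and $\infty$), $\Theta_k=\frac{k\cdot u-\langle u,u\rangle}{2}$ and $$\varepsilon_k(x)=-\tfrac14\Big((k-Mu)^TM^{-1}(k-Mu)+3s+\sum_v m_v\Big)-\big(k\cdot x+\langle x,x\rangle\big)+\langle x,u\rangle .$$ Let $\Delta=\frac14\big(\sum_i h_i-3s-\sum_v m_v-\frac{b_2b_3}{b_1}-\frac{b_1b_3}{b_2}-\frac{b_1b_2}{b_3}\big)$, where $h_i$ is the order of $H_1$ of the manifold plumbed along $\Gamma$ with the last vertex of the $i$-th leg removed. Let $\alpha_1=p-b_1b_2-b_1b_3-b_2b_3$, $\alpha_2=p+b_1b_2-b_1b_3-b_2b_3$, $\alpha_3=p-b_1b_2+b_1b_3-b_2b_3$, $\alpha_4=p+b_1b_2+b_1b_3-b_2b_3$, put $(\beta_1,\beta_2,\beta_3,\beta_4)=(\alpha_1+2p,\alpha_2,\alpha_3,\alpha_4-2p)$ and $(\sigma_1,\sigma_2,\sigma_3,\sigma_4)=(-1,1,1,-1)$, and let $$\varphi(n;t)=\pm\tfrac{\sigma_i}{2}\big(t^{(n\mp\beta_i)/2p}+t^{-(n\mp\beta_i)/2p}\big)\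 \text{ if } n\equiv\pm\alpha_i \bmod 2p,\qquad \varphi(n;t)=0\ \text{ otherwise.}$$ **Quantum modular forms.** For $k\in\frac12+\mathbb Z$, $f:\mathcal Q\to\mathbb C$ with $\mathcal Q\subseteq\mathbb Q$, and $\gamma=\begin{psmallmatrix}a&b\\c&d\end{psmallmatrix}$ with $d$ odd, $4\mid c$, let $f|_k\gamma(x)=\varepsilon_d^{2k}\left(\frac cd\right)(cx+d)^{-k}f(\gamma x)$, where $\varepsilon_d=1$ or $i$ according to $d\equiv1$ or $3\bmod4$, $\left(\frac cd\right)$ is the (extended) Jacobi symbol, and $(cx+d)^{-k}$ is the limit of the principal branch of $(c\tau+d)^{-k}$ as $\tau\to x$ from the lower half-plane. A quantum modular form of weight $k$ for $\Gamma'$ (with trivial multiplier) and with quantum set $\mathcal Q$ is such an $f$, where $\mathcal Q$ is closed under $\Gamma'$ (away from $i\infty$), for which, for every $\gamma\in\Gamma'$, the function $f-f|_k\gamma$ on $\mathcal Q\setminus\{\gamma^{-1}(i\infty)\}$ extends to a $C^\infty$ function on $\mathbb R$ that is real-analytic on $\mathbb R\setminus\{\gamma^{-1}(i\infty)\}$.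 A holomorphic function on the upper half-plane is called a quantum modular form if its radial limits at the points $x\in\mathcal Q$ (along $\tau=x+is$, $s\searrow0$) exist and form one. **Theorem.** Let $j\ge1$ and $\zeta^j=1$. Let $C'=q^{1/120}(\zeta-\zeta^{-1})$ if $(b_1,b_2,b_3)=(2,3,5)$ and $C'=0$ otherwise, let $\varphi'(n;\zeta)=t\frac{\partial}{\partial t}\varphi(n;t)\big|_{t=\zeta}$ and $$A'_\zeta(\tau)=\sum_{n\ge0}\varphi'(n;\zeta)\,q^{n^2/4p}.$$ Then the series $\widehat{\widehat Z}_\Sigma(t,q)$ converges absolutely for all $t\ne0$ and $|q|<1$, it is differentiable in $t$ at $\zeta$, it may be differentiated summand by summand there, and $\widehat{\widehat Z}{}'_\Sigma:=t\frac{\partial}{\partial t}\widehat{\widehat Z}_\Sigma$ satisfies $$\widehat{\widehat Z}{}'_\Sigma(\zeta,q)=q^\Delta\big(C'-A'_\zeta(\tau)\big).$$ Moreover there are $2pj$-periodic functions $\chi$ (odd) and $\psi$ (even) on $\mathbb Z$ with $$A'_\zeta(\tau)=\sum_{n\ge0}\chi(n)q^{n^2/4p}+\sum_{n\ge0}n\,\psi(n)q^{n^2/4p},$$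 where the first series is a quantum modular form of weight $1/2$ for $\Gamma(4pj^2)$ with quantum set $\mathbb Q$, and the second is a quantum modular form of weight $3/2$ for $\Gamma(4pj^2)$ with quantum set $\{x\in\mathbb Q: jx \text{ is } \Gamma_1(4pj)\text{-equivalent to } i\infty\}$. -/

import Mathlib

open Complex Filter Topology
open scoped ContDiff

noncomputable section

namespace BrieskornQM

/-- `q ^ r` for `q = exp (2 π i τ)` and a rational exponent `r`. -/
def qpow (r : ℚ) (τ : ℂ) : ℂ := Complex.exp (2 * Real.pi * Complex.I * (r : ℂ) * τ)

/-! ### The two-variable series of a weighted graph -/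

/-- A weighted graph on the vertex set `V`. -/
structure Plumbing (V : Type) where
  graph : SimpleGraph V
  weight : V → ℤ

namespace Plumbing

variable {V : Type} [Fintype V]

/-- The degree vector `δ`. -/
def deg (G : Plumbing V) (v : V) : ℕ := (G.graph.neighborSet v).ncard

open Classical in
/-- The plumbing matrix `M`. -/
def mat (G : Plumbing V) : Matrix V V ℤ :=
  Matrix.of fun v w => if v = w then G.weight v else if G.graph.Adj v w then 1 else 0

/-- The bilinear form `⟨x, y⟩ = xᵀ M y`. -/
def form (G : Plumbing V) (x y : V → ℤ) : ℤ := dotProduct x (G.mat.mulVec y)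

/-- The form `a² = aᵀ M⁻¹ a` (a rational number). -/
def dualSq (G : Plumbing V) (a : V → ℤ) : ℚ :=
  open Classical in
  dotProduct (fun v => (a v : ℚ)) ((G.mat.map (Int.cast : ℤ → ℚ))⁻¹.mulVec fun v => (a v : ℚ))

/-- `k` represents a spin^c structure: `k ∈ m + 2ℤ^s`. -/
def IsSpinc (G : Plumbing V) (k : V → ℤ) : Prop := ∀ v, k v ≡ G.weight v [ZMOD 2]

/-- `Mu`, where `u = (1, 1, …, 1)`. -/
def matU (G : Plumbing V) : V → ℤ := G.mat.mulVec 1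

/-- The coefficient of `z ^ (-r)` in `(z - z⁻¹) ^ (2 - n)`; for `n ≥ 3` this is the average of the
expansions at `z = 0` and `z = ∞`. -/
def Fhat : ℕ → ℤ → ℚ
  | 0, r => if r = 2 ∨ r = -2 then 1 else if r = 0 then -2 else 0
  | 1, r => if r = 1 ∨ r = -1 then -r else 0
  | 2, r => if r = 0 then 1 else 0
  | (n + 3), r =>
      if (n : ℤ) + 1 ≤ |r| ∧ r ≡ (n : ℤ) + 3 [ZMOD 2] then
        1 / 2 * (r.sign : ℚ) ^ (n + 3) * (((((n : ℤ) + 3 + |r|) / 2 - 2).toNat.choose n : ℕ) : ℚ)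
      else 0

/-- `F̂_{Γ,k}(x) = ∏_v F̂_{δ_v}((2Mx + k - Mu)_v)`. -/
def FhatProd (G : Plumbing V) (k x : V → ℤ) : ℚ :=
  ∏ v, Fhat (G.deg v) (2 * G.mat.mulVec x v + k v - G.matU v)

/-- `χ_k(x) = -(k · x + ⟨x, x⟩) / 2`. -/
def chi (G : Plumbing V) (k x : V → ℤ) : ℚ := -((dotProduct k x + G.form x x : ℤ) : ℚ) / 2

/-- `Θ_k + ⟨x, u⟩`, where `Θ_k = (k · u - ⟨u, u⟩) / 2`; the division is exact when `k` represents a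
spin^c structure. -/
def tExp (G : Plumbing V) (k x : V → ℤ) : ℤ :=
  (dotProduct k 1 - G.form 1 1) / 2 + G.form x 1

/-- `ε_k(x) = -((k - Mu)² + 3s + ∑ m_v) / 4 + 2 χ_k(x) + ⟨x, u⟩`. -/
def qExp (G : Plumbing V) (k x : V → ℤ) : ℚ :=
  -(G.dualSq (k - G.matU) + 3 * (Fintype.card V : ℚ) + ((∑ v, G.weight v : ℤ) : ℚ)) / 4
    + 2 * G.chi k x + (G.form x 1 : ℚ)

/-- The summand of the two-variable series indexed by `x ∈ ℤ^s`, with `q = exp (2 π i τ)`. -/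
def term (G : Plumbing V) (k : V → ℤ) (t τ : ℂ) (x : V → ℤ) : ℂ :=
  (G.FhatProd k x : ℂ) * qpow (G.qExp k x) τ * t ^ G.tExp k x

/-- The two-variable series. -/
def series (G : Plumbing V) (k : V → ℤ) (t τ : ℂ) : ℂ := ∑' x : V → ℤ, G.term k t τ x

/-- `t ∂/∂t` of the two-variable series. -/
def seriesDeriv (G : Plumbing V) (k : V → ℤ) (t τ : ℂ) : ℂ :=
  t * deriv (fun s => G.series k s τ) t

open Classical in
/-- The order of `H₁` of the plumbed manifold that belongs to the graph with the vertices outside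
`S` removed, that is, of the cokernel of the plumbing matrix of that graph. -/
def homologyCard (G : Plumbing V) (S : Set V) : ℕ :=
  Nat.card ((S → ℤ) ⧸
    LinearMap.range (G.mat.submatrix (Subtype.val : S → V) (Subtype.val : S → V)).mulVecLin)

end Plumbing

/-! ### Brieskorn spheres -/

/-- The continued fraction `a₁ - 1/(a₂ - 1/(⋯ - 1/aₙ))` of a non-empty list (the value `0` of the
empty list has inverse `0`, so that the value of `[a]` is `a`). -/
def negCF : List ℤ → ℚ
  | [] => 0
  | a :: l => a - (negCF l)⁻¹

/-- The data of the negative definite star-shaped plumbing graph of `Σ(b₀, b₁, b₂)` in normal form: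
the weight `e` of the central vertex and, for each of the three legs, the weights `-a` for `a` in
the continued fraction expansion of `bᵢ / omᵢ`, read from the centre outwards, where
`e + ∑ omᵢ / bᵢ = -1 / (b₀ b₁ b₂)`. -/
structure BrieskornPlumbing (b : Fin 3 → ℕ) where
  e : ℤ
  om : Fin 3 → ℕ
  leg : Fin 3 → List ℤ
  om_pos : ∀ i, 0 < om i
  om_lt : ∀ i, om i < b i
  two_le : ∀ i, ∀ a ∈ leg i, 2 ≤ a
  negCF_leg : ∀ i, negCF (leg i) = (b i : ℚ) / om i
  euler : (e : ℚ) + ∑ i, (om i : ℚ) / b i = -1 / ((∏ i, b i : ℕ) : ℚ)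

/-- Every fraction `b / w > 1` has a continued fraction expansion with entries at least `2`. -/
theorem exists_negCF (w : ℕ) : ∀ b : ℕ, 0 < w → w < b →
    ∃ l : List ℤ, (∀ a ∈ l, 2 ≤ a) ∧ negCF l = (b : ℚ) / w := by
  induction w using Nat.strong_induction_on with
  | _ w ih =>
    intro b hw hwb
    by_cases hdvd : w ∣ b
    · obtain ⟨a, rfl⟩ := hdvd
      refine ⟨[(a : ℤ)], ?_, ?_⟩
      · intro x hx
        rw [List.mem_singleton] at hx
        have : 1 < a := by
          by_contra hcon
          have : a ≤ 1 := not_lt.mp hcon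
          nlinarith
        omega
      · have : (w : ℚ) ≠ 0 := by positivity
        simp only [negCF]
        push_cast
        field_simp
        simp
    · set a : ℕ := b / w + 1 with ha
      have hdm := Nat.div_add_mod b w
      have hmod : b % w < w := Nat.mod_lt _ hw
      have hmod0 : 0 < b % w := Nat.pos_of_ne_zero fun h0 => hdvd (Nat.dvd_of_mod_eq_zero h0)
      have hq : 1 ≤ b / w := (Nat.one_le_div_iff hw).mpr hwb.le
      obtain ⟨l, hl, hcf⟩ := ih (w - b % w) (by omega) w (by omega) (by omega)
      refine ⟨(a : ℤ) :: l, ?_, ?_⟩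
      · intro x hx
        rcases List.mem_cons.mp hx with h | h
        · omega
        · exact hl x h
      · have hwq : (w : ℚ) ≠ 0 := by positivity
        have hbq : (w : ℚ) * ((b / w : ℕ) : ℚ) + ((b % w : ℕ) : ℚ) = b := by exact_mod_cast hdm
        have haq : ((a : ℤ) : ℚ) = ((b / w : ℕ) : ℚ) + 1 := by
          rw [ha, Int.cast_natCast, Nat.cast_add, Nat.cast_one]
        rw [negCF, hcf, inv_div, Nat.cast_sub hmod.le, haq]
        generalize ((b / w : ℕ) : ℚ) = x at *
        generalize ((b % w : ℕ) : ℚ) = y at *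
        field_simp
        linarith

/-- Every Brieskorn sphere has a plumbing graph in normal form. -/
theorem nonempty_brieskornPlumbing (b : Fin 3 → ℕ) (hb : ∀ i, 2 ≤ b i)
    (hcop : Pairwise fun i i' => Nat.Coprime (b i) (b i')) : Nonempty (BrieskornPlumbing b) := by
  have key : ∀ x c : ℕ, 2 ≤ x → Nat.Coprime c x → ∃ w : ℕ, 0 < w ∧ w < x ∧ (x : ℤ) ∣ w * c + 1 := by
    intro x c hx hc
    have : NeZero x := ⟨by omega⟩
    have : Fact (1 < x) := ⟨by omega⟩
    set u : ZMod x := -(c : ZMod x)⁻¹ with hu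
    have h1 : u * c = -1 := by
      rw [hu, neg_mul, mul_comm, ZMod.coe_mul_inv_eq_one c hc]
    refine ⟨u.val, ?_, ZMod.val_lt u, ?_⟩
    · apply Nat.pos_of_ne_zero
      intro h0
      rw [(ZMod.val_eq_zero u).mp h0, zero_mul] at h1
      exact one_ne_zero (neg_eq_zero.mp h1.symm)
    · rw [← ZMod.intCast_zmod_eq_zero_iff_dvd]
      push_cast
      rw [ZMod.natCast_zmod_val, h1]
      ring
  have h01 : Nat.Coprime (b 0) (b 1) := hcop (by decide)
  have h02 : Nat.Coprime (b 0) (b 2) := hcop (by decide)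
  have h12 : Nat.Coprime (b 1) (b 2) := hcop (by decide)
  obtain ⟨w0, hp0, hl0, hd0⟩ := key (b 0) (b 1 * b 2) (hb 0) (h01.symm.mul_left h02.symm)
  obtain ⟨w1, hp1, hl1, hd1⟩ := key (b 1) (b 0 * b 2) (hb 1) (h01.mul_left h12.symm)
  obtain ⟨w2, hp2, hl2, hd2⟩ := key (b 2) (b 0 * b 1) (hb 2) (h02.mul_left h12)
  set S : ℤ := w0 * (b 1 * b 2) + w1 * (b 0 * b 2) + w2 * (b 0 * b 1) + 1 with hS
  push_cast at hd0 hd1 hd2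
  have e0 : (b 0 : ℤ) ∣ S := by
    have : S = (w0 * (b 1 * b 2) + 1) + b 0 * (w1 * b 2 + w2 * b 1) := by rw [hS]; ring
    rw [this]
    exact dvd_add hd0 (dvd_mul_right _ _)
  have e1 : (b 1 : ℤ) ∣ S := by
    have : S = (w1 * (b 0 * b 2) + 1) + b 1 * (w0 * b 2 + w2 * b 0) := by rw [hS]; ring
    rw [this]
    exact dvd_add hd1 (dvd_mul_right _ _)
  have e2 : (b 2 : ℤ) ∣ S := by
    have : S = (w2 * (b 0 * b 1) + 1) + b 2 * (w0 * b 1 + w1 * b 0) := by rw [hS]; ring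
    rw [this]
    exact dvd_add hd2 (dvd_mul_right _ _)
  have e01 : (b 0 * b 1 : ℤ) ∣ S :=
    IsCoprime.mul_dvd (Nat.isCoprime_iff_coprime.mpr h01) e0 e1
  have e012 : (b 0 * b 1 * b 2 : ℤ) ∣ S := by
    refine IsCoprime.mul_dvd ?_ e01 e2
    exact IsCoprime.mul_left (Nat.isCoprime_iff_coprime.mpr h02) (Nat.isCoprime_iff_coprime.mpr h12)
  obtain ⟨r, hr⟩ := e012
  obtain ⟨l0, ha0, hc0⟩ := exists_negCF w0 (b 0) hp0 hl0
  obtain ⟨l1, ha1, hc1⟩ := exists_negCF w1 (b 1) hp1 hl1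
  obtain ⟨l2, ha2, hc2⟩ := exists_negCF w2 (b 2) hp2 hl2
  refine ⟨⟨-r, ![w0, w1, w2], ![l0, l1, l2], ?_, ?_, ?_, ?_, ?_⟩⟩
  · intro i; fin_cases i <;> simpa
  · intro i; fin_cases i <;> simpa
  · intro i; fin_cases i <;> simpa
  · intro i; fin_cases i <;> simpa
  · have n0 : (b 0 : ℚ) ≠ 0 := by have := hb 0; positivity
    have n1 : (b 1 : ℚ) ≠ 0 := by have := hb 1; positivity
    have n2 : (b 2 : ℚ) ≠ 0 := by have := hb 2; positivity
    have hr' : ((w0 * (b 1 * b 2) + w1 * (b 0 * b 2) + w2 * (b 0 * b 1) + 1 : ℤ) : ℚ)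
        = ((b 0 * b 1 * b 2 * r : ℤ) : ℚ) := by rw [← hr]
    push_cast at hr'
    simp only [Fin.sum_univ_three, Fin.prod_univ_three, Matrix.cons_val]
    push_cast
    field_simp
    linarith

namespace BrieskornPlumbing

variable {b : Fin 3 → ℕ}

/-- The centre is `none`; `some ⟨i, r⟩` is the vertex number `r` on the leg `i`. -/
abbrev Vertex (P : BrieskornPlumbing b) : Type := Option (Σ i : Fin 3, Fin (P.leg i).length)

/-- The vertex `w` follows the vertex `v` on the way from the centre outwards. -/
def Next (P : BrieskornPlumbing b) : P.Vertex → P.Vertex → Prop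
  | none, some ⟨_, r⟩ => (r : ℕ) = 0
  | some ⟨i, r⟩, some ⟨i', r'⟩ => i = i' ∧ (r' : ℕ) = r + 1
  | _, none => False

/-- The star-shaped plumbing graph. -/
def plumbing (P : BrieskornPlumbing b) : Plumbing P.Vertex where
  graph := SimpleGraph.fromRel P.Next
  weight
    | none => P.e
    | some ⟨i, r⟩ => -(P.leg i).get r

/-- The vertex `v` is the last vertex of the leg `i`. -/
def IsEnd (P : BrieskornPlumbing b) (i : Fin 3) (v : P.Vertex) : Prop :=
  ∃ r : Fin (P.leg i).length, (r : ℕ) + 1 = (P.leg i).length ∧ v = some ⟨i, r⟩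

/-- `hᵢ`, the order of `H₁` of the plumbed manifold obtained by removing the end of the leg `i`. -/
def h (P : BrieskornPlumbing b) (i : Fin 3) : ℕ :=
  P.plumbing.homologyCard {v | ¬ P.IsEnd i v}

/-- The exponent `Δ`. -/
def Delta (P : BrieskornPlumbing b) : ℚ :=
  1 / 4 * ((∑ i, (P.h i : ℚ)) - 3 * (Fintype.card P.Vertex : ℚ)
    - ((∑ v, P.plumbing.weight v : ℤ) : ℚ)
    - (b 1 * b 2 : ℚ) / b 0 - (b 0 * b 2 : ℚ) / b 1 - (b 0 * b 1 : ℚ) / b 2)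

end BrieskornPlumbing

/-! ### The coefficients -/

/-- `p = b₀ b₁ b₂`. -/
def pNum (b : Fin 3 → ℕ) : ℕ := b 0 * b 1 * b 2

/-- The four integers `α`. -/
def alpha (b : Fin 3 → ℕ) : Fin 4 → ℤ :=
  ![(b 0 * b 1 * b 2 : ℤ) - b 0 * b 1 - b 0 * b 2 - b 1 * b 2,
    (b 0 * b 1 * b 2 : ℤ) + b 0 * b 1 - b 0 * b 2 - b 1 * b 2,
    (b 0 * b 1 * b 2 : ℤ) - b 0 * b 1 + b 0 * b 2 - b 1 * b 2,
    (b 0 * b 1 * b 2 : ℤ) + b 0 * b 1 + b 0 * b 2 - b 1 * b 2]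

/-- The integers by which the exponents of `t` are shifted: `α₁ + 2p, α₂, α₃, α₄ - 2p`. -/
def beta (b : Fin 3 → ℕ) : Fin 4 → ℤ :=
  ![alpha b 0 + 2 * pNum b, alpha b 1, alpha b 2, alpha b 3 - 2 * pNum b]

/-- `t ^ (m / 2p) + t ^ (-m / 2p)`; used only when `2p` divides `m`. -/
def tSum (b : Fin 3 → ℕ) (m : ℤ) (t : ℂ) : ℂ :=
  t ^ (m / (2 * pNum b : ℤ)) + t ^ (-(m / (2 * pNum b : ℤ)))

/-- The coefficients `φ(n; t)`. The eight residue classes `± α` modulo `2p` are distinct when the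
`bᵢ` are pairwise coprime and at least `2`. -/
def phi (b : Fin 3 → ℕ) (n : ℤ) (t : ℂ) : ℂ :=
  if n ≡ alpha b 0 [ZMOD 2 * pNum b] then -(1 / 2) * tSum b (n - beta b 0) t
  else if n ≡ -alpha b 0 [ZMOD 2 * pNum b] then 1 / 2 * tSum b (n + beta b 0) t
  else if n ≡ alpha b 1 [ZMOD 2 * pNum b] then 1 / 2 * tSum b (n - beta b 1) t
  else if n ≡ -alpha b 1 [ZMOD 2 * pNum b] then -(1 / 2) * tSum b (n + beta b 1) t
  else if n ≡ alpha b 2 [ZMOD 2 * pNum b] then 1 / 2 * tSum b (n - beta b 2) t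
  else if n ≡ -alpha b 2 [ZMOD 2 * pNum b] then -(1 / 2) * tSum b (n + beta b 2) t
  else if n ≡ alpha b 3 [ZMOD 2 * pNum b] then -(1 / 2) * tSum b (n - beta b 3) t
  else if n ≡ -alpha b 3 [ZMOD 2 * pNum b] then 1 / 2 * tSum b (n + beta b 3) t
  else 0

/-- `φ'(n; ζ)`, the value of `t ∂/∂t φ(n; t)` at `t = ζ`. -/
def phiDeriv (b : Fin 3 → ℕ) (n : ℤ) (ζ : ℂ) : ℂ := ζ * deriv (fun t => phi b n t) ζ

/-- The series `∑_{n ≥ 0} c(n) q ^ (n² / 4p)`. -/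
def qSeries (p : ℕ) (c : ℕ → ℂ) (τ : ℂ) : ℂ :=
  ∑' n : ℕ, c n * qpow ((n : ℚ) ^ 2 / (4 * p)) τ

/-- `A'_ζ(τ) = ∑_{n ≥ 0} φ'(n; ζ) q ^ (n² / 4p)`. -/
def ADeriv (b : Fin 3 → ℕ) (ζ τ : ℂ) : ℂ := qSeries (pNum b) (fun n => phiDeriv b n ζ) τ

/-- `C'`: it is `q ^ (1/120) (ζ - ζ⁻¹)` for the Poincaré sphere and `0` otherwise. -/
def CDeriv (b : Fin 3 → ℕ) (ζ τ : ℂ) : ℂ :=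
  if b 0 = 2 ∧ b 1 = 3 ∧ b 2 = 5 then qpow (1 / 120) τ * (ζ - ζ⁻¹) else 0

/-! ### Quantum modular forms -/

/-- `SL(2, ℤ)`. -/
abbrev SL2Z : Type := Matrix.SpecialLinearGroup (Fin 2) ℤ

/-- The factor `ε_d`, for odd `d`. -/
def epsFactor (d : ℤ) : ℂ := if d % 4 = 1 then 1 else Complex.I

/-- The Jacobi symbol `(c / d)` for odd `d`, in the usual extension to negative `d`:
`(c / d) = (c / |d|)`, up to a sign `-1` when `c` and `d` are both negative. -/
def thetaSymbol (c d : ℤ) : ℤ := (if c < 0 ∧ d < 0 then -1 else 1) * jacobiSym c d.natAbs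

/-- The value at the real point `x` of the branch of `√(cτ + d)` on the lower half-plane, in terms
of `y = cx + d`: the limit of the principal branch as `τ → x`, `Im τ < 0`. -/
def lowerSqrt (c : ℤ) (y : ℝ) : ℂ :=
  if 0 ≤ y then (Real.sqrt y : ℂ)
  else (if 0 < c then -Complex.I else Complex.I) * (Real.sqrt (-y) : ℂ)

theorem tendsto_sqrt_lowerSqrt (c d : ℤ) (hcd : c ≠ 0) (x : ℝ) :
    Tendsto (fun s : ℝ => ((c : ℂ) * ((x : ℂ) - s * Complex.I) + d) ^ (1 / 2 : ℂ))
      (𝓝[>] 0) (𝓝 (lowerSqrt c (c * x + d))) := by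
  set y : ℝ := c * x + d with hy
  have hz : ∀ s : ℝ, (c : ℂ) * ((x : ℂ) - s * Complex.I) + d = (y : ℂ) - (c * s : ℝ) * Complex.I := by
    intro s
    rw [hy]
    push_cast
    ring
  simp only [hz]
  have hcont : Tendsto (fun s : ℝ => (y : ℂ) - (c * s : ℝ) * Complex.I) (𝓝[>] 0) (𝓝 (y : ℂ)) := by
    have : Continuous fun s : ℝ => (y : ℂ) - (c * s : ℝ) * Complex.I := by fun_prop
    simpa using (this.tendsto 0).mono_left nhdsWithin_le_nhds
  have hsq : ∀ w : ℝ, 0 ≤ w → ((w : ℂ) ^ (1 / 2 : ℂ)) = (Real.sqrt w : ℂ) := by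
    intro w hw
    rw [Real.sqrt_eq_rpow, Complex.ofReal_cpow hw]
    norm_num
  unfold lowerSqrt
  rcases lt_trichotomy y 0 with hneg | hzero | hpos
  · rw [if_neg (not_le.mpr hneg)]
    have hlim : Tendsto (fun s : ℝ => (-((y : ℂ) - (c * s : ℝ) * Complex.I)) ^ (1 / 2 : ℂ))
        (𝓝[>] 0) (𝓝 (Real.sqrt (-y) : ℂ)) := by
      rw [← hsq (-y) (by linarith)]
      have h2 := hcont.neg
      rw [← Complex.ofReal_neg] at h2
      exact h2.cpow tendsto_const_nhds (Or.inl (by simpa using hneg))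
    have hexp : Complex.exp (Real.pi * Complex.I * (1 / 2)) = Complex.I := by
      rw [show (Real.pi * Complex.I * (1 / 2) : ℂ) = Real.pi / 2 * Complex.I by ring,
        Complex.exp_pi_div_two_mul_I]
    have hexp' : Complex.exp (-(Real.pi * Complex.I * (1 / 2))) = -Complex.I := by
      rw [Complex.exp_neg, hexp, Complex.inv_I]
    refine (hlim.const_mul (if 0 < c then -Complex.I else Complex.I)).congr' ?_
    filter_upwards [self_mem_nhdsWithin] with s hs
    have hs0 : (0 : ℝ) < s := hs
    set z : ℂ := (y : ℂ) - (c * s : ℝ) * Complex.I with hzd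
    have him : z.im = -(c * s) := by simp [hzd]
    have hz0 : z ≠ 0 := by
      intro h0
      have : z.re = y := by simp [hzd]
      rw [h0] at this
      simp at this
      linarith
    rw [Complex.cpow_def_of_ne_zero (neg_ne_zero.mpr hz0), Complex.cpow_def_of_ne_zero hz0]
    have hlog : ∀ w : ℂ, Complex.log w = Real.log ‖w‖ + w.arg * Complex.I := fun w => rfl
    by_cases hc : 0 < c
    · have hc' : (0 : ℝ) < c := by exact_mod_cast hc
      have h1 : z.im < 0 := by rw [him]; have := mul_pos hc' hs0; linarith
      rw [if_pos hc, hlog, hlog, norm_neg, Complex.arg_neg_eq_arg_add_pi_of_im_neg h1, ← hexp',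
        ← Complex.exp_add]
      congr 1
      push_cast
      ring
    · have hc' : (c : ℝ) < 0 := by exact_mod_cast lt_of_le_of_ne (not_lt.mp hc) hcd
      have h1 : 0 < z.im := by rw [him]; have := mul_neg_of_neg_of_pos hc' hs0; linarith
      rw [if_neg hc, hlog, hlog, norm_neg, Complex.arg_neg_eq_arg_sub_pi_of_im_pos h1]
      nth_rewrite 1 [← hexp]
      rw [← Complex.exp_add]
      congr 1
      push_cast
      ring
  · rw [if_pos hzero.ge, hzero, Real.sqrt_zero]
    rw [hzero] at hcont
    have h3 := (Complex.continuousAt_cpow_zero_of_re_pos (z := (1 / 2 : ℂ)) (by norm_num)).tendsto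
    have h4 := h3.comp (hcont.prodMk_nhds (tendsto_const_nhds (x := (1 / 2 : ℂ))))
    simpa [Function.comp_def] using h4
  · rw [if_pos hpos.le, ← hsq y hpos.le]
    exact hcont.cpow tendsto_const_nhds (Or.inl (by simpa using hpos))

/-- The action of `γ` on the rational point `x`; used only when `cx + d ≠ 0`. -/
def moebius (γ : SL2Z) (x : ℚ) : ℚ := (γ 0 0 * x + γ 0 1) / (γ 1 0 * x + γ 1 1)

/-- The slash operator `f|_{κ/2} γ` of weight `κ / 2` at rational points. -/
def slash (κ : ℕ) (f : ℚ → ℂ) (γ : SL2Z) (x : ℚ) : ℂ :=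
  (if Even κ then 1 else epsFactor (γ 1 1) ^ κ * (thetaSymbol (γ 1 0) (γ 1 1) : ℂ))
    * (lowerSqrt (γ 1 0) (γ 1 0 * x + γ 1 1) ^ κ)⁻¹ * f (moebius γ x)

/-- `f`, restricted to the set `Q` of rational numbers, is a quantum modular form of weight `κ / 2`
with multiplier `χ` for `Γ` and with quantum set `Q`: the set `Q` is closed under the action of `Γ`
(away from the point `i∞`), and for every `γ ∈ Γ` the function `h_γ = f - χ̄(γ) f|γ` on
`Q ∖ {γ⁻¹(i∞)}` extends to a smooth function on `ℝ` that is real-analytic on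
`ℝ ∖ {γ⁻¹(i∞)}`. -/
def IsQuantumModularForm (κ : ℕ) (χ : SL2Z → ℂ) (Γ : Subgroup SL2Z) (Q : Set ℚ) (f : ℚ → ℂ) :
    Prop :=
  (∀ γ ∈ Γ, ∀ x ∈ Q, (γ 1 0 : ℚ) * x + γ 1 1 ≠ 0 → moebius γ x ∈ Q) ∧
  ∀ γ ∈ Γ, ∃ h : ℝ → ℂ, ContDiff ℝ ∞ h ∧
    AnalyticOnNhd ℝ h {x : ℝ | (γ 1 0 : ℝ) * x + γ 1 1 ≠ 0} ∧
    ∀ x ∈ Q, (γ 1 0 : ℚ) * x + γ 1 1 ≠ 0 →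
      h (x : ℝ) = f x - (starRingEnd ℂ) (χ γ) * slash κ f γ x

/-- The function `F` on the upper half-plane has radial limits at all points of `Q`, and these form
a quantum modular form with quantum set `Q`. -/
def HasQuantumModularLimits (κ : ℕ) (χ : SL2Z → ℂ) (Γ : Subgroup SL2Z) (Q : Set ℚ) (F : ℂ → ℂ) :
    Prop :=
  ∃ f : ℚ → ℂ,
    (∀ x ∈ Q, Tendsto (fun s : ℝ => F ((x : ℂ) + s * Complex.I)) (𝓝[>] 0) (𝓝 (f x))) ∧
    IsQuantumModularForm κ χ Γ Q f

/-- The set of rational numbers that are `Γ₁(N)`-equivalent to `i∞`. -/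
def cuspInfty (N : ℕ) : Set ℚ :=
  {x | ∃ γ ∈ CongruenceSubgroup.Gamma1 N, γ 1 0 ≠ 0 ∧ x = (γ 0 0 : ℚ) / γ 1 0}

end BrieskornQM

end

/-!
Two independent parts meet in the theorem: an explicit evaluation of the series, and the quantum
modularity of partial theta series with periodic coefficients.

**The series.** Put `l = 2Mx + k - Mu`. The coefficient of the summand `x` vanishes unless `l` is `0` at
the vertices of degree two, a sign `ηᵢ` at the end of the leg `i`, and an odd number `2l₀ + 1` at the
centre. Since `M` is unimodular, every such vector occurs exactly once (`exists_reindex`). Completing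
the square gives the exponent of `q` in terms of the value of the form `M⁻¹` at `l`, hence in terms of
the entries of `M⁻¹` at the centre and at the ends of the legs. These are found by solving the
recursions along the legs with the continuants of the continued fractions (`mat_mul_invMat`), and the
diagonal ones are `-hᵢ`. The exponent becomes `Δ + N² / 4p` with
`N = p (2l₀ + 1) + ∑ ηᵢ p / bᵢ`. The map `(l₀, η) ↦ N` is injective with image the residue classes
`±αᵢ` modulo `2p`, and `φ(N; t)` is, up to the sign of `2l₀ + 1`, the sum of the contributions of `N`
and `-N` (`phi_latN`, `hasSum_phiDeriv`). That sign is the sign of `N`, except for `N = ±1` when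
`∑ 1 / bᵢ > 1`, that is for `(2, 3, 5)`; this is the correction `C'`. At a root of unity `ζ` the number
`φ'(N; ζ)` is a periodic function of `N` times an affine one, whence `χ` and `ψ`.

**Quantum modularity.** The partial theta series `∑_{n ≥ 0} χ(n) q^{n²/4p}` with `χ` odd is at
`τ = x + is` an integral of the theta series `θ = ∑ n χ(n) q^{n²/4p}` of weight `3/2` over the vertical
line above `x` (`qSeries_eq_integral`), so that its radial limit is the Eichler integral of `θ` with
endpoint `x`. For even `ψ` the same holds with `θ = ∑ ψ(n) q^{n²/4p}` of weight `1/2`, after an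
integration by parts. The transformation law of `θ` under `Γ(4pj²)`, with the Jacobi symbol as
multiplier, is derived from the two-variable theta function by the Euclidean algorithm (`thetaLaw`,
`thetaSeries_zero_moebius`, `thetaSeries_one_moebius`). It turns the defect of modularity into an
Eichler integral over the line above `γ⁻¹(i∞)` (`eichler_contour`), which is smooth, and real-analytic
off the endpoint (`contDiff_eichler`, `analyticOnNhd_eichler`). All integrals converge because `θ`
decays exponentially at the cusps in question: at every cusp when the coefficients are odd, and at those
equivalent to `i∞` in the sense of `cuspInfty` when they are even with `ψ(0) = 0`, since there the
relevant mean value is `ψ(0)`, up to a constant factor (`decaysAtCusp_thetaSeries_of_cusp`).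
-/

noncomputable section

namespace BrieskornQM

/-! ### Square roots on the two half-planes -/

/-- The principal branch of the complex square root. -/
def csqrt (z : ℂ) : ℂ := z ^ (1 / 2 : ℂ)

theorem csqrt_sq (z : ℂ) : csqrt z ^ 2 = z := by
  simp [csqrt]

theorem csqrt_ne_zero {z : ℂ} (hz : z ≠ 0) : csqrt z ≠ 0 := by
  intro h
  apply hz
  rw [← csqrt_sq z, h]
  simp

theorem csqrt_eq {z : ℂ} (hz : z ≠ 0) :
    csqrt z = Complex.exp ((Real.log ‖z‖ / 2 : ℝ) + (z.arg / 2 : ℝ) * I) := by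
  rw [csqrt, Complex.cpow_def_of_ne_zero hz, Complex.log]
  congr 1
  push_cast
  ring

theorem csqrt_re_nonneg (z : ℂ) : 0 ≤ (csqrt z).re := by
  by_cases hz : z = 0
  · simp [csqrt, hz]
  rw [csqrt_eq hz, Complex.exp_re]
  refine mul_nonneg (Real.exp_pos _).le (Real.cos_nonneg_of_mem_Icc ?_)
  have h1 := Complex.neg_pi_lt_arg z
  have h2 := Complex.arg_le_pi z
  constructor <;> simp <;> linarith

theorem csqrt_two_mul (z : ℂ) : 2 * (csqrt z).re * (csqrt z).im = z.im := by
  conv_rhs => rw [← csqrt_sq z]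
  rw [sq, Complex.mul_im]
  ring

theorem csqrt_re_pos {z : ℂ} (hz : z.im ≠ 0) : 0 < (csqrt z).re := by
  rcases (csqrt_re_nonneg z).lt_or_eq with h | h
  · exact h
  · have := csqrt_two_mul z
    rw [← h] at this
    simp at this
    exact absurd this.symm hz

theorem csqrt_im_pos {z : ℂ} (hz : 0 < z.im) : 0 < (csqrt z).im := by
  have h1 := csqrt_re_pos hz.ne'
  have h2 := csqrt_two_mul z
  by_contra h
  nlinarith

theorem csqrt_im_neg {z : ℂ} (hz : z.im < 0) : (csqrt z).im < 0 := by
  have h1 := csqrt_re_pos hz.ne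
  have h2 := csqrt_two_mul z
  by_contra h
  nlinarith

theorem csqrt_im_nonneg {z : ℂ} (hz : 0 ≤ z.im) : 0 ≤ (csqrt z).im := by
  rcases hz.lt_or_eq with h | h
  · exact (csqrt_im_pos h).le
  by_cases hz0 : z = 0
  · simp [csqrt, hz0]
  rw [csqrt_eq hz0, Complex.exp_im]
  refine mul_nonneg (Real.exp_pos _).le (Real.sin_nonneg_of_mem_Icc ?_)
  have h1 := Complex.arg_nonneg_iff.mpr h.le
  have h2 := Complex.arg_le_pi z
  constructor <;> simp <;> linarith [Real.pi_pos]

theorem csqrt_abs_im_lt {z : ℂ} (hz : 0 < z.re) : (csqrt z).im ^ 2 < (csqrt z).re ^ 2 := by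
  have : z.re = (csqrt z).re ^ 2 - (csqrt z).im ^ 2 := by
    conv_lhs => rw [← csqrt_sq z]
    rw [sq, Complex.mul_re]
    ring
  linarith

/-- If three numbers lie in the right half-plane and the product of the first two is the third, then
so it is for the square roots, provided that the first is in the upper half-plane. -/
theorem csqrt_mul_of_re_pos {a b c : ℂ} (hb : 0 < b.re) (hc : 0 < c.re) (ha : 0 < a.im)
    (h : a * b = c) : csqrt a * csqrt b = csqrt c := by
  have hsq : (csqrt a * csqrt b) ^ 2 = csqrt c ^ 2 := by rw [mul_pow, csqrt_sq, csqrt_sq, csqrt_sq, h]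
  rcases sq_eq_sq_iff_eq_or_eq_neg.mp hsq with h1 | h1
  · exact h1
  exfalso
  have a1 := csqrt_re_pos ha.ne'
  have b0 := csqrt_re_nonneg b
  have c0 := csqrt_re_nonneg c
  have b1 := csqrt_abs_im_lt hb
  have c1 := csqrt_abs_im_lt hc
  set A := csqrt a
  set B := csqrt b
  set C := csqrt c
  have h2 : A * (B * (starRingEnd ℂ) B) = -(C * (starRingEnd ℂ) B) := by
    rw [← mul_assoc, h1]; ring
  have h3 := congrArg Complex.re h2
  rw [Complex.mul_conj, mul_comm, Complex.re_ofReal_mul, Complex.normSq_apply] at h3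
  simp only [Complex.neg_re, Complex.mul_re, Complex.conj_re, Complex.conj_im] at h3
  have hB := abs_lt_of_sq_lt_sq b1 b0
  have hC := abs_lt_of_sq_lt_sq c1 c0
  rw [abs_lt] at hB hC
  have hB0 : 0 < B.re := by linarith
  have hpos : 0 < (B.re * B.re + B.im * B.im) * A.re :=
    mul_pos (add_pos_of_pos_of_nonneg (mul_pos hB0 hB0) (mul_self_nonneg _)) a1
  have : 0 < C.re * B.re + C.im * B.im := by
    nlinarith [mul_pos (sub_pos.mpr hC.2) (sub_pos.mpr hB.2),
      mul_pos (sub_pos.mpr hC.1) (sub_pos.mpr hB.1)]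
  linarith

/-- The sign in the convention for the Jacobi symbol `(c / d)`. -/
def negSign (c d : ℤ) : ℤ := if c < 0 ∧ d < 0 then -1 else 1

theorem negSign_mul_self (c d : ℤ) : negSign c d * negSign c d = 1 := by
  unfold negSign; split_ifs <;> rfl

theorem lin_im (c d : ℤ) (z : ℂ) : ((c : ℂ) * z + d).im = c * z.im := by
  simp

theorem lin_ne_zero {c d : ℤ} (hcd : c ≠ 0 ∨ d ≠ 0) {z : ℂ} (hz : 0 < z.im) : (c : ℂ) * z + d ≠ 0 := by
  intro h
  have h1 := congrArg Complex.im h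
  rw [lin_im] at h1
  simp at h1
  rcases h1 with h1 | h1
  · subst h1
    simp at h
    simp [h] at hcd
  · exact hz.ne' h1

theorem moebius_im (a b c d : ℤ) (z : ℂ) :
    (((a : ℂ) * z + b) / (c * z + d)).im = (a * d - b * c) * z.im / Complex.normSq (c * z + d) := by
  rw [Complex.div_im]
  simp only [Complex.add_re, Complex.add_im, Complex.mul_re, Complex.mul_im, Complex.intCast_re,
    Complex.intCast_im]
  ring

/-- The square roots of the automorphy factors of `γ` at `Vz`, of `V = (1 0; 4 1)` at `z` and of
`γV` at `z`: they are multiplicative up to the sign that occurs in the convention for the Jacobi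
symbol. -/
theorem csqrt_lin_mul {c d : ℤ} (hd : d ≠ 0) {z : ℂ} (hz : 0 < z.im) :
    csqrt (c * (z / (4 * z + 1)) + d) * csqrt (4 * z + 1)
      = (negSign c d * negSign (c + 4 * d) d : ℤ) * csqrt (((c + 4 * d : ℤ) : ℂ) * z + d) := by
  have h4 : (4 * z + 1) ≠ 0 := by
    have := lin_ne_zero (c := 4) (d := 1) (by simp) hz
    simpa using this
  have hV : 0 < (z / (4 * z + 1)).im := by
    have := moebius_im 1 0 4 1 z
    simp only [Int.cast_one, Int.cast_zero, one_mul, add_zero, Int.cast_ofNat] at this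
    rw [this]
    have := Complex.normSq_pos.mpr h4
    positivity
  set v := z / (4 * z + 1) with hv
  have hs : 0 < ((4 : ℂ) * z + 1).im := by simp [hz]
  have hs1 := csqrt_re_pos hs.ne'
  have hs2 := csqrt_im_pos hs
  set q := csqrt (c * v + d) with hq
  set s := csqrt (4 * z + 1)
  set r := csqrt (((c + 4 * d : ℤ) : ℂ) * z + d) with hr
  have hsq : (q * s) ^ 2 = r ^ 2 := by
    rw [mul_pow, csqrt_sq, csqrt_sq, csqrt_sq, hv, add_mul, mul_assoc, div_mul_cancel₀ _ h4]
    push_cast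
    ring
  have hq0 : q ≠ 0 := csqrt_ne_zero (lin_ne_zero (Or.inr hd) hV)
  have hre : (q * s).re = q.re * s.re - q.im * s.im := Complex.mul_re _ _
  have him : (q * s).im = q.re * s.im + q.im * s.re := Complex.mul_im _ _
  have q1 : 0 ≤ q.re := csqrt_re_nonneg _
  have r1 : 0 ≤ r.re := csqrt_re_nonneg _
  have qpos : 0 ≤ c → 0 < (q * s).im := fun hc => by
    have q2 : 0 ≤ q.im := csqrt_im_nonneg (by
      rw [lin_im]; exact mul_nonneg (by exact_mod_cast hc) hV.le)
    rw [him]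
    rcases q1.lt_or_eq with h | h
    · have := mul_pos h hs2
      have := mul_nonneg q2 hs1.le
      linarith
    · have h3 : q.im ≠ 0 := fun h3 => hq0 (Complex.ext h.symm h3)
      have := mul_pos (lt_of_le_of_ne q2 h3.symm) hs1
      rw [← h]
      linarith
  have qneg : c < 0 → 0 < (q * s).re := fun hc => by
    have hlt : ((c : ℂ) * v + d).im < 0 := by
      rw [lin_im]; exact mul_neg_of_neg_of_pos (by exact_mod_cast hc) hV
    have q2 := csqrt_im_neg hlt
    have q3 := csqrt_re_pos hlt.ne
    rw [hre]
    have := mul_pos q3 hs1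
    have := mul_neg_of_neg_of_pos q2 hs2
    linarith
  have rpos : 0 ≤ c + 4 * d → 0 ≤ r.im := fun hc => csqrt_im_nonneg (by
      rw [lin_im]; exact mul_nonneg (by exact_mod_cast hc) hz.le)
  have rneg : c + 4 * d < 0 → r.im < 0 := fun hc => csqrt_im_neg (by
      rw [lin_im]; exact mul_neg_of_neg_of_pos (by exact_mod_cast hc) hz)
  rcases sq_eq_sq_iff_eq_or_eq_neg.mp hsq with h1 | h1
  · suffices negSign c d * negSign (c + 4 * d) d = 1 by rw [this, h1]; simp
    by_cases hc : c < 0 <;> by_cases hd' : d < 0 <;> by_cases hc' : c + 4 * d < 0 <;>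
      simp only [negSign, hc, hd', hc', and_self, and_true, and_false, if_true, if_false] <;>
      try norm_num
    · omega
    · exfalso
      have := qpos (not_lt.mp hc)
      have := rneg hc'
      rw [h1] at *
      linarith
  · suffices negSign c d * negSign (c + 4 * d) d = -1 by rw [this, h1]; simp
    have e1 : (q * s).im = -r.im := by rw [h1]; simp
    have e2 : (q * s).re = -r.re := by rw [h1]; simp
    by_cases hc : c < 0 <;> by_cases hd' : d < 0 <;> by_cases hc' : c + 4 * d < 0 <;>
      simp only [negSign, hc, hd', hc', and_self, and_true, and_false, if_true, if_false] <;>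
      try norm_num
    all_goals first
      | (have := qneg hc; linarith)
      | (have := qpos (not_lt.mp hc); have := rpos (not_lt.mp hc'); linarith)
      | (exfalso; omega)

/-! ### The extended Jacobi symbol -/

theorem thetaSymbol_eq (c d : ℤ) : thetaSymbol c d = negSign c d * jacobiSym c d.natAbs := rfl

theorem thetaSymbol_add_four_mul (c d : ℤ) :
    thetaSymbol (c + 4 * d) d = negSign c d * negSign (c + 4 * d) d * thetaSymbol c d := by
  have : jacobiSym (c + 4 * d) d.natAbs = jacobiSym c d.natAbs := by
    apply jacobiSym.mod_left'
    apply Int.ModEq.symm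
    rw [Int.modEq_iff_dvd]
    simp
  rw [thetaSymbol_eq, thetaSymbol_eq, this]
  have := negSign_mul_self c d
  linear_combination (-negSign (c + 4 * d) d * jacobiSym c d.natAbs) * this

/-- Quadratic reciprocity in the form needed when the lower right entry changes its sign. -/
theorem jacobiSym_sub_self {C m : ℕ} (hC : 4 ∣ C) (hm : Odd m) (hmC : m < C) :
    jacobiSym C (C - m) = jacobiSym C m := by
  have hodd : Odd (C - m) := by
    have := Nat.odd_iff.mp hm
    rw [Nat.odd_iff]
    omega
  have h1 : jacobiSym C (C - m) = jacobiSym m (C - m) := by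
    apply jacobiSym.mod_left'
    apply Int.ModEq.symm
    rw [Int.modEq_iff_dvd, Nat.cast_sub hmC.le]
  have h2 : jacobiSym (C - m : ℕ) m = jacobiSym C m := by
    apply jacobiSym.mod_left'
    apply Int.ModEq.symm
    rw [Int.modEq_iff_dvd, Nat.cast_sub hmC.le]
    simp
  rw [h1, ← h2]
  have hm2 := Nat.odd_iff.mp hm
  have : m % 4 = 1 ∨ m % 4 = 3 := by omega
  rcases this with h | h
  · exact jacobiSym.quadratic_reciprocity_one_mod_four h hodd
  · exact (jacobiSym.quadratic_reciprocity_one_mod_four (by omega) hm).symm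

theorem jacobiSym_sub_self_neg {C m : ℕ} (hC : 4 ∣ C) (hm : Odd m) (hmC : m < C) :
    jacobiSym (-C) (C - m) = -jacobiSym (-C) m := by
  have hm2 := Nat.odd_iff.mp hm
  have hodd : Odd (C - m) := by rw [Nat.odd_iff]; omega
  rw [jacobiSym.neg _ hodd, jacobiSym.neg _ hm, jacobiSym_sub_self hC hm hmC]
  have : ZMod.χ₄ ((C - m : ℕ) : ZMod 4) = -ZMod.χ₄ (m : ZMod 4) := by
    have : m % 4 = 1 ∨ m % 4 = 3 := by omega
    rcases this with h | h
    · rw [ZMod.χ₄_nat_one_mod_four h, ZMod.χ₄_nat_three_mod_four (by omega)]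
    · rw [ZMod.χ₄_nat_three_mod_four h, ZMod.χ₄_nat_one_mod_four (by omega)]
      norm_num
  rw [this]
  ring

theorem jacobiSym_mod_natAbs {c : ℤ} (hc : 4 ∣ c) {m : ℕ} (hm : Odd m) :
    jacobiSym c (m + c.natAbs) = jacobiSym c m := by
  obtain ⟨c', rfl⟩ := hc
  have hm2 := Nat.odd_iff.mp hm
  have h4 : ∀ m : ℕ, m % 2 = 1 → jacobiSym (4 * c') m = jacobiSym c' m := fun m h => by
    have := jacobiSym.div_four_left (a := 4 * c') (b := m) (by omega) h
    rw [← this]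
    congr 1
    omega
  have e : (4 * c').natAbs = 4 * c'.natAbs := by rw [Int.natAbs_mul]; rfl
  rw [h4 _ hm2, h4 _ (by omega), jacobiSym.mod_right c' (b := m + _) (by rw [Nat.odd_iff]; omega),
    jacobiSym.mod_right c' hm, e, Nat.add_mod_right]

theorem thetaSymbol_add_natAbs {c d : ℤ} (hc : 4 ∣ c) (hd : Odd d) :
    thetaSymbol c (d + c.natAbs) = thetaSymbol c d := by
  have hd2 := Int.odd_iff.mp hd
  by_cases h1 : 0 < d
  · lift d to ℕ using h1.le
    have hdo : Odd d := by exact_mod_cast hd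
    have := jacobiSym_mod_natAbs hc hdo
    simp only [thetaSymbol]
    rw [← Nat.cast_add, Int.natAbs_natCast, this, Int.natAbs_natCast, if_neg (by omega),
      if_neg (by omega)]
  · obtain ⟨m, rfl⟩ : ∃ m : ℕ, d = -m := ⟨d.natAbs, by omega⟩
    have hm : Odd m := by rw [Nat.odd_iff]; omega
    by_cases h2 : m < c.natAbs
    · have hC : 4 ∣ c.natAbs := by omega
      have e : (-(m : ℤ) + c.natAbs).natAbs = c.natAbs - m := by omega
      simp only [thetaSymbol]
      rw [e, Int.natAbs_neg, Int.natAbs_natCast, if_neg (by omega)]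
      by_cases hc0 : c < 0
      · rw [if_pos (by omega)]
        have := jacobiSym_sub_self_neg hC hm h2
        rw [show (-(c.natAbs : ℤ)) = c by omega] at this
        rw [this]
        ring
      · rw [if_neg (by omega)]
        have := jacobiSym_sub_self hC hm h2
        rw [show (c.natAbs : ℤ) = c by omega] at this
        rw [this]
    · have h3 : m ≠ c.natAbs := by omega
      obtain ⟨l, hl⟩ : ∃ l, m = l + c.natAbs := ⟨m - c.natAbs, by omega⟩
      subst hl
      have hl : Odd l := by rw [Nat.odd_iff]; omega
      have := jacobiSym_mod_natAbs hc hl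
      simp only [thetaSymbol]
      rw [Int.natAbs_neg, Int.natAbs_natCast, this, show (-((l + c.natAbs : ℕ) : ℤ) + c.natAbs).natAbs = l by omega]
      congr 1
      by_cases hc0 : c < 0
      · rw [if_pos (by omega), if_pos (by omega)]
      · rw [if_neg (by omega), if_neg (by omega)]

/-- For `4 ∣ c` the extended symbol `(c / d)` depends on `d` modulo `c` only, across the sign change of
`d` as well. -/
theorem thetaSymbol_add {c d : ℤ} (hc : 4 ∣ c) (hd : Odd d) :
    thetaSymbol c (d + c) = thetaSymbol c d := by
  rcases le_total 0 c with h | h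
  · have := thetaSymbol_add_natAbs hc hd
    rwa [show (c.natAbs : ℤ) = c by omega] at this
  · have hd2 := Int.odd_iff.mp hd
    have := thetaSymbol_add_natAbs hc (d := d + c) (by rw [Int.odd_iff]; omega)
    rw [show (c.natAbs : ℤ) = -c by omega] at this
    rw [← this]
    congr 1
    ring

/-! ### The transformation law of the two-variable theta function -/

/-- The transformation law of `∑ e(n² z + n w)`, that is `jacobiTheta₂ w (2 z)`, under
`z ↦ (az + b) / (cz + d)`, `w ↦ w / (cz + d)`. -/
def ThetaLaw (a b c d : ℤ) : Prop :=
  ∀ z w : ℂ, 0 < z.im →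
    jacobiTheta₂ (w / (c * z + d)) (2 * ((a * z + b) / (c * z + d))) =
      thetaSymbol c d * (epsFactor d)⁻¹ * csqrt (c * z + d) *
        cexp (Real.pi * I * (c * w ^ 2 / (2 * (c * z + d)))) * jacobiTheta₂ w (2 * z)

theorem jacobiTheta₂_add_two_mul_int (w z : ℂ) (n : ℤ) :
    jacobiTheta₂ w (2 * (z + n)) = jacobiTheta₂ w (2 * z) := by
  have : Function.Periodic (jacobiTheta₂ w) 2 := fun τ => jacobiTheta₂_add_right w τ
  rw [mul_add, mul_comm 2 (n : ℂ)]
  exact this.int_mul n _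

theorem epsFactor_add_four_mul (d m : ℤ) : epsFactor (d + 4 * m) = epsFactor d := by
  simp [epsFactor]

/-- The transformation law is insensitive to multiplication by the translation `(1 1; 0 1)` from the
right. -/
theorem thetaLaw_mul_T (a b : ℤ) {c d : ℤ} (hc : 4 ∣ c) (hd : Odd d) :
    ThetaLaw a (b + a) c (d + c) ↔ ThetaLaw a b c d := by
  have h1 := thetaSymbol_add hc hd
  have h2 : epsFactor (d + c) = epsFactor d := by
    obtain ⟨m, rfl⟩ := hc
    exact epsFactor_add_four_mul d m
  have e1 : ∀ z : ℂ, (a : ℂ) * z + (b + a : ℤ) = a * (z + 1) + b := fun z => by push_cast; ring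
  have e2 : ∀ z : ℂ, (c : ℂ) * z + (d + c : ℤ) = c * (z + 1) + d := fun z => by push_cast; ring
  have e3 : ∀ w z : ℂ, jacobiTheta₂ w (2 * (z + 1)) = jacobiTheta₂ w (2 * z) := fun w z => by
    simpa using jacobiTheta₂_add_two_mul_int w z 1
  unfold ThetaLaw
  simp only [e1, e2, h1, h2]
  constructor
  · intro h z w hz
    have := h (z - 1) w (by simpa using hz)
    rw [← e3 w (z - 1), sub_add_cancel] at this
    exact this
  · intro h z w hz
    have := h (z + 1) w (by simpa using hz)
    rwa [e3] at this

/-- The case of the matrix `(1 0; 4 1)`, a consequence of the inversion formula. -/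
theorem jacobiTheta₂_lower (w z : ℂ) (hz : 0 < z.im) :
    jacobiTheta₂ (w / (4 * z + 1)) (2 * (z / (4 * z + 1))) =
      csqrt (4 * z + 1) * cexp (Real.pi * I * (4 * w ^ 2 / (2 * (4 * z + 1)))) *
        jacobiTheta₂ w (2 * z) := by
  have h4 : (4 * z + 1) ≠ 0 := by
    have := lin_ne_zero (c := 4) (d := 1) (by simp) hz
    simpa using this
  have hz0 : z ≠ 0 := by rintro rfl; simp at hz
  have hV : 0 < (z / (4 * z + 1)).im := by
    have := moebius_im 1 0 4 1 z
    simp only [Int.cast_one, Int.cast_zero, one_mul, add_zero, Int.cast_ofNat] at this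
    rw [this]
    have := Complex.normSq_pos.mpr h4
    positivity
  rw [jacobiTheta₂_functional_equation (w / (4 * z + 1)) (2 * (z / (4 * z + 1))),
    jacobiTheta₂_functional_equation w (2 * z)]
  have e1 : w / (4 * z + 1) / (2 * (z / (4 * z + 1))) = w / (2 * z) := by field_simp
  have e2 : -1 / (2 * (z / (4 * z + 1))) = 2 * (-1 / (4 * z) + (-1 : ℤ)) := by
    push_cast; field_simp; ring
  have e3 : -1 / (2 * z) = 2 * (-1 / (4 * z)) := by field_simp; ring
  rw [e1, e2, e3, jacobiTheta₂_add_two_mul_int]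
  have hs : csqrt (4 * z + 1) * csqrt (-I * (2 * (z / (4 * z + 1)))) = csqrt (-I * (2 * z)) := by
    apply csqrt_mul_of_re_pos
    · simpa using hV
    · simpa using hz
    · simpa using hz
    · field_simp
  have n1 : csqrt (-I * (2 * (z / (4 * z + 1)))) ≠ 0 := csqrt_ne_zero (by simp [hz0, h4])
  have n2 : csqrt (-I * (2 * z)) ≠ 0 := csqrt_ne_zero (by simp [hz0])
  have e4 : cexp (-Real.pi * I * (w / (4 * z + 1)) ^ 2 / (2 * (z / (4 * z + 1)))) =
      cexp (Real.pi * I * (4 * w ^ 2 / (2 * (4 * z + 1)))) * cexp (-Real.pi * I * w ^ 2 / (2 * z)) := by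
    rw [← Complex.exp_add]
    congr 1
    field_simp
    ring
  rw [e4]
  change 1 / csqrt _ * _ * _ = csqrt _ * _ * (1 / csqrt _ * _ * _)
  rw [← hs] at n2 ⊢
  have n3 := left_ne_zero_of_mul n2
  generalize csqrt (4 * z + 1) = A at *
  generalize csqrt (-I * (2 * (z / (4 * z + 1)))) = B at *
  field_simp

/-- The transformation law is insensitive to multiplication by `(1 0; 4 1)` from the right: the sign in
`csqrt_lin_mul` is the one by which the extended symbol changes. -/
theorem thetaLaw_mul_V (a b : ℤ) {c d : ℤ} (hd : d ≠ 0) :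
    ThetaLaw (a + 4 * b) b (c + 4 * d) d ↔ ThetaLaw a b c d := by
  have key : ∀ z w : ℂ, 0 < z.im →
      ((jacobiTheta₂ (w / ((c + 4 * d : ℤ) * z + d))
          (2 * (((a + 4 * b : ℤ) * z + b) / ((c + 4 * d : ℤ) * z + d))) =
        thetaSymbol (c + 4 * d) d * (epsFactor d)⁻¹ * csqrt ((c + 4 * d : ℤ) * z + d) *
          cexp (Real.pi * I * ((c + 4 * d : ℤ) * w ^ 2 / (2 * ((c + 4 * d : ℤ) * z + d)))) *
          jacobiTheta₂ w (2 * z)) ↔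
      (jacobiTheta₂ (w / (4 * z + 1) / (c * (z / (4 * z + 1)) + d))
          (2 * ((a * (z / (4 * z + 1)) + b) / (c * (z / (4 * z + 1)) + d))) =
        thetaSymbol c d * (epsFactor d)⁻¹ * csqrt (c * (z / (4 * z + 1)) + d) *
          cexp (Real.pi * I * (c * (w / (4 * z + 1)) ^ 2 / (2 * (c * (z / (4 * z + 1)) + d)))) *
          jacobiTheta₂ (w / (4 * z + 1)) (2 * (z / (4 * z + 1))))) := by
    intro z w hz
    have h4 : (4 * z + 1) ≠ 0 := by
      have := lin_ne_zero (c := 4) (d := 1) (by simp) hz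
      simpa using this
    have h5 : ((c + 4 * d : ℤ) : ℂ) * z + d ≠ 0 := lin_ne_zero (Or.inr hd) hz
    have h6 : (c : ℂ) * (z / (4 * z + 1)) + d = ((c + 4 * d : ℤ) * z + d) / (4 * z + 1) := by
      rw [mul_div_assoc', div_add' _ _ _ h4]; push_cast; ring
    have h7 : (a : ℂ) * (z / (4 * z + 1)) + b = ((a + 4 * b : ℤ) * z + b) / (4 * z + 1) := by
      rw [mul_div_assoc', div_add' _ _ _ h4]; push_cast; ring
    have hs := csqrt_lin_mul (c := c) hd hz
    rw [thetaSymbol_add_four_mul, jacobiTheta₂_lower w z hz]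
    push_cast at hs ⊢
    have e1 : cexp (Real.pi * I * (((c : ℂ) + 4 * d) * w ^ 2 / (2 * (((c : ℂ) + 4 * d) * z + d)))) =
        cexp (Real.pi * I * (c * (w / (4 * z + 1)) ^ 2 / (2 * (c * (z / (4 * z + 1)) + d)))) *
        cexp (Real.pi * I * (4 * w ^ 2 / (2 * (4 * z + 1)))) := by
      rw [← Complex.exp_add]
      congr 1
      rw [h6]
      push_cast at h5 ⊢
      field_simp
      ring
    rw [e1]
    push_cast at h6 h7 h5
    have e2 : w / (4 * z + 1) / (c * (z / (4 * z + 1)) + d) = w / ((c + 4 * d) * z + d) := by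
      rw [h6]; field_simp
    have e3 : (a * (z / (4 * z + 1)) + b) / (c * (z / (4 * z + 1)) + d) =
        ((a + 4 * b) * z + b) / ((c + 4 * d) * z + d) := by
      rw [h6, h7]; field_simp
    rw [e2, e3]
    have e4 : ∀ A E1 E2 ϑ q s r σ ε : ℂ, q * s = σ * r →
        σ * A * ε * r * (E1 * E2) * ϑ = A * ε * q * E1 * (s * E2 * ϑ) := by
      intro A E1 E2 ϑ q s r σ ε h
      linear_combination (-(A * ε * E1 * E2 * ϑ)) * h
    rw [e4 _ _ _ _ _ _ _ _ _ hs]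
  constructor
  · intro h z w hz
    have h4 : ((-4 : ℂ) * z + 1) ≠ 0 := by
      have := lin_ne_zero (c := -4) (d := 1) (by simp) hz
      simpa using this
    have hV : 0 < (z / ((-4 : ℂ) * z + 1)).im := by
      have := moebius_im 1 0 (-4) 1 z
      simp only [Int.cast_one, Int.cast_zero, one_mul, add_zero, Int.cast_ofNat, Int.cast_neg] at this
      rw [this]
      have := Complex.normSq_pos.mpr h4
      simp only [mul_neg, zero_mul, neg_zero, sub_zero, one_mul]
      positivity
    have e0 : 4 * (z / (-4 * z + 1)) + 1 = 1 / (-4 * z + 1) := by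
      rw [mul_div_assoc', div_add' _ _ _ h4]; ring
    have := (key (z / (-4 * z + 1)) (w / (-4 * z + 1)) hV).mp (h _ _ hV)
    rw [e0] at this
    have e5 : w / (-4 * z + 1) / (1 / (-4 * z + 1)) = w := by
      rw [div_div_div_cancel_right₀ h4, div_one]
    have e6 : z / (-4 * z + 1) / (1 / (-4 * z + 1)) = z := by
      rw [div_div_div_cancel_right₀ h4, div_one]
    rwa [e5, e6] at this
  · intro h z w hz
    have hV : 0 < (z / ((4 : ℂ) * z + 1)).im := by
      have h4 : (4 * z + 1) ≠ 0 := by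
        have := lin_ne_zero (c := 4) (d := 1) (by simp) hz
        simpa using this
      have := moebius_im 1 0 4 1 z
      simp only [Int.cast_one, Int.cast_zero, one_mul, add_zero, Int.cast_ofNat] at this
      rw [this]
      have := Complex.normSq_pos.mpr h4
      positivity
    exact (key z w hz).mpr (h _ _ hV)

theorem csqrt_neg_one : csqrt (-1) = I := by
  have h1 := csqrt_sq (-1)
  have h2 := csqrt_im_nonneg (z := -1) (by simp)
  have h3 : csqrt (-1) ^ 2 = I ^ 2 := by rw [h1, Complex.I_sq]
  rcases sq_eq_sq_iff_eq_or_eq_neg.mp h3 with h | h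
  · exact h
  · rw [h] at h2
    simp at h2
    linarith

/-- The transformation law for all matrices of `Γ₀(4)`, by the Euclidean algorithm on the lower
row. -/
theorem thetaLaw {a b c d : ℤ} (hdet : a * d - b * c = 1) (hc : 4 ∣ c) : ThetaLaw a b c d := by
  have hodd : Odd d := by
    obtain ⟨m, rfl⟩ := hc
    by_contra h
    rw [Int.not_odd_iff_even] at h
    obtain ⟨n, rfl⟩ := h
    have : 2 * (a * n - 2 * b * m) = 1 := by linear_combination hdet
    omega
  have hd2 := Int.odd_iff.mp hodd
  induction h : c.natAbs + d.natAbs using Nat.strong_induction_on generalizing a b c d with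
  | _ N ih =>
    by_cases hc0 : c = 0
    · subst hc0
      have had : a * d = 1 := by linarith
      rcases Int.eq_one_or_neg_one_of_mul_eq_one' had with ⟨rfl, rfl⟩ | ⟨rfl, rfl⟩
      · intro z w hz
        have h1 : thetaSymbol 0 1 = 1 := by simp [thetaSymbol]
        have h2 : csqrt 1 = 1 := by simp [csqrt]
        have := jacobiTheta₂_add_two_mul_int w z b
        simp [h1, h2, epsFactor, this]
      · intro z w hz
        have h1 : thetaSymbol 0 (-1) = 1 := by simp [thetaSymbol]
        have h3 : epsFactor (-1) = I := by simp [epsFactor]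
        have := jacobiTheta₂_add_two_mul_int w z (-b)
        push_cast at this
        rw [h1, h3]
        simp only [Int.cast_zero, zero_mul, zero_add, Int.cast_neg, Int.cast_one, csqrt_neg_one,
          div_neg, div_one, jacobiTheta₂_neg_left, mul_neg, zero_div, mul_zero, neg_zero,
          Complex.exp_zero, mul_one, one_mul, inv_mul_cancel₀ Complex.I_ne_zero]
        rw [← this]
        congr 1
        ring
    · by_cases hlt : c.natAbs < 2 * d.natAbs
      · -- the entry `d` can be made smaller by adding or subtracting `c`
        by_cases hs : 0 < c ↔ 0 < d
        · have := ih (c.natAbs + (d - c).natAbs) (by omega) (a := a) (b := b - a) (c := c) (d := d - c)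
            (by linear_combination hdet) hc (by rw [Int.odd_iff]; omega) (by omega) rfl
          rw [← thetaLaw_mul_T a (b - a) hc (by rw [Int.odd_iff]; omega)] at this
          simpa using this
        · have := ih (c.natAbs + (d + c).natAbs) (by omega) (a := a) (b := b + a) (c := c) (d := d + c)
            (by linear_combination hdet) hc (by rw [Int.odd_iff]; omega) (by omega) rfl
          rwa [thetaLaw_mul_T a b hc hodd] at this
      · -- the entry `c` can be made smaller by adding or subtracting `4 d`
        have hd0 : d ≠ 0 := by omega
        by_cases hs : 0 < c ↔ 0 < d
        · have := ih ((c - 4 * d).natAbs + d.natAbs) (by omega) (a := a - 4 * b) (b := b)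
            (c := c - 4 * d) (d := d)
            (by linear_combination hdet) (by omega) hodd (by omega) rfl
          rw [← thetaLaw_mul_V _ _ hd0] at this
          simpa using this
        · have := ih ((c + 4 * d).natAbs + d.natAbs) (by omega) (a := a + 4 * b) (b := b)
            (c := c + 4 * d) (d := d)
            (by linear_combination hdet) (by omega) hodd (by omega) rfl
          rwa [thetaLaw_mul_V _ _ hd0] at this

/-! ### Theta series with periodic coefficients under a principal congruence subgroup -/

theorem lin_ne_zero_of_det {a b c d : ℤ} (hdet : a * d - b * c = 1) {z : ℂ} (hz : 0 < z.im) :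
    (c : ℂ) * z + d ≠ 0 := by
  apply lin_ne_zero _ hz
  by_contra! h0
  rw [h0.1, h0.2] at hdet
  simp at hdet

theorem moebius_im_pos {a b c d : ℤ} (hdet : a * d - b * c = 1) {z : ℂ} (hz : 0 < z.im) :
    0 < (((a : ℂ) * z + b) / (c * z + d)).im := by
  rw [moebius_im]
  have h1 := Complex.normSq_pos.mpr (lin_ne_zero_of_det hdet hz)
  have h2 : (a : ℝ) * d - b * c = 1 := by exact_mod_cast hdet
  rw [h2]
  positivity

theorem jacobiTheta₂_add_int_mul (W τ : ℂ) (l m : ℤ) :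
    jacobiTheta₂ (W + l * τ + m) τ =
      cexp (-(2 * Real.pi * I * (l ^ 2 * τ / 2 + l * W))) * jacobiTheta₂ W τ := by
  conv_rhs => rw [jacobiTheta₂, ← tsum_mul_left, ← (Equiv.addRight l).tsum_eq]
  refine tsum_congr fun n => ?_
  simp_rw [jacobiTheta₂_term, ← Complex.exp_add, Equiv.coe_addRight, Int.cast_add]
  rw [Complex.exp_eq_exp_iff_exists_int]
  refine ⟨n * m, ?_⟩
  push_cast
  ring

theorem jacobiSym_eq_one_of_mod {D : ℕ} (hD : 0 < D) {d : ℤ} (hd : d ≡ 1 [ZMOD 4 * D]) :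
    jacobiSym D d.natAbs = 1 := by
  obtain ⟨s, hs⟩ := hd.symm.dvd
  have hd2 : d % 2 = 1 := by
    have : d = 1 + 2 * (2 * D * s) := by linarith
    omega
  have hodd : Odd d.natAbs := by rw [Nat.odd_iff]; omega
  have h1 := jacobiSym.mod_right' D hodd
  rw [h1]
  by_cases hd0 : 0 < d
  · have : d.natAbs % (4 * D) = 1 := by
      have h2 : (d.natAbs : ℤ) ≡ 1 [ZMOD ((4 * D : ℕ) : ℤ)] := by
        rw [show (d.natAbs : ℤ) = d by omega]; exact_mod_cast hd
      have h3 : d.natAbs ≡ 1 [MOD 4 * D] := (Int.natCast_modEq_iff).mp (by exact_mod_cast h2)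
      rw [h3, Nat.mod_eq_of_lt (by omega)]
    rw [this, jacobiSym.one_right]
  · have : d.natAbs % (4 * D) = 4 * D - 1 := by
      have h2 : (d.natAbs : ℤ) ≡ ((4 * D - 1 : ℕ) : ℤ) [ZMOD ((4 * D : ℕ) : ℤ)] := by
        rw [show (d.natAbs : ℤ) = -d by omega, Int.modEq_iff_dvd]
        push_cast [Nat.cast_sub (show 1 ≤ 4 * D by omega)]
        exact ⟨1 + s, by linear_combination hs⟩
      have h3 : d.natAbs ≡ 4 * D - 1 [MOD 4 * D] := (Int.natCast_modEq_iff).mp (by exact_mod_cast h2)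
      rw [h3, Nat.mod_eq_of_lt (by omega)]
    rw [this]
    have h4 := jacobiSym.div_four_left (a := 4 * D) (b := 4 * D - 1) (by omega) (by omega)
    rw [Int.mul_ediv_cancel_left _ (by norm_num)] at h4
    rw [h4, ← jacobiSym.one_left (4 * D - 1)]
    apply jacobiSym.mod_left'
    apply Int.ModEq.symm
    rw [Int.modEq_iff_dvd, Nat.cast_sub (by omega)]
    push_cast
    exact dvd_rfl

theorem thetaSymbol_mul_left {D : ℕ} (hD : 0 < D) (c : ℤ) {d : ℤ} (hd : d ≡ 1 [ZMOD 4 * D]) :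
    thetaSymbol (D * c) d = thetaSymbol c d := by
  have h1 : ((D : ℤ) * c < 0 ∧ d < 0) ↔ (c < 0 ∧ d < 0) := by
    have : (0 : ℤ) < D := by exact_mod_cast hD
    rw [mul_neg_iff]
    simp only [this, this.not_gt, true_and, false_and, or_false]
  simp only [thetaSymbol, h1, jacobiSym.mul_left, jacobiSym_eq_one_of_mod hD hd, one_mul]

/-- The sum `∑ e(n² z / 4p + n w)` over the class of `h` modulo `2pj`. -/
def classTheta (p j : ℕ) (h : ℤ) (z w : ℂ) : ℂ :=
  cexp (2 * Real.pi * I * (h ^ 2 * z / (4 * p) + h * w)) *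
    jacobiTheta₂ (h * j * z + 2 * p * j * w) (2 * (p * j ^ 2 * z))

/-- The classes modulo `2pj` are fixed by `Γ(4pj²)`, so that each of the sums transforms by itself. The
sum over a class is `jacobiTheta₂` at a multiple of `z`; conjugation by that multiple turns the given
matrix into one of `Γ₀(4)`, to which `thetaLaw` applies. -/
theorem classTheta_moebius {p j : ℕ} (hp : 0 < p) (hj : 0 < j) (h : ℤ) {a b c d : ℤ}
    (hdet : a * d - b * c = 1) (ha : a ≡ 1 [ZMOD 4 * (p * j ^ 2 : ℕ)])
    (hd : d ≡ 1 [ZMOD 4 * (p * j ^ 2 : ℕ)]) (hb : 4 * ((p * j ^ 2 : ℕ) : ℤ) ∣ b)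
    (hc : 4 * ((p * j ^ 2 : ℕ) : ℤ) ∣ c) {z : ℂ} (hz : 0 < z.im) (w : ℂ) :
    classTheta p j h ((a * z + b) / (c * z + d)) (w / (c * z + d)) =
      thetaSymbol c d * csqrt (c * z + d) * cexp (2 * Real.pi * I * (p * c * w ^ 2 / (c * z + d))) *
        classTheta p j h z w := by
  set D : ℕ := p * j ^ 2 with hD
  have hD0 : 0 < D := by positivity
  obtain ⟨a', ha'⟩ := ha.symm.dvd
  obtain ⟨b', hb'⟩ := hb
  obtain ⟨c', hc'⟩ := hc
  have hu := lin_ne_zero_of_det hdet hz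
  have heps : epsFactor d = 1 := by
    obtain ⟨s, hs⟩ := hd.symm.dvd
    rw [show d = 1 + 4 * (D * s) by linarith, epsFactor_add_four_mul]
    simp [epsFactor]
  have hDz : 0 < ((D : ℂ) * z).im := by
    rw [← Complex.ofReal_natCast, Complex.im_ofReal_mul]; positivity
  have hlaw := thetaLaw (a := a) (b := D * b) (c := 4 * c') (d := d)
    (by rw [← hdet, hc']; ring) ⟨c', rfl⟩ (D * z) (h * j * (a * z + b) + 2 * p * j * w) hDz
  have hsym : thetaSymbol (4 * c') d = thetaSymbol c d := by
    rw [show c = D * (4 * c') by rw [hc']; ring, thetaSymbol_mul_left hD0 _ hd]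
  have hcC : (c : ℂ) = D * ((4 * c' : ℤ) : ℂ) := by rw [hc']; push_cast; ring
  have e1 : ((4 * c' : ℤ) : ℂ) * (D * z) + d = c * z + d := by rw [hcC]; ring
  have e2 : (a : ℂ) * (D * z) + (D * b : ℤ) = D * (a * z + b) := by push_cast; ring
  rw [e1, e2, hsym, heps] at hlaw
  have haC : (a : ℂ) = 1 + 4 * D * a' := by
    have : a = 1 + 4 * D * a' := by linarith
    rw [this]; push_cast; ring
  have hDC : (D : ℂ) = p * j ^ 2 := by rw [hD]; push_cast; ring
  -- the argument differs from the one of the right-hand side by a period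
  have e3 : (h : ℂ) * j * (a * z + b) + 2 * p * j * w
      = (h * j * z + 2 * p * j * w) + ((2 * h * j * a' : ℤ) : ℂ) * (2 * (D * z)) + ((h * j * b : ℤ) : ℂ) := by
    rw [haC]; push_cast; ring
  have e4 := jacobiTheta₂_add_int_mul (h * j * z + 2 * p * j * w) (2 * (D * z)) (2 * h * j * a') (h * j * b)
  rw [← e3] at e4
  rw [e4] at hlaw
  have e5 : ((h : ℂ) * j * (a * z + b) + 2 * p * j * w) / (c * z + d)
      = h * j * ((a * z + b) / (c * z + d)) + 2 * p * j * (w / (c * z + d)) := by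
    field_simp
  have e6 : (2 : ℂ) * (D * (a * z + b) / (c * z + d)) = 2 * (p * j ^ 2 * ((a * z + b) / (c * z + d))) := by
    rw [hDC]; ring
  rw [e5, e6] at hlaw
  unfold classTheta
  rw [hlaw, hDC]
  have hp0 : (p : ℂ) ≠ 0 := by exact_mod_cast hp.ne'
  have hj0 : (j : ℂ) ≠ 0 := by exact_mod_cast hj.ne'
  have hexp : cexp (2 * Real.pi * I * (h ^ 2 * ((a * z + b) / (c * z + d)) / (4 * p) + h * (w / (c * z + d)))) *
      (cexp (Real.pi * I * (((4 * c' : ℤ) : ℂ) * (h * j * (a * z + b) + 2 * p * j * w) ^ 2 /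
        (2 * (c * z + d)))) *
      cexp (-(2 * Real.pi * I * ((2 * h * j * a' : ℤ) ^ 2 * (2 * (p * j ^ 2 * z)) / 2 +
        (2 * h * j * a' : ℤ) * (h * j * z + 2 * p * j * w))))) =
      cexp (2 * Real.pi * I * (p * c * w ^ 2 / (c * z + d))) *
      cexp (2 * Real.pi * I * (h ^ 2 * z / (4 * p) + h * w)) := by
    rw [← Complex.exp_add, ← Complex.exp_add, ← Complex.exp_add, Complex.exp_eq_exp_iff_exists_int]
    refine ⟨h ^ 2 * j ^ 2 * a * b', ?_⟩
    have hv : 1 + (c : ℂ) * (a * z + b) = a * (c * z + d) := by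
      have : (a : ℂ) * d - b * c = 1 := by exact_mod_cast hdet
      linear_combination -this
    have hcC' : ((4 * c' : ℤ) : ℂ) = c / (p * j ^ 2) := by
      rw [hcC, hDC]; field_simp
    have hsq : (c : ℂ) * (h * j * (a * z + b) + 2 * p * j * w) ^ 2 =
        (h ^ 2 * j ^ 2 * (a * z + b) + 4 * h * j * p * j * w) * (a * (c * z + d) - 1)
          + 4 * c * p ^ 2 * j ^ 2 * w ^ 2 := by
      linear_combination (h ^ 2 * j ^ 2 * (a * z + b) + 4 * h * j * p * j * w) * hv
    have hbC : (b : ℂ) = 4 * (p * j ^ 2) * b' := by rw [hb']; push_cast; rw [hDC]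
    rw [hcC', div_mul_eq_mul_div, hsq]
    rw [hDC] at haC
    have ha2 : (a' : ℂ) = (a - 1) / (4 * (p * j ^ 2)) := by rw [haC]; field_simp; ring
    have hb2 : (b' : ℂ) = b / (4 * (p * j ^ 2)) := by rw [hbC]; field_simp
    push_cast
    rw [ha2, hb2]
    generalize (c : ℂ) * z + d = u at *
    field_simp
    ring
  linear_combination (thetaSymbol c d * csqrt (c * z + d) *
    jacobiTheta₂ (h * j * z + 2 * p * j * w) (2 * (p * j ^ 2 * z))) * hexp

/-- A sum with periodic coefficients is a combination of sums over residue classes. -/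
theorem hasSum_periodic_mul {N : ℕ} (hN : 0 < N) {c : ℤ → ℂ} (hc : Function.Periodic c (N : ℤ))
    {f : ℤ → ℂ} {S : ℕ → ℂ} (h : ∀ r : ℕ, HasSum (fun m : ℤ => f (r + N * m)) (S r)) :
    HasSum (fun n => c n * f n) (∑ r ∈ Finset.range N, c r * S r) := by
  have h1 : ∀ r ∈ Finset.range N,
      HasSum (fun n : ℤ => c r * (if n % N = r then f n else 0)) (c r * S r) := by
    intro r hr
    refine HasSum.mul_left _ ?_
    have hinj : Function.Injective fun m : ℤ => (r : ℤ) + N * m := by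
      intro m m' hm
      have hN' : (N : ℤ) ≠ 0 := by exact_mod_cast hN.ne'
      exact mul_left_cancel₀ hN' (add_left_cancel hm)
    rw [← hinj.hasSum_iff]
    · refine (h r).congr_fun fun m => ?_
      have : ((r : ℤ) + N * m) % N = r := by
        rw [Int.add_mul_emod_self_left]
        exact Int.emod_eq_of_lt (by positivity) (by exact_mod_cast Finset.mem_range.mp hr)
      simp only [Function.comp, this, if_true]
    · intro n hn
      rw [if_neg]
      intro h0
      apply hn
      exact ⟨n / N, by rw [← h0]; exact Int.emod_add_mul_ediv n N⟩
  refine (hasSum_sum h1).congr_fun ?_ |> id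
  intro n
  have hN' : (0 : ℤ) < N := by exact_mod_cast hN
  have h2 : ((n % N).toNat : ℤ) = n % N := Int.toNat_of_nonneg (Int.emod_nonneg _ hN'.ne')
  rw [Finset.sum_eq_single (n % N).toNat]
  · rw [if_pos h2.symm, h2]
    congr 1
    have := hc.int_mul (n / N) (n % N)
    rw [← this]
    congr 1
    rw [mul_comm]
    exact Int.emod_add_mul_ediv n N |>.symm
  · intro r _ hr
    rw [if_neg, mul_zero]
    intro h3
    apply hr
    omega
  · intro h3
    exfalso
    apply h3
    rw [Finset.mem_range]
    have := Int.emod_lt_of_pos n hN'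
    omega

/-- The derivative of `classTheta` with respect to `w` at `w = 0`. -/
def classThetaDeriv (p j : ℕ) (h : ℤ) (z : ℂ) : ℂ :=
  cexp (2 * Real.pi * I * (h ^ 2 * z / (4 * p))) *
    (2 * Real.pi * I * h * jacobiTheta₂ (h * j * z) (2 * (p * j ^ 2 * z)) +
      2 * p * j * jacobiTheta₂' (h * j * z) (2 * (p * j ^ 2 * z)))

theorem im_two_mul_pos {p j : ℕ} (hp : 0 < p) (hj : 0 < j) {z : ℂ} (hz : 0 < z.im) :
    0 < (2 * ((p : ℂ) * j ^ 2 * z)).im := by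
  have : (2 * ((p : ℂ) * j ^ 2 * z)) = ((2 * (p * j ^ 2) : ℝ) : ℂ) * z := by push_cast; ring
  rw [this, Complex.im_ofReal_mul]
  positivity

theorem hasDerivAt_classTheta {p j : ℕ} (hp : 0 < p) (hj : 0 < j) (h : ℤ) {z : ℂ} (hz : 0 < z.im) :
    HasDerivAt (classTheta p j h z) (classThetaDeriv p j h z) 0 := by
  have h1 : HasDerivAt (fun w : ℂ => (h : ℂ) * j * z + 2 * p * j * w) (2 * p * j) 0 := by
    simpa using ((hasDerivAt_id (0 : ℂ)).const_mul (2 * p * j : ℂ)).const_add ((h : ℂ) * j * z)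
  have h2 : HasDerivAt (fun w => jacobiTheta₂ ((h : ℂ) * j * z + 2 * p * j * w) (2 * (p * j ^ 2 * z)))
      (jacobiTheta₂' (h * j * z) (2 * (p * j ^ 2 * z)) * (2 * p * j)) 0 := by
    have := hasDerivAt_jacobiTheta₂_fst ((h : ℂ) * j * z + 2 * p * j * 0) (im_two_mul_pos hp hj hz)
    have := HasDerivAt.comp (0 : ℂ) this h1
    simpa [Function.comp_def] using this
  have h3 : HasDerivAt (fun w : ℂ => cexp (2 * Real.pi * I * (h ^ 2 * z / (4 * p) + h * w)))
      (cexp (2 * Real.pi * I * (h ^ 2 * z / (4 * p))) * (2 * Real.pi * I * h)) 0 := by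
    have : HasDerivAt (fun w : ℂ => 2 * Real.pi * I * (h ^ 2 * z / (4 * p) + h * w))
        (2 * Real.pi * I * h) 0 := by
      simpa using (((hasDerivAt_id (0 : ℂ)).const_mul (h : ℂ)).const_add
        ((h : ℂ) ^ 2 * z / (4 * p))).const_mul (2 * Real.pi * I)
    simpa using this.cexp
  have h4 := h3.mul h2
  simp only [mul_zero, add_zero] at h4
  refine h4.congr_deriv ?_
  unfold classThetaDeriv
  ring

theorem hasSum_classTheta {p j : ℕ} (hp : 0 < p) (hj : 0 < j) (h : ℕ) {z : ℂ} (hz : 0 < z.im) :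
    HasSum (fun m : ℤ => cexp (2 * Real.pi * I * (((h + (2 * p * j : ℕ) * m : ℤ) : ℂ) ^ 2 * z / (4 * p))))
      (classTheta p j h z 0) := by
  have := (hasSum_jacobiTheta₂_term ((h : ℂ) * j * z) (im_two_mul_pos hp hj hz)).mul_left
    (cexp (2 * Real.pi * I * (h ^ 2 * z / (4 * p))))
  simp only [classTheta, mul_zero, add_zero, Int.cast_natCast]
  refine this.congr_fun fun m => ?_
  have hp0 : (p : ℂ) ≠ 0 := by exact_mod_cast hp.ne'
  rw [jacobiTheta₂_term, ← Complex.exp_add]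
  congr 1
  push_cast
  field_simp
  ring

theorem hasSum_classThetaDeriv {p j : ℕ} (hp : 0 < p) (hj : 0 < j) (h : ℕ) {z : ℂ} (hz : 0 < z.im) :
    HasSum (fun m : ℤ => ((h + (2 * p * j : ℕ) * m : ℤ) : ℂ) *
        cexp (2 * Real.pi * I * (((h + (2 * p * j : ℕ) * m : ℤ) : ℂ) ^ 2 * z / (4 * p))))
      (classThetaDeriv p j h z / (2 * Real.pi * I)) := by
  have h1 := (hasSum_jacobiTheta₂_term ((h : ℂ) * j * z) (im_two_mul_pos hp hj hz)).mul_left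
    (2 * Real.pi * I * h)
  have h2 := (hasSum_jacobiTheta₂'_term ((h : ℂ) * j * z) (im_two_mul_pos hp hj hz)).mul_left
    (2 * p * j : ℂ)
  have h3 := ((h1.add h2).mul_left (cexp (2 * Real.pi * I * (h ^ 2 * z / (4 * p))))).div_const
    (2 * Real.pi * I)
  simp only [classThetaDeriv, Int.cast_natCast]
  refine h3.congr_fun fun m => ?_
  have hp0 : (p : ℂ) ≠ 0 := by exact_mod_cast hp.ne'
  have hπ : (Real.pi : ℂ) ≠ 0 := by exact_mod_cast Real.pi_ne_zero
  have : cexp (2 * Real.pi * I * (((h + (2 * p * j : ℕ) * m : ℤ) : ℂ) ^ 2 * z / (4 * p))) =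
      cexp (2 * Real.pi * I * (h ^ 2 * z / (4 * p))) *
        jacobiTheta₂_term m (h * j * z) (2 * (p * j ^ 2 * z)) := by
    rw [jacobiTheta₂_term, ← Complex.exp_add]
    congr 1
    push_cast
    field_simp
    ring
  rw [this, jacobiTheta₂'_term]
  push_cast
  field_simp

/-- Differentiation of the law in `w` at `w = 0` raises the weight from `1/2` to `3/2`; the factor
`exp (c w² / …)` is stationary there. -/
theorem classThetaDeriv_moebius {p j : ℕ} (hp : 0 < p) (hj : 0 < j) (h : ℤ) {a b c d : ℤ}
    (hdet : a * d - b * c = 1) (ha : a ≡ 1 [ZMOD 4 * (p * j ^ 2 : ℕ)])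
    (hd : d ≡ 1 [ZMOD 4 * (p * j ^ 2 : ℕ)]) (hb : 4 * ((p * j ^ 2 : ℕ) : ℤ) ∣ b)
    (hc : 4 * ((p * j ^ 2 : ℕ) : ℤ) ∣ c) {z : ℂ} (hz : 0 < z.im) :
    classThetaDeriv p j h ((a * z + b) / (c * z + d)) =
      thetaSymbol c d * csqrt (c * z + d) ^ 3 * classThetaDeriv p j h z := by
  have hu := lin_ne_zero_of_det hdet hz
  have hγ := moebius_im_pos hdet hz
  have h1 := hasDerivAt_classTheta hp hj h hγ
  have h2 := hasDerivAt_classTheta hp hj h hz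
  have h3 : HasDerivAt (fun w : ℂ => w / (c * z + d)) (1 / (c * z + d)) 0 :=
    (hasDerivAt_id (0 : ℂ)).div_const _
  have h4 := HasDerivAt.comp (0 : ℂ) (by simpa using h1) h3
  have h5 : HasDerivAt (fun w : ℂ => cexp (2 * Real.pi * I * (p * c * w ^ 2 / (c * z + d)))) 0 0 := by
    have : HasDerivAt (fun w : ℂ => 2 * Real.pi * I * (p * c * w ^ 2 / (c * z + d))) 0 0 := by
      have := ((((hasDerivAt_id (0 : ℂ)).pow 2).const_mul (p * c : ℂ)).div_const
        (c * z + d)).const_mul (2 * Real.pi * I)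
      simpa using this
    simpa using this.cexp
  have h6 := (h5.mul h2).const_mul (thetaSymbol c d * csqrt (c * z + d))
  have h7 : (classTheta p j h ((a * z + b) / (c * z + d)) ∘ fun w => w / (c * z + d)) =
      fun w => thetaSymbol c d * csqrt (c * z + d) *
        ((fun w => cexp (2 * Real.pi * I * (p * c * w ^ 2 / (c * z + d)))) * classTheta p j h z) w := by
    funext w
    simp only [Function.comp, Pi.mul_apply]
    rw [classTheta_moebius hp hj h hdet ha hd hb hc hz w]
    ring
  rw [h7] at h4
  have h8 := h4.unique h6
  have h9 := csqrt_sq (c * z + d)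
  simp at h8
  have : classThetaDeriv p j h ((a * z + b) / (c * z + d)) =
      (thetaSymbol c d * csqrt (c * z + d) * classThetaDeriv p j h z) * (c * z + d) := by
    rw [← h8, inv_mul_cancel_right₀ hu]
  rw [this]
  conv_lhs => rw [← h9]
  rw [h9]
  linear_combination (-thetaSymbol c d * csqrt (c * z + d) * classThetaDeriv p j h z) * h9

/-- The theta series `∑ n^ν c(n) q ^ (n² / 4p)` over all integers. It is modular for
`ν = 0` and `ν = 1`, of weight `ν + 1/2`. -/
def thetaSeries (p ν : ℕ) (c : ℤ → ℂ) (z : ℂ) : ℂ :=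
  ∑' n : ℤ, c n * ((n : ℂ) ^ ν * cexp (2 * Real.pi * I * ((n : ℂ) ^ 2 * z / (4 * p))))

theorem thetaSeries_zero_moebius {p j : ℕ} (hp : 0 < p) (hj : 0 < j) {c' : ℤ → ℂ}
    (hper : Function.Periodic c' ((2 * p * j : ℕ) : ℤ)) {a b c d : ℤ}
    (hdet : a * d - b * c = 1) (ha : a ≡ 1 [ZMOD 4 * (p * j ^ 2 : ℕ)])
    (hd : d ≡ 1 [ZMOD 4 * (p * j ^ 2 : ℕ)]) (hb : 4 * ((p * j ^ 2 : ℕ) : ℤ) ∣ b)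
    (hc : 4 * ((p * j ^ 2 : ℕ) : ℤ) ∣ c) {z : ℂ} (hz : 0 < z.im) :
    thetaSeries p 0 c' ((a * z + b) / (c * z + d)) =
      thetaSymbol c d * csqrt (c * z + d) ^ 1 * thetaSeries p 0 c' z := by
  have hγ := moebius_im_pos hdet hz
  have key : ∀ z : ℂ, 0 < z.im → thetaSeries p 0 c' z =
      ∑ r ∈ Finset.range (2 * p * j), c' r * classTheta p j r z 0 := fun z hz => by
    have := hasSum_periodic_mul (by positivity) hper
      (f := fun n : ℤ => cexp (2 * Real.pi * I * ((n : ℂ) ^ 2 * z / (4 * p))))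
      (fun r => hasSum_classTheta hp hj r hz)
    simp only [thetaSeries, pow_zero, one_mul]
    rw [← this.tsum_eq]
  rw [key _ hγ, key z hz, Finset.mul_sum]
  refine Finset.sum_congr rfl fun r _ => ?_
  have := classTheta_moebius hp hj r hdet ha hd hb hc hz 0
  simp only [zero_div, ne_eq, OfNat.ofNat_ne_zero, not_false_eq_true, zero_pow, mul_zero,
    Complex.exp_zero, mul_one] at this
  rw [this]
  ring

theorem thetaSeries_one_moebius {p j : ℕ} (hp : 0 < p) (hj : 0 < j) {c' : ℤ → ℂ}
    (hper : Function.Periodic c' ((2 * p * j : ℕ) : ℤ)) {a b c d : ℤ}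
    (hdet : a * d - b * c = 1) (ha : a ≡ 1 [ZMOD 4 * (p * j ^ 2 : ℕ)])
    (hd : d ≡ 1 [ZMOD 4 * (p * j ^ 2 : ℕ)]) (hb : 4 * ((p * j ^ 2 : ℕ) : ℤ) ∣ b)
    (hc : 4 * ((p * j ^ 2 : ℕ) : ℤ) ∣ c) {z : ℂ} (hz : 0 < z.im) :
    thetaSeries p 1 c' ((a * z + b) / (c * z + d)) =
      thetaSymbol c d * csqrt (c * z + d) ^ 3 * thetaSeries p 1 c' z := by
  have hγ := moebius_im_pos hdet hz
  have key : ∀ z : ℂ, 0 < z.im → thetaSeries p 1 c' z =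
      ∑ r ∈ Finset.range (2 * p * j), c' r * (classThetaDeriv p j r z / (2 * Real.pi * I)) :=
    fun z hz => by
    have := hasSum_periodic_mul (by positivity) hper
      (f := fun n : ℤ => (n : ℂ) * cexp (2 * Real.pi * I * ((n : ℂ) ^ 2 * z / (4 * p))))
      (fun r => hasSum_classThetaDeriv hp hj r hz)
    simp only [thetaSeries, pow_one]
    rw [← this.tsum_eq]
  rw [key _ hγ, key z hz, Finset.mul_sum]
  refine Finset.sum_congr rfl fun r _ => ?_
  rw [classThetaDeriv_moebius hp hj r hdet ha hd hb hc hz]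
  ring

/-! ### Theta series: convergence, and decay at the cusps -/

theorem exists_norm_le_of_periodic {K : ℕ} (hK : 0 < K) {c : ℤ → ℂ}
    (hc : Function.Periodic c (K : ℤ)) : ∃ B : ℝ, 0 ≤ B ∧ ∀ n, ‖c n‖ ≤ B := by
  refine ⟨∑ r ∈ Finset.range K, ‖c r‖, Finset.sum_nonneg fun _ _ => norm_nonneg _, fun n => ?_⟩
  have hK' : (0 : ℤ) < K := by exact_mod_cast hK
  have h2 : ((n % K).toNat : ℤ) = n % K := Int.toNat_of_nonneg (Int.emod_nonneg _ hK'.ne')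
  have h1 : c n = c ((n % K).toNat : ℤ) := by
    rw [h2, ← hc.int_mul (n / K) (n % K)]
    congr 1
    rw [mul_comm]
    exact Int.emod_add_mul_ediv n K |>.symm
  rw [h1]
  refine Finset.single_le_sum (f := fun r : ℕ => ‖c r‖) (fun _ _ => norm_nonneg _) ?_
  rw [Finset.mem_range]
  have := Int.emod_lt_of_pos n hK'
  omega

theorem summable_pow_mul_exp_neg_sq {a : ℝ} (ha : 0 < a) (k : ℕ) :
    Summable fun n : ℤ => |(n : ℝ)| ^ k * Real.exp (-a * (n : ℝ) ^ 2) := by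
  have := summable_pow_mul_jacobiTheta₂_term_bound 0 (T := a / Real.pi) (by positivity) k
  refine this.congr fun n => ?_
  have hπ := Real.pi_ne_zero
  push_cast
  congr 2
  field_simp
  ring

theorem norm_thetaTerm (p ν : ℕ) (c : ℤ → ℂ) (z : ℂ) (n : ℤ) :
    ‖c n * ((n : ℂ) ^ ν * cexp (2 * Real.pi * I * ((n : ℂ) ^ 2 * z / (4 * p))))‖ =
      ‖c n‖ * (|(n : ℝ)| ^ ν * Real.exp (-(Real.pi / (2 * p) * z.im) * (n : ℝ) ^ 2)) := by
  rw [norm_mul, norm_mul, norm_pow, Complex.norm_intCast, Complex.norm_exp]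
  congr 3
  have : 2 * Real.pi * I * ((n : ℂ) ^ 2 * z / (4 * p)) =
      ((2 * Real.pi * ((n : ℝ) ^ 2 / (4 * p)) : ℝ) : ℂ) * (I * z) := by push_cast; ring
  rw [this, Complex.re_ofReal_mul]
  simp
  ring

theorem hasSum_thetaSeries {p : ℕ} (hp : 0 < p) (ν : ℕ) {c : ℤ → ℂ} {B : ℝ} (hc : ∀ n, ‖c n‖ ≤ B)
    {z : ℂ} (hz : 0 < z.im) :
    HasSum (fun n : ℤ => c n * ((n : ℂ) ^ ν * cexp (2 * Real.pi * I * ((n : ℂ) ^ 2 * z / (4 * p)))))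
      (thetaSeries p ν c z) := by
  have ha : 0 < Real.pi / (2 * p) * z.im := by have := Real.pi_pos; positivity
  refine (Summable.of_norm_bounded ((summable_pow_mul_exp_neg_sq ha ν).mul_left B) fun n => ?_).hasSum
  rw [norm_thetaTerm]
  gcongr
  exact hc n

theorem differentiableOn_thetaSeries {p : ℕ} (hp : 0 < p) (ν : ℕ) {c : ℤ → ℂ} {B : ℝ}
    (hc : ∀ n, ‖c n‖ ≤ B) : DifferentiableOn ℂ (thetaSeries p ν c) {z | 0 < z.im} := by
  have hB : 0 ≤ B := (norm_nonneg _).trans (hc 0)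
  intro z hz
  have hz' : 0 < z.im := hz
  have ha : 0 < Real.pi / (2 * p) * (z.im / 2) := by have := Real.pi_pos; positivity
  have hopen : IsOpen {w : ℂ | z.im / 2 < w.im} := isOpen_lt continuous_const Complex.continuous_im
  have h := differentiableOn_tsum_of_summable_norm
    (F := fun (n : ℤ) (z : ℂ) => c n * ((n : ℂ) ^ ν * cexp (2 * Real.pi * I * ((n : ℂ) ^ 2 * z / (4 * p)))))
    ((summable_pow_mul_exp_neg_sq ha ν).mul_left B)
    (fun n => by fun_prop) hopen (fun n w hw => by
      rw [norm_thetaTerm]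
      gcongr
      · exact hc n
      · exact le_of_lt hw)
  exact (h.differentiableAt (hopen.mem_nhds (by simp only [Set.mem_ofPred_eq]; linarith))).differentiableWithinAt

/-- The constant term of the theta series vanishes, so that it decays at `i∞`. -/
theorem thetaSeries_decay {p : ℕ} (hp : 0 < p) (ν : ℕ) {c : ℤ → ℂ} {B : ℝ}
    (hc : ∀ n, ‖c n‖ ≤ B) (h0 : ν = 0 → c 0 = 0) :
    ∃ A δ : ℝ, 0 ≤ A ∧ 0 < δ ∧ ∀ z : ℂ, 1 ≤ z.im →
      ‖thetaSeries p ν c z‖ ≤ A * Real.exp (-δ * z.im) := by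
  have hB : 0 ≤ B := (norm_nonneg _).trans (hc 0)
  have hπ := Real.pi_pos
  set a := Real.pi / (2 * p) * (1 / 2) with ha
  have ha0 : 0 < a := by positivity
  have hs := (summable_pow_mul_exp_neg_sq ha0 ν).mul_left B
  refine ⟨∑' n : ℤ, B * (|(n : ℝ)| ^ ν * Real.exp (-a * (n : ℝ) ^ 2)), a,
    tsum_nonneg fun n => by positivity, ha0, fun z hz => ?_⟩
  rw [mul_comm, ← tsum_mul_left]
  refine tsum_of_norm_bounded (hs.mul_left _).hasSum fun n => ?_
  rw [norm_thetaTerm]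
  by_cases hn : n = 0
  · subst hn
    by_cases hν : ν = 0
    · rw [h0 hν]
      simp
      positivity
    · simp [hν]
  have hn1 : (1 : ℝ) ≤ (n : ℝ) ^ 2 := by
    have : (1 : ℤ) ≤ n ^ 2 := Int.add_one_le_iff.mpr (pow_pos (abs_pos.mpr hn) 2 |>.trans_eq (sq_abs n))
    exact_mod_cast this
  calc ‖c n‖ * (|(n : ℝ)| ^ ν * Real.exp (-(Real.pi / (2 * p) * z.im) * (n : ℝ) ^ 2))
      ≤ B * (|(n : ℝ)| ^ ν * Real.exp (-a * z.im + -a * (n : ℝ) ^ 2)) := by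
        gcongr
        · exact hc n
        · have : Real.pi / (2 * p) = 2 * a := by rw [ha]; ring
          rw [this]
          have h1 : 0 ≤ ((n : ℝ) ^ 2 - 1) * z.im := by nlinarith
          have h2 : 0 ≤ (z.im - 1) * (n : ℝ) ^ 2 := by nlinarith
          nlinarith
    _ = _ := by rw [Real.exp_add]; ring

/-- The finite Fourier expansion of a periodic sequence; the coefficient `C 0` is its mean value. -/
theorem exists_fourier_of_periodic {K : ℕ} (hK : 0 < K) {c : ℤ → ℂ}
    (hc : Function.Periodic c (K : ℤ)) (h0 : ∑ r ∈ Finset.range K, c r = 0) :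
    ∃ C : ℕ → ℂ, C 0 = 0 ∧
      ∀ n : ℤ, c n = ∑ r ∈ Finset.range K, C r * cexp (2 * Real.pi * I * n * ((r : ℝ) / K : ℝ)) := by
  have : NeZero K := ⟨hK.ne'⟩
  set Φ : ZMod K → ℂ := fun x => c x.val with hΦ
  have hcΦ : ∀ n : ℤ, c n = Φ n := by
    intro n
    simp only [hΦ, ZMod.val_intCast]
    rw [← hc.int_mul (n / K) (n % K)]
    congr 1
    rw [mul_comm]
    exact Int.emod_add_mul_ediv n K |>.symm
  have hsum : ∀ f : ZMod K → ℂ, ∑ x, f x = ∑ r ∈ Finset.range K, f r := by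
    intro f
    refine Finset.sum_bij' (fun x _ => x.val) (fun r _ => (r : ZMod K)) ?_ ?_ ?_ ?_ ?_
    · intro x _; exact Finset.mem_range.mpr (ZMod.val_lt x)
    · intro r _; exact Finset.mem_univ _
    · intro x _; exact ZMod.natCast_zmod_val x
    · intro r hr; exact ZMod.val_cast_of_lt (Finset.mem_range.mp hr)
    · intro x _; rw [ZMod.natCast_zmod_val]
  refine ⟨fun r => (K : ℂ)⁻¹ * ZMod.dft Φ (r : ZMod K), ?_, ?_⟩
  · simp only [Nat.cast_zero]
    rw [ZMod.dft_apply_zero, hsum]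
    have h1 : ∀ r ∈ Finset.range K, Φ ((r : ℕ) : ZMod K) = c r := fun r _ => by
      rw [hcΦ, Int.cast_natCast]
    rw [Finset.sum_congr rfl h1, h0, mul_zero]
  · intro n
    have h1 : Φ (n : ZMod K) = ZMod.dft.symm (ZMod.dft Φ) (n : ZMod K) := by simp
    rw [hcΦ, h1, ZMod.invDFT_apply, hsum, smul_eq_mul, Finset.mul_sum]
    refine Finset.sum_congr rfl fun r _ => ?_
    have h2 : (r : ZMod K) * (n : ZMod K) = ((n * r : ℤ) : ZMod K) := by push_cast; ring
    rw [h2, ZMod.stdAddChar_coe, smul_eq_mul]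
    have h3 : 2 * Real.pi * I * ((n * r : ℤ) : ℂ) / K = 2 * Real.pi * I * n * ((r : ℝ) / K : ℝ) := by
      push_cast; ring
    rw [h3]
    ring

/-- The inversion formula with the quadratic exponentials completed to squares. -/
theorem jacobiTheta₂_eq_dual (y : ℝ) {τ : ℂ} (hτ : 0 < τ.im) :
    jacobiTheta₂ y τ = 1 / csqrt (-I * τ) *
      ∑' n : ℤ, cexp (Real.pi * I * (-1 / τ) * ((n : ℂ) - y) ^ 2) := by
  have hτ0 : τ ≠ 0 := by rintro rfl; simp at hτ
  rw [jacobiTheta₂_functional_equation, mul_assoc]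
  congr 1
  rw [jacobiTheta₂, ← tsum_mul_left]
  refine tsum_congr fun n => ?_
  rw [jacobiTheta₂_term, ← Complex.exp_add]
  congr 1
  field_simp
  ring

theorem neg_one_div_im_pos {τ : ℂ} (hτ : 0 < τ.im) : 0 < (-1 / τ).im := by
  have := moebius_im_pos (a := 0) (b := -1) (c := 1) (d := 0) (by norm_num) hτ
  simpa using this

theorem jacobiTheta₂'_eq_dual (y : ℝ) {τ : ℂ} (hτ : 0 < τ.im) :
    jacobiTheta₂' y τ = 1 / csqrt (-I * τ) / τ *
      ∑' n : ℤ, 2 * Real.pi * I * (((n : ℂ) - y) * cexp (Real.pi * I * (-1 / τ) * ((n : ℂ) - y) ^ 2)) := by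
  have hτ0 : τ ≠ 0 := by rintro rfl; simp at hτ
  have hτ' := neg_one_div_im_pos hτ
  rw [jacobiTheta₂'_functional_equation]
  have h1 := hasSum_jacobiTheta₂_term (y / τ) hτ'
  have h2 := hasSum_jacobiTheta₂'_term (y / τ) hτ'
  have h3 := (h2.sub (h1.mul_left (2 * Real.pi * I * y))).mul_left (cexp (-Real.pi * I * y ^ 2 / τ))
  rw [show ∀ a b c d : ℂ, 1 / a * b / c * d = 1 / a / c * (b * d) by intros; ring]
  congr 1
  rw [← h3.tsum_eq]
  refine tsum_congr fun n => ?_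
  rw [jacobiTheta₂'_term, jacobiTheta₂_term]
  have : cexp (Real.pi * I * (-1 / τ) * ((n : ℂ) - y) ^ 2) = cexp (-Real.pi * I * y ^ 2 / τ) *
      cexp (2 * Real.pi * I * n * (y / τ) + Real.pi * I * n ^ 2 * (-1 / τ)) := by
    rw [← Complex.exp_add]
    congr 1
    field_simp
    ring
  rw [this]
  ring

/-- The sums over a shifted lattice that misses the origin decay exponentially. -/
theorem dual_decay {ν : ℕ} (hν : ν ≤ 1) {y : ℝ} (hy0 : 0 < y) (hy1 : y < 1) :
    ∃ A δ : ℝ, 0 ≤ A ∧ 0 < δ ∧ ∀ U : ℂ, 1 ≤ U.im →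
      ‖∑' n : ℤ, ((n : ℂ) - y) ^ ν * cexp (Real.pi * I * U * ((n : ℂ) - y) ^ 2)‖ ≤
        A * Real.exp (-δ * U.im) := by
  have hπ := Real.pi_pos
  set m := min y (1 - y) with hm
  have hm0 : 0 < m := lt_min hy0 (by linarith)
  have hs : Summable fun n : ℤ => Real.exp (Real.pi / 2) * ((|(n : ℝ)| ^ 1 * Real.exp (-(Real.pi / 4) * (n : ℝ) ^ 2))
      + |(n : ℝ)| ^ 0 * Real.exp (-(Real.pi / 4) * (n : ℝ) ^ 2)) :=
    ((summable_pow_mul_exp_neg_sq (by positivity) 1).add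
      (summable_pow_mul_exp_neg_sq (by positivity) 0)).mul_left _
  refine ⟨∑' n : ℤ, Real.exp (Real.pi / 2) * ((|(n : ℝ)| ^ 1 * Real.exp (-(Real.pi / 4) * (n : ℝ) ^ 2))
      + |(n : ℝ)| ^ 0 * Real.exp (-(Real.pi / 4) * (n : ℝ) ^ 2)), Real.pi / 2 * m ^ 2,
    tsum_nonneg fun n => by positivity, by positivity, fun U hU => ?_⟩
  · rw [← tsum_mul_right]
    refine tsum_of_norm_bounded (hs.mul_right _).hasSum fun n => ?_
    have hnorm : ‖cexp (Real.pi * I * U * ((n : ℂ) - y) ^ 2)‖ =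
        Real.exp (-(Real.pi * U.im) * ((n : ℝ) - y) ^ 2) := by
      rw [Complex.norm_exp]
      congr 1
      have : Real.pi * I * U * ((n : ℂ) - y) ^ 2 =
          ((Real.pi * ((n : ℝ) - y) ^ 2 : ℝ) : ℂ) * (I * U) := by push_cast; ring
      rw [this, Complex.re_ofReal_mul]
      simp
      ring
    have h1 : ‖((n : ℂ) - y) ^ ν‖ ≤ |(n : ℝ)| + 1 := by
      have e : ((n : ℂ) - y) = (((n : ℝ) - y : ℝ) : ℂ) := by push_cast; rfl
      rw [e, norm_pow, Complex.norm_real, Real.norm_eq_abs]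
      have h2 : |(n : ℝ) - y| ≤ |(n : ℝ)| + 1 := by
        refine (abs_sub _ _).trans ?_
        rw [abs_of_pos hy0]
        linarith
      interval_cases ν
      · simp
      · simpa using h2
    have h2 : m ^ 2 ≤ ((n : ℝ) - y) ^ 2 := by
      rw [sq_le_sq, abs_of_pos hm0]
      rcases le_or_gt n 0 with h | h
      · have : (n : ℝ) ≤ 0 := by exact_mod_cast h
        rw [abs_of_neg (by linarith)]
        have := min_le_left y (1 - y)
        linarith
      · have : (1 : ℝ) ≤ n := by exact_mod_cast h
        rw [abs_of_pos (by linarith)]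
        have := min_le_right y (1 - y)
        linarith
    have h3 : (n : ℝ) ^ 2 / 2 - 1 ≤ ((n : ℝ) - y) ^ 2 := by
      nlinarith [sq_nonneg ((n : ℝ) - 2 * y)]
    rw [norm_mul, hnorm]
    calc ‖((n : ℂ) - y) ^ ν‖ * Real.exp (-(Real.pi * U.im) * ((n : ℝ) - y) ^ 2)
        ≤ (|(n : ℝ)| + 1) * Real.exp (-(Real.pi / 2 * m ^ 2) * U.im + Real.pi / 2 +
            -(Real.pi / 4) * (n : ℝ) ^ 2) := by
          gcongr
          have h4 : 0 ≤ (((n : ℝ) - y) ^ 2 - m ^ 2) * (U.im / 2) := by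
            apply mul_nonneg <;> linarith
          have h5 : 0 ≤ ((n : ℝ) - y) ^ 2 * (U.im / 2 - 1 / 2) := by
            apply mul_nonneg (sq_nonneg _); linarith
          have h6 : Real.pi * (m ^ 2 * (U.im / 2) + ((n : ℝ) ^ 2 / 2 - 1) / 2) ≤
              Real.pi * (U.im * ((n : ℝ) - y) ^ 2) := by
            gcongr
            nlinarith
          linarith
      _ = _ := by rw [Real.exp_add, Real.exp_add]; ring

theorem norm_csqrt (z : ℂ) : ‖csqrt z‖ ^ 2 = ‖z‖ := by
  rw [← norm_pow, csqrt_sq]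

/-- A theta series whose periodic coefficients have mean value zero decays exponentially at the
cusp `0`. -/
theorem thetaSeries_cusp_decay {p : ℕ} (hp : 0 < p) {ν : ℕ} (hν : ν ≤ 1) {K : ℕ} (hK : 0 < K)
    {c : ℤ → ℂ} (hc : Function.Periodic c (K : ℤ)) (h0 : ∑ r ∈ Finset.range K, c r = 0) :
    ∃ A δ : ℝ, 0 ≤ A ∧ 0 < δ ∧ ∀ u : ℂ, 1 ≤ u.im →
      ‖thetaSeries p ν c (-1 / u)‖ ≤ A * ‖u‖ ^ 2 * Real.exp (-δ * u.im) := by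
  -- expand the coefficients into additive characters and invert each of the resulting theta functions;
  -- only the trivial character could leave a term without decay, and its coefficient is the mean value
  obtain ⟨C, hC0, hC⟩ := exists_fourier_of_periodic hK hc h0
  have hπ := Real.pi_pos
  have hp1 : (1 : ℝ) ≤ p := by exact_mod_cast hp
  have key : ∀ r : ℕ, ∃ A δ : ℝ, 0 ≤ A ∧ 0 < δ ∧ (r < K → ∀ U : ℂ, 1 ≤ U.im →
      ‖C r‖ * ‖∑' n : ℤ, (((n : ℂ) - (r / K : ℝ)) ^ ν *
        cexp (Real.pi * I * U * ((n : ℂ) - (r / K : ℝ)) ^ 2) : ℂ)‖ ≤ A * Real.exp (-δ * U.im)) := by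
    intro r
    by_cases hr : r = 0
    · exact ⟨0, 1, le_rfl, one_pos, fun _ U _ => by simp [hr, hC0]⟩
    by_cases hrK : r < K
    · have hK' : (0 : ℝ) < K := by exact_mod_cast hK
      obtain ⟨A, δ, hA, hδ, h⟩ := dual_decay hν (y := r / K)
        (by have := Nat.pos_of_ne_zero hr; positivity)
        (by rw [div_lt_one hK']; exact_mod_cast hrK)
      refine ⟨‖C r‖ * A, δ, by positivity, hδ, fun _ U hU => ?_⟩
      rw [mul_assoc ‖C r‖ A]
      exact mul_le_mul_of_nonneg_left (h U hU) (norm_nonneg (C r))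
    · exact ⟨0, 1, le_rfl, one_pos, fun h => absurd h hrK⟩
  choose A δ hA hδ hbd using key
  -- the smallest of the exponents
  obtain ⟨δ₀, hδ₀, hδle⟩ : ∃ δ₀ : ℝ, 0 < δ₀ ∧ ∀ r ∈ Finset.range K, δ₀ ≤ δ r := by
    have hne : (Finset.range K).Nonempty := Finset.nonempty_range_iff.mpr hK.ne'
    refine ⟨(Finset.range K).inf' hne δ, ?_, fun r hr => Finset.inf'_le _ hr⟩
    rw [Finset.lt_inf'_iff]
    exact fun r _ => hδ r
  have hθ : ∀ u : ℂ, 1 ≤ u.im → ‖thetaSeries p ν c (-1 / u)‖ ≤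
      (2 * p * ‖u‖) ^ 2 * ∑ r ∈ Finset.range K, (‖C r‖ *
        ‖∑' n : ℤ, ((n : ℂ) - (r / K : ℝ)) ^ ν *
          cexp (Real.pi * I * (2 * p * u) * ((n : ℂ) - (r / K : ℝ)) ^ 2)‖ : ℝ) := by
    intro u hu
    have hu0 : u ≠ 0 := by rintro rfl; simp at hu; linarith
    have hun : 1 ≤ ‖u‖ := hu.trans ((le_abs_self _).trans (Complex.abs_im_le_norm u))
    set τ : ℂ := (-1 / u) / (2 * p) with hτ
    have hp0 : (p : ℂ) ≠ 0 := by exact_mod_cast hp.ne'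
    have hτim : 0 < τ.im := by
      have h1 := neg_one_div_im_pos (show 0 < u.im by linarith)
      have : τ = ((1 / (2 * p) : ℝ) : ℂ) * (-1 / u) := by rw [hτ]; push_cast; field_simp
      rw [this, Complex.im_ofReal_mul]
      positivity
    have hτ1 : -1 / τ = 2 * p * u := by rw [hτ]; field_simp
    have hτn : ‖τ‖ = (2 * p * ‖u‖)⁻¹ := by
      rw [hτ, norm_div, norm_div, norm_neg, norm_one, norm_mul]
      simp
      ring
    have hs : ‖1 / csqrt (-I * τ)‖ ≤ 2 * p * ‖u‖ := by
      have h1 := norm_csqrt (-I * τ)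
      rw [norm_mul, norm_neg, Complex.norm_I, one_mul, hτn] at h1
      have h2 : (1 : ℝ) ≤ 2 * p * ‖u‖ := by nlinarith
      rw [norm_div, norm_one]
      have h3 : (1 / ‖csqrt (-I * τ)‖) ^ 2 = 2 * p * ‖u‖ := by
        rw [div_pow, h1]; simp
      have h4 : 0 ≤ 1 / ‖csqrt (-I * τ)‖ := by positivity
      nlinarith
    have hterm : ∀ n : ℤ, c n * ((n : ℂ) ^ ν * cexp (2 * Real.pi * I * ((n : ℂ) ^ 2 * (-1 / u) / (4 * p)))) =
        ∑ r ∈ Finset.range K, C r * ((n : ℂ) ^ ν * jacobiTheta₂_term n ((r : ℝ) / K : ℝ) τ) := by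
      intro n
      rw [hC, Finset.sum_mul]
      refine Finset.sum_congr rfl fun r _ => ?_
      rw [jacobiTheta₂_term, Complex.exp_add, hτ]
      have : 2 * Real.pi * I * ((n : ℂ) ^ 2 * (-1 / u) / (4 * p)) =
          Real.pi * I * n ^ 2 * (-1 / u / (2 * p)) := by field_simp; ring
      rw [this]
      ring
    rw [thetaSeries, tsum_congr hterm, Finset.mul_sum]
    obtain rfl | rfl : ν = 0 ∨ ν = 1 := by omega
    · simp only [pow_zero, one_mul]
      rw [(hasSum_sum fun (r : ℕ) _ => (hasSum_jacobiTheta₂_term ((r : ℝ) / K : ℝ) hτim).mul_left (C r)).tsum_eq]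
      refine (norm_sum_le _ _).trans (Finset.sum_le_sum fun r _ => ?_)
      rw [jacobiTheta₂_eq_dual _ hτim, hτ1, norm_mul, norm_mul]
      have h2 : (1 : ℝ) ≤ 2 * p * ‖u‖ := by nlinarith
      calc _ ≤ ‖C r‖ * ((2 * p * ‖u‖) ^ 2 * _) := by
            gcongr
            exact hs.trans (by nlinarith)
        _ = _ := by ring
    · have h1 : ∀ r : ℕ, HasSum (fun n : ℤ => C r * ((n : ℂ) ^ 1 * jacobiTheta₂_term n ((r : ℝ) / K : ℝ) τ))
          (C r * (jacobiTheta₂' ((r : ℝ) / K : ℝ) τ / (2 * Real.pi * I))) := by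
        intro r
        refine HasSum.mul_left _ (((hasSum_jacobiTheta₂'_term ((r : ℝ) / K : ℝ) hτim).div_const
          (2 * Real.pi * I)).congr_fun fun n => ?_)
        have hπ' : (Real.pi : ℂ) ≠ 0 := by exact_mod_cast Real.pi_ne_zero
        rw [jacobiTheta₂'_term]
        field_simp
      rw [(hasSum_sum fun r _ => h1 r).tsum_eq]
      refine (norm_sum_le _ _).trans (Finset.sum_le_sum fun r _ => ?_)
      have hπ' : (2 * Real.pi * I : ℂ) ≠ 0 := by simp [Real.pi_ne_zero]
      rw [jacobiTheta₂'_eq_dual _ hτim, hτ1, tsum_mul_left, ← mul_assoc, mul_comm _ (2 * Real.pi * I),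
        mul_assoc, mul_div_cancel_left₀ _ hπ', norm_mul, norm_mul, norm_div, hτn, div_inv_eq_mul]
      simp only [pow_one]
      calc _ ≤ ‖C r‖ * ((2 * p * ‖u‖) * (2 * p * ‖u‖) * _) := by gcongr
        _ = _ := by ring
  refine ⟨(2 * p) ^ 2 * ∑ r ∈ Finset.range K, A r, δ₀, ?_, hδ₀, fun u hu => (hθ u hu).trans ?_⟩
  · have := Finset.sum_nonneg fun r (_ : r ∈ Finset.range K) => hA r
    positivity
  · have hU : 1 ≤ ((2 : ℂ) * p * u).im := by
      have : (2 : ℂ) * p * u = ((2 * p : ℝ) : ℂ) * u := by push_cast; ring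
      rw [this, Complex.im_ofReal_mul]
      nlinarith
    have hUle : u.im ≤ ((2 : ℂ) * p * u).im := by
      have : (2 : ℂ) * p * u = ((2 * p : ℝ) : ℂ) * u := by push_cast; ring
      rw [this, Complex.im_ofReal_mul]
      nlinarith
    calc _ ≤ (2 * p * ‖u‖) ^ 2 * ∑ r ∈ Finset.range K, A r * Real.exp (-δ₀ * u.im) := by
          refine mul_le_mul_of_nonneg_left (Finset.sum_le_sum fun r hr => ?_) (by positivity)
          refine (hbd r (Finset.mem_range.mp hr) _ hU).trans
            (mul_le_mul_of_nonneg_left (Real.exp_le_exp.mpr ?_) (hA r))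
          have h1 := hδle r hr
          have h2 := hδ r
          nlinarith
      _ = _ := by rw [← Finset.sum_mul]; ring

theorem thetaSeries_add_real (p ν : ℕ) (c : ℤ → ℂ) (x z : ℂ) :
    thetaSeries p ν c (x + z) =
      thetaSeries p ν (fun n => c n * cexp (2 * Real.pi * I * ((n : ℂ) ^ 2 * x / (4 * p)))) z := by
  unfold thetaSeries
  refine tsum_congr fun n => ?_
  rw [show 2 * Real.pi * I * ((n : ℂ) ^ 2 * (x + z) / (4 * p)) =
    2 * Real.pi * I * ((n : ℂ) ^ 2 * x / (4 * p)) + 2 * Real.pi * I * ((n : ℂ) ^ 2 * z / (4 * p)) by ring,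
    Complex.exp_add]
  ring

section

open MeasureTheory Set

/-! ### Contour integrals between cusps -/

/-- Exponential decay of `θ` at `i∞`. -/
def DecaysAtInfty (θ : ℂ → ℂ) : Prop :=
  ∃ A δ : ℝ, 0 ≤ A ∧ 0 < δ ∧ ∀ z : ℂ, 1 ≤ z.im → ‖θ z‖ ≤ A * Real.exp (-δ * z.im)

/-- Exponential decay of `θ` at the cusp `r`, in terms of the coordinate `u = -1 / (z - r)`, up to
the factor `‖u‖ ^ m`. -/
def DecaysAtCusp (m : ℕ) (θ : ℂ → ℂ) (r : ℝ) : Prop :=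
  ∃ A δ : ℝ, 0 ≤ A ∧ 0 < δ ∧
    ∀ u : ℂ, 1 ≤ u.im → ‖θ (r + -1 / u)‖ ≤ A * ‖u‖ ^ m * Real.exp (-δ * u.im)

/-- Every holomorphic function on the upper half-plane has a primitive there: transport the
statement for the disc with the Cayley transform. -/
theorem exists_primitive_upperHalfPlane {g : ℂ → ℂ} (hg : DifferentiableOn ℂ g {z | 0 < z.im}) :
    ∃ G : ℂ → ℂ, ∀ z : ℂ, 0 < z.im → HasDerivAt G (g z) z := by
  set C : ℂ → ℂ := fun s => I * (1 + s) / (1 - s) with hC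
  have hne : ∀ s ∈ Metric.ball (0 : ℂ) 1, (1 : ℂ) - s ≠ 0 := by
    intro s hs h
    rw [mem_ball_zero_iff] at hs
    have : s = 1 := by linear_combination -h
    rw [this] at hs
    simp at hs
  have hCd : ∀ s ∈ Metric.ball (0 : ℂ) 1, HasDerivAt C (2 * I / (1 - s) ^ 2) s := by
    intro s hs
    have h1 : HasDerivAt (fun s : ℂ => I * (1 + s)) I s := by
      simpa using ((hasDerivAt_id s).const_add 1).const_mul I
    have h2 : HasDerivAt (fun s : ℂ => 1 - s) (-1) s := by
      simpa using (hasDerivAt_id s).const_sub 1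
    have := h1.div h2 (hne s hs)
    refine this.congr_deriv ?_
    ring
  have hCim : ∀ s ∈ Metric.ball (0 : ℂ) 1, 0 < (C s).im := by
    intro s hs
    have h1 := Complex.normSq_pos.mpr (hne s hs)
    have h2 : Complex.normSq s < 1 := by
      rw [mem_ball_zero_iff] at hs
      rw [Complex.normSq_eq_norm_sq]
      have := norm_nonneg s
      nlinarith
    rw [Complex.normSq_apply] at h2
    have : (C s).im = (1 - (s.re * s.re + s.im * s.im)) / Complex.normSq (1 - s) := by
      rw [hC, Complex.div_im]
      simp
      ring
    rw [this]
    apply div_pos _ h1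
    linarith
  have hd : DifferentiableOn ℂ (fun s => g (C s) * (2 * I / (1 - s) ^ 2)) (Metric.ball 0 1) := by
    intro s hs
    have h1 : DifferentiableAt ℂ g (C s) :=
      hg.differentiableAt ((isOpen_lt continuous_const Complex.continuous_im).mem_nhds (hCim s hs))
    have h2 := h1.comp s (hCd s hs).differentiableAt
    have h3 : DifferentiableAt ℂ (fun s : ℂ => 2 * I / (1 - s) ^ 2) s := by
      refine DifferentiableAt.div (by fun_prop) (by fun_prop) (pow_ne_zero _ (hne s hs))
    exact (h2.mul h3).differentiableWithinAt
  obtain ⟨H, hH⟩ := hd.isExactOn_ball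
  refine ⟨fun z => H ((z - I) / (z + I)), fun z hz => ?_⟩
  have hzI : z + I ≠ 0 := by
    intro h
    have := congrArg Complex.im h
    simp at this
    linarith
  have hmem : (z - I) / (z + I) ∈ Metric.ball (0 : ℂ) 1 := by
    rw [mem_ball_zero_iff, norm_div, div_lt_one (norm_pos_iff.mpr hzI)]
    rw [← abs_norm, ← abs_norm (z + I), ← sq_lt_sq, ← Complex.normSq_eq_norm_sq,
      ← Complex.normSq_eq_norm_sq, Complex.normSq_apply, Complex.normSq_apply]
    simp
    nlinarith
  have h1 : C ((z - I) / (z + I)) = z := by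
    have h0 := hne _ hmem
    rw [hC]
    simp only
    rw [div_eq_iff h0]
    field_simp
    ring_nf
  have h2 : HasDerivAt (fun z : ℂ => (z - I) / (z + I)) (2 * I / (z + I) ^ 2) z := by
    have := ((hasDerivAt_id z).sub_const I).div ((hasDerivAt_id z).add_const I) hzI
    refine this.congr_deriv ?_
    simp only [id]
    ring
  have h3 := (hH _ hmem).comp z h2
  refine h3.congr_deriv ?_
  beta_reduce
  rw [h1]
  have : (1 : ℂ) - (z - I) / (z + I) = 2 * I / (z + I) := by field_simp; ring
  rw [this]
  field_simp

theorem tendsto_sub_of_hasDerivAt_Ioi {f f' : ℝ → ℂ} (hf : ∀ y, 0 < y → HasDerivAt f (f' y) y)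
    (hint : IntegrableOn f' (Ioi 0)) {a b : ℝ → ℝ} (ha : Tendsto a atTop (𝓝 0))
    (hb : Tendsto b atTop atTop) (ha0 : ∀ᶠ T in atTop, 0 < a T) :
    Tendsto (fun T => f (b T) - f (a T)) atTop (𝓝 (∫ y in Ioi 0, f' y)) := by
  have hcov : AECover (volume.restrict (Ioi (0 : ℝ))) atTop fun T => Ioc (a T) (b T) :=
    (aecover_Ioi_of_Ioi ha).inter ((aecover_Iic hb).mono Measure.restrict_le_self)
  have h1 := hcov.integral_tendsto_of_countably_generated hint
  refine h1.congr' ?_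
  have h2 : ∀ᶠ T in atTop, a T < 1 := ha.eventually_lt_const one_pos
  have h3 : ∀ᶠ T in atTop, 1 ≤ b T := hb.eventually_ge_atTop 1
  filter_upwards [ha0, h2, h3] with T h4 h5 h6
  have hle : a T ≤ b T := by linarith
  have hsub : Ioc (a T) (b T) ⊆ Ioi 0 := fun y hy => lt_trans h4 hy.1
  rw [Measure.restrict_restrict measurableSet_Ioc, inter_eq_self_of_subset_left hsub,
    ← intervalIntegral.integral_of_le hle]
  refine intervalIntegral.integral_eq_sub_of_hasDerivAt (fun y hy => hf y ?_) ?_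
  · rw [uIcc_of_le hle] at hy
    exact lt_of_lt_of_le h4 hy.1
  · rw [intervalIntegrable_iff_integrableOn_Ioc_of_le hle]
    exact hint.mono_set hsub

theorem tendsto_pow_mul_exp_neg (A δ s k : ℝ) (hk : 0 < k) (hδ : 0 < δ) (m : ℕ) :
    Tendsto (fun T : ℝ => A * (k * T + s) ^ m * Real.exp (-δ * (k * T))) atTop (𝓝 0) := by
  have h1 : Tendsto (fun T : ℝ => k * T + s) atTop atTop :=
    tendsto_atTop_add_const_right _ _ (tendsto_id.const_mul_atTop hk)
  have h2 := (Real.tendsto_pow_mul_exp_neg_atTop_nhds_zero m).comp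
    ((tendsto_id (α := ℝ)).const_mul_atTop hδ |>.comp h1)
  have h3 := h2.const_mul (A * (δ ^ m)⁻¹ * Real.exp (δ * s))
  rw [mul_zero] at h3
  refine h3.congr fun T => ?_
  simp only [Function.comp, id, mul_pow]
  rw [show -δ * (k * T) = δ * s + -(δ * (k * T + s)) by ring, Real.exp_add]
  have : δ ^ m ≠ 0 := by positivity
  field_simp

/-- A primitive of a function with exponential decay at a cusp has the same limit along any two
horocyclically close approaches to the cusp. -/
theorem tendsto_primitive_cusp {g G : ℂ → ℂ} (hG : ∀ z : ℂ, 0 < z.im → HasDerivAt G (g z) z)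
    {m : ℕ} {r : ℝ} (hg : DecaysAtCusp m g r) {k : ℝ} (hk : 0 < k) (s : ℝ) :
    Tendsto (fun T : ℝ => G (r + -1 / ((s : ℂ) + (k * T : ℝ) * I)) - G (r + -1 / ((k * T : ℝ) * I)))
      atTop (𝓝 0) := by
  obtain ⟨A, δ, hA, hδ, hb⟩ := hg
  refine squeeze_zero_norm' ?_ (tendsto_pow_mul_exp_neg (A * |s|) δ |s| k hk hδ m)
  have : ∀ᶠ T : ℝ in atTop, 1 ≤ k * T :=
    (tendsto_id.const_mul_atTop hk).eventually_ge_atTop 1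
  filter_upwards [this] with T hT
  set v := k * T with hv
  set S : Set ℂ := {u : ℂ | u.im = v} ∩ {u : ℂ | |u.re| ≤ |s|} with hS
  have hconv : Convex ℝ S := by
    apply Convex.inter
    · intro x hx y hy a b _ _ hab
      simp only [mem_ofPred_eq, Complex.add_im, Complex.smul_im, smul_eq_mul] at *
      rw [hx, hy, ← add_mul, hab, one_mul]
    · intro x hx y hy a b ha hb hab
      simp only [mem_ofPred_eq, Complex.add_re, Complex.smul_re, smul_eq_mul] at *
      calc |a * x.re + b * y.re| ≤ |a * x.re| + |b * y.re| := abs_add_le _ _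
        _ = a * |x.re| + b * |y.re| := by rw [abs_mul, abs_mul, abs_of_nonneg ha, abs_of_nonneg hb]
        _ ≤ a * |s| + b * |s| := by gcongr
        _ = |s| := by rw [← add_mul, hab, one_mul]
  have hder : ∀ u ∈ S, HasDerivWithinAt (fun u => G (r + -1 / u)) (g (r + -1 / u) * (1 / u ^ 2)) S u := by
    intro u hu
    have hui : u.im = v := hu.1
    have hu0 : u ≠ 0 := by rintro rfl; simp at hui; linarith
    have him : 0 < ((r : ℂ) + -1 / u).im := by
      have := neg_one_div_im_pos (τ := u) (by rw [hui]; linarith)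
      simpa using this
    have h1 : HasDerivAt (fun u : ℂ => (r : ℂ) + -1 / u) (1 / u ^ 2) u := by
      have := ((hasDerivAt_inv hu0).const_mul (-1)).const_add (r : ℂ)
      simpa [div_eq_mul_inv] using this
    exact ((hG _ him).comp u h1).hasDerivWithinAt
  have hbound : ∀ u ∈ S, ‖g (r + -1 / u) * (1 / u ^ 2)‖ ≤ A * (v + |s|) ^ m * Real.exp (-δ * v) := by
    intro u hu
    have hui : u.im = v := hu.1
    have hur : |u.re| ≤ |s| := hu.2
    have h1 := hb u (by rw [hui]; exact hT)
    have hn : ‖u‖ ≤ v + |s| := by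
      have := Complex.norm_le_abs_re_add_abs_im u
      rw [hui, abs_of_pos (by linarith : 0 < v)] at this
      linarith
    have hn1 : 1 ≤ ‖u‖ := by
      have := Complex.abs_im_le_norm u
      rw [hui, abs_of_pos (by linarith : 0 < v)] at this
      linarith
    have h2 : ‖1 / u ^ 2‖ ≤ 1 := by
      rw [norm_div, norm_one, norm_pow, div_le_one (by positivity)]
      exact one_le_pow₀ hn1
    rw [norm_mul]
    calc _ ≤ (A * ‖u‖ ^ m * Real.exp (-δ * u.im)) * 1 := by gcongr
      _ ≤ _ := by rw [mul_one, hui]; gcongr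
  have hx : ((v : ℂ) * I) ∈ S := by simp [hS]
  have hy : ((s : ℂ) + (v : ℂ) * I) ∈ S := by simp [hS]
  have := hconv.norm_image_sub_le_of_norm_hasDerivWithin_le hder hbound hx hy
  simp only [add_sub_cancel_right, Complex.norm_real, Real.norm_eq_abs] at this
  calc _ ≤ _ := this
    _ = _ := by ring

/-- The same at the cusp `i∞`. -/
theorem tendsto_primitive_infty {g G : ℂ → ℂ} (hG : ∀ z : ℂ, 0 < z.im → HasDerivAt G (g z) z)
    (hg : DecaysAtInfty g) (r x : ℝ) :
    Tendsto (fun T : ℝ => G (r + T * I) - G (x + T * I)) atTop (𝓝 0) := by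
  obtain ⟨A, δ, hA, hδ, hb⟩ := hg
  refine squeeze_zero_norm' ?_ (tendsto_pow_mul_exp_neg (A * |r - x|) δ 0 1 one_pos hδ 0)
  filter_upwards [eventually_ge_atTop (1 : ℝ)] with T hT
  have hconv : Convex ℝ {u : ℂ | u.im = T} := by
    intro x hx y hy a b _ _ hab
    simp only [mem_ofPred_eq, Complex.add_im, Complex.smul_im, smul_eq_mul] at *
    rw [hx, hy, ← add_mul, hab, one_mul]
  have := hconv.norm_image_sub_le_of_norm_hasDerivWithin_le (f := G) (f' := g)
    (C := A * Real.exp (-δ * T)) (x := x + T * I) (y := r + T * I)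
    (fun u hu => (hG u (by rw [hu.out]; linarith)).hasDerivWithinAt)
    (fun u hu => by have := hb u (by rw [hu.out]; linarith); rwa [hu.out] at this)
    (by simp) (by simp)
  calc _ ≤ _ := this
    _ = _ := by
      rw [show (r : ℂ) + T * I - (x + T * I) = ((r - x : ℝ) : ℂ) by push_cast; ring,
        Complex.norm_real, Real.norm_eq_abs]
      simp
      ring

/-! ### Eichler integrals -/

/-- Decay of a function on `(0, ∞)` that is exponential at `∞` and faster than every power at `0`. -/
def RapidDecay (g : ℝ → ℂ) : Prop :=
  ∀ M : ℕ, ∃ A δ : ℝ, 0 ≤ A ∧ 0 < δ ∧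
    ∀ y : ℝ, 0 < y → ‖g y‖ ≤ A * Real.sqrt y ^ M * Real.exp (-δ * y)

theorem pow_mul_exp_neg_le {δ : ℝ} (hδ : 0 < δ) (k : ℕ) {t : ℝ} (ht : 0 ≤ t) :
    t ^ k * Real.exp (-δ * t) ≤ k.factorial / δ ^ k := by
  have h1 := Real.pow_div_factorial_le_exp (δ * t) (by positivity) k
  rw [show -δ * t = -(δ * t) by ring, Real.exp_neg, ← div_eq_mul_inv, div_le_div_iff₀ (Real.exp_pos _)
    (by positivity)]
  rw [div_le_iff₀ (by positivity), mul_pow] at h1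
  linarith

theorem add_mul_I_im (s y : ℝ) : ((s : ℂ) + y * I).im = y := by simp

/-- Bounds near `∞` and near `0` suffice: the compact interval in between only changes the constant. -/
theorem rapidDecay_of_bounds {g : ℝ → ℂ} (hc : ContinuousOn g (Ioi 0)) {y₀ y₁ A₁ δ₁ A₂ δ₂ : ℝ} {m : ℕ}
    (hy₀ : 0 < y₀) (hy₀1 : y₀ ≤ 1) (hy₁ : 1 ≤ y₁) (hA₁ : 0 ≤ A₁) (hδ₁ : 0 < δ₁) (hA₂ : 0 ≤ A₂) (hδ₂ : 0 < δ₂)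
    (h1 : ∀ y, y₁ ≤ y → ‖g y‖ ≤ A₁ * Real.exp (-δ₁ * y))
    (h2 : ∀ y, 0 < y → y ≤ y₀ → ‖g y‖ ≤ A₂ * y⁻¹ ^ m * Real.exp (-δ₂ * y⁻¹)) : RapidDecay g := by
  intro M
  obtain ⟨B, hB⟩ := (isCompact_Icc (a := y₀) (b := y₁)).exists_bound_of_continuousOn
    (hc.mono fun y hy => lt_of_lt_of_le hy₀ hy.1)
  have hB0 : 0 ≤ B := (norm_nonneg _).trans (hB y₀ ⟨le_rfl, by linarith⟩)
  have hs0 : 0 < Real.sqrt y₀ := Real.sqrt_pos.mpr hy₀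
  set C₂ := A₂ * ((m + M).factorial / δ₂ ^ (m + M)) * Real.exp δ₁ with hC₂
  set C₃ := B * (Real.sqrt y₀ ^ M)⁻¹ * Real.exp (δ₁ * y₁) with hC₃
  have hC₂0 : 0 ≤ C₂ := by positivity
  have hC₃0 : 0 ≤ C₃ := by positivity
  refine ⟨A₁ + C₂ + C₃, δ₁, by positivity, hδ₁, fun y hy => ?_⟩
  have hs : 0 < Real.sqrt y := Real.sqrt_pos.mpr hy
  suffices h : ‖g y‖ ≤ A₁ * Real.sqrt y ^ M * Real.exp (-δ₁ * y) ∨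
      ‖g y‖ ≤ C₂ * Real.sqrt y ^ M * Real.exp (-δ₁ * y) ∨
      ‖g y‖ ≤ C₃ * Real.sqrt y ^ M * Real.exp (-δ₁ * y) by
    have hE : 0 ≤ Real.sqrt y ^ M * Real.exp (-δ₁ * y) := by positivity
    have hmul : ∀ C, C ≤ A₁ + C₂ + C₃ → C * Real.sqrt y ^ M * Real.exp (-δ₁ * y) ≤
        (A₁ + C₂ + C₃) * Real.sqrt y ^ M * Real.exp (-δ₁ * y) := by
      intro C hC
      rw [mul_assoc, mul_assoc]
      exact mul_le_mul_of_nonneg_right hC hE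
    rcases h with h | h | h <;> exact h.trans (hmul _ (by linarith))
  rcases le_total y₁ y with h | h
  · left
    have h4 : 1 ≤ Real.sqrt y ^ M := one_le_pow₀ (by rw [Real.one_le_sqrt]; linarith)
    calc _ ≤ A₁ * Real.exp (-δ₁ * y) := h1 y h
      _ = A₁ * 1 * Real.exp (-δ₁ * y) := by ring
      _ ≤ _ := by gcongr
  · right
    rcases le_total y y₀ with h' | h'
    · left
      have h5 := pow_mul_exp_neg_le hδ₂ (m + M) (t := y⁻¹) (by positivity)
      have h6 : y ^ M ≤ Real.sqrt y ^ M := by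
        have h61 : Real.sqrt y ≤ 1 := Real.sqrt_le_one.mpr (by linarith)
        have h62 := Real.mul_self_sqrt hy.le
        gcongr
        nlinarith
      have h7 : y⁻¹ ^ m * Real.exp (-δ₂ * y⁻¹) ≤ ((m + M).factorial / δ₂ ^ (m + M)) * y ^ M := by
        calc y⁻¹ ^ m * Real.exp (-δ₂ * y⁻¹) = (y⁻¹ ^ (m + M) * Real.exp (-δ₂ * y⁻¹)) * y ^ M := by
              rw [pow_add]
              have : y⁻¹ ^ M * y ^ M = 1 := by rw [← mul_pow, inv_mul_cancel₀ hy.ne', one_pow]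
              linear_combination (-(y⁻¹ ^ m * Real.exp (-δ₂ * y⁻¹))) * this
          _ ≤ _ := by gcongr
      have h8 : 1 ≤ Real.exp δ₁ * Real.exp (-δ₁ * y) := by
        rw [← Real.exp_add]
        apply Real.one_le_exp
        nlinarith
      calc _ ≤ A₂ * y⁻¹ ^ m * Real.exp (-δ₂ * y⁻¹) := h2 y hy h'
        _ = A₂ * (y⁻¹ ^ m * Real.exp (-δ₂ * y⁻¹)) * 1 := by ring
        _ ≤ A₂ * (((m + M).factorial / δ₂ ^ (m + M)) * Real.sqrt y ^ M) *
            (Real.exp δ₁ * Real.exp (-δ₁ * y)) :=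
          mul_le_mul (mul_le_mul_of_nonneg_left (h7.trans (by gcongr)) hA₂) h8 zero_le_one
            (by positivity)
        _ = _ := by rw [hC₂]; ring
    · right
      have h3 : 1 ≤ (Real.sqrt y₀ ^ M)⁻¹ * Real.sqrt y ^ M := by
        rw [← inv_pow, ← mul_pow]
        refine one_le_pow₀ ?_
        rw [inv_mul_eq_div, one_le_div hs0]
        exact Real.sqrt_le_sqrt h'
      have h4 : 1 ≤ Real.exp (δ₁ * y₁) * Real.exp (-δ₁ * y) := by
        rw [← Real.exp_add]
        apply Real.one_le_exp
        nlinarith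
      calc _ ≤ B := hB y ⟨h', h⟩
        _ = B * 1 * 1 := by ring
        _ ≤ B * ((Real.sqrt y₀ ^ M)⁻¹ * Real.sqrt y ^ M) * (Real.exp (δ₁ * y₁) * Real.exp (-δ₁ * y)) :=
          mul_le_mul (mul_le_mul_of_nonneg_left h3 hB0) h4 zero_le_one (by positivity)
        _ = _ := by rw [hC₃]; ring

theorem continuousOn_vertical {θ : ℂ → ℂ} (hθ : DifferentiableOn ℂ θ {z | 0 < z.im}) (r : ℝ) :
    ContinuousOn (fun y : ℝ => θ (r + y * I)) (Ioi 0) := by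
  refine hθ.continuousOn.comp (by fun_prop) fun y hy => ?_
  rw [mem_ofPred_eq, add_mul_I_im]
  exact hy

theorem rapidDecay_vertical {θ : ℂ → ℂ} {m : ℕ} {r : ℝ} (hθ : DifferentiableOn ℂ θ {z | 0 < z.im})
    (h1 : DecaysAtInfty θ) (h2 : DecaysAtCusp m θ r) : RapidDecay fun y => θ (r + y * I) := by
  obtain ⟨A1, δ1, hA1, hδ1, hb1⟩ := h1
  obtain ⟨A2, δ2, hA2, hδ2, hb2⟩ := h2
  refine rapidDecay_of_bounds (m := m) (continuousOn_vertical hθ r) one_pos le_rfl le_rfl hA1 hδ1 hA2 hδ2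
    (fun y hy => ?_) fun y hy hy1 => ?_
  · have h3 := hb1 (r + y * I) (by rwa [add_mul_I_im])
    rwa [add_mul_I_im] at h3
  · have hy0 : (y : ℂ) ≠ 0 := by exact_mod_cast hy.ne'
    have hu : ((y⁻¹ : ℝ) * I : ℂ).im = y⁻¹ := by simp
    have hun : ‖((y⁻¹ : ℝ) * I : ℂ)‖ = y⁻¹ := by
      rw [norm_mul, Complex.norm_I, mul_one, Complex.norm_real, Real.norm_eq_abs, abs_of_pos (by positivity)]
    have h3 := hb2 ((y⁻¹ : ℝ) * I) (by rw [hu]; exact (one_le_inv₀ hy).mpr hy1)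
    rw [hu, hun] at h3
    have h4 : (r : ℂ) + -1 / ((y⁻¹ : ℝ) * I) = r + y * I := by
      push_cast
      field_simp
      linear_combination (-(y : ℂ)) * Complex.I_sq
    rwa [h4] at h3

theorem sqrt_le_norm_csqrt (z : ℂ) : Real.sqrt |z.im| ≤ ‖csqrt z‖ := by
  rw [Real.sqrt_le_left (norm_nonneg _), norm_csqrt]
  exact Complex.abs_im_le_norm z

theorem norm_inv_csqrt_pow_le (s : ℝ) {y : ℝ} (hy : 0 < y) (k : ℕ) :
    ‖(csqrt (s + y * I) ^ k)⁻¹‖ ≤ (Real.sqrt y ^ k)⁻¹ := by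
  have h := sqrt_le_norm_csqrt (s + y * I)
  simp only [Complex.add_im, Complex.ofReal_im, Complex.mul_im, Complex.ofReal_re, Complex.I_im,
      mul_one, Complex.I_re, mul_zero, add_zero, zero_add, abs_of_pos hy] at h
  rw [norm_inv, norm_pow]
  have := Real.sqrt_pos.mpr hy
  gcongr

theorem hasDerivAt_inv_csqrt_pow {z : ℂ} (hz : z ∈ slitPlane) (k : ℕ) :
    HasDerivAt (fun z => (csqrt z ^ k)⁻¹) (-(k / 2) * (csqrt z ^ (k + 2))⁻¹) z := by
  have h1 : HasDerivAt csqrt (1 / 2 * (csqrt z)⁻¹) z := by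
    have h2 := ((hasDerivAt_id z).cpow_const (c := 1 / 2) hz)
    refine h2.congr_deriv ?_
    have hz0 : z ≠ 0 := slitPlane_ne_zero hz
    have h3 : z ^ ((1 / 2 : ℂ) - 1) = (csqrt z)⁻¹ := by
      rw [csqrt, ← Complex.cpow_neg]
      norm_num
    simp only [id]
    rw [h3, mul_one]
  have h0 : csqrt z ≠ 0 := csqrt_ne_zero (slitPlane_ne_zero hz)
  have h4 := (h1.pow k).inv (pow_ne_zero k h0)
  refine h4.congr_deriv ?_
  rcases k with _ | k
  · simp
  · simp only [Nat.add_sub_cancel]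
    field_simp
    simp only [Pi.pow_apply]
    ring

theorem upper_mem_slitPlane {z : ℂ} (hz : 0 < z.im) : z ∈ slitPlane :=
  mem_slitPlane_iff.mpr (Or.inr hz.ne')

theorem continuousOn_inv_csqrt_pow (s : ℝ) (k : ℕ) :
    ContinuousOn (fun y : ℝ => (csqrt (s + y * I) ^ k)⁻¹) (Ioi 0) := by
  intro y hy
  have h1 : (s : ℂ) + y * I ∈ slitPlane := upper_mem_slitPlane (by rw [add_mul_I_im]; exact hy)
  have h2 : ContinuousAt (fun y : ℝ => (s : ℂ) + y * I) y := by fun_prop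
  exact (ContinuousAt.comp (f := fun y : ℝ => (s : ℂ) + y * I)
    (hasDerivAt_inv_csqrt_pow h1 k).continuousAt h2).continuousWithinAt

theorem integrableOn_exp_neg {δ : ℝ} (hδ : 0 < δ) (A : ℝ) :
    IntegrableOn (fun y : ℝ => A * Real.exp (-δ * y)) (Ioi 0) :=
  (integrableOn_exp_mul_Ioi (by linarith) 0).const_mul A

theorem RapidDecay.exists_bound {g : ℝ → ℂ} (hg : RapidDecay g) (k : ℕ) :
    ∃ A δ : ℝ, 0 ≤ A ∧ 0 < δ ∧ ∀ y : ℝ, 0 < y → ‖g y‖ * (Real.sqrt y ^ k)⁻¹ ≤ A * Real.exp (-δ * y) := by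
  obtain ⟨A, δ, hA, hδ, h⟩ := hg k
  refine ⟨A, δ, hA, hδ, fun y hy => ?_⟩
  have h1 : 0 < Real.sqrt y ^ k := by have := Real.sqrt_pos.mpr hy; positivity
  rw [← div_eq_mul_inv, div_le_iff₀ h1]
  have := h y hy
  linarith

theorem RapidDecay.integrableOn {g : ℝ → ℂ} (hg : RapidDecay g) (hc : ContinuousOn g (Ioi 0))
    (s : ℝ) (k : ℕ) : IntegrableOn (fun y : ℝ => g y * (csqrt (s + y * I) ^ k)⁻¹) (Ioi 0) := by
  obtain ⟨A, δ, hA, hδ, h⟩ := hg.exists_bound k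
  refine Integrable.mono' (integrableOn_exp_neg hδ A)
    ((hc.mul (continuousOn_inv_csqrt_pow s k)).aestronglyMeasurable measurableSet_Ioi) ?_
  filter_upwards [ae_restrict_mem measurableSet_Ioi] with y hy
  rw [norm_mul]
  refine le_trans ?_ (h y hy)
  gcongr
  exact norm_inv_csqrt_pow_le s hy k

/-- The integral of `θ(w) (w - x)^(-κ/2)` over the vertical half-line that ends in `r`, without the
factor `i = dw/dy`. -/
def eichler (κ : ℕ) (θ : ℂ → ℂ) (r x : ℝ) : ℂ :=
  ∫ y in Ioi (0 : ℝ), θ (r + y * I) * (csqrt ((r - x : ℝ) + y * I) ^ κ)⁻¹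

theorem lowerSqrt_sq (c : ℤ) (y : ℝ) : lowerSqrt c y ^ 2 = y := by
  unfold lowerSqrt
  split_ifs with h h1
  · rw [← Complex.ofReal_pow, Real.sq_sqrt h]
  · rw [mul_pow, ← Complex.ofReal_pow, Real.sq_sqrt (by linarith)]
    simp
  · rw [mul_pow, ← Complex.ofReal_pow, Real.sq_sqrt (by linarith)]
    simp

/-- Compatibility of the branches of the square root: on the upper half-plane the principal branch
is used, and on the real line the limit from the lower half-plane. -/
theorem csqrt_moebius_sub {a b c d : ℤ} (hdet : a * d - b * c = 1) (hc : c ≠ 0) {x : ℝ}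
    (hx : (c : ℝ) * x + d ≠ 0) {w : ℂ} (hw : 0 < w.im) :
    csqrt ((a * w + b) / (c * w + d) - ((a * x + b) / (c * x + d) : ℝ)) * csqrt (c * w + d) *
      lowerSqrt c (c * x + d) = csqrt (w - x) := by
  have hu := lin_ne_zero_of_det hdet hw
  have hx' : (c : ℂ) * x + d ≠ 0 := by exact_mod_cast hx
  have hd : (a : ℂ) * d - b * c = 1 := by exact_mod_cast hdet
  have him : 0 < ((a * w + b) / (c * w + d) - ((a * x + b) / (c * x + d) : ℝ) : ℂ).im := by
    rw [Complex.sub_im, Complex.ofReal_im, sub_zero]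
    exact moebius_im_pos hdet hw
  have him2 : 0 < (w - x).im := by simpa using hw
  set A := csqrt ((a * w + b) / (c * w + d) - ((a * x + b) / (c * x + d) : ℝ)) with hA
  set D := csqrt (c * w + d) with hD
  set B := csqrt (w - x) with hB
  have hsq : (A * D * lowerSqrt c (c * x + d)) ^ 2 = B ^ 2 := by
    rw [mul_pow, mul_pow, csqrt_sq, csqrt_sq, csqrt_sq, lowerSqrt_sq]
    push_cast
    rw [div_sub_div _ _ hu hx', div_mul_eq_mul_div, div_mul_eq_mul_div, div_eq_iff (mul_ne_zero hu hx')]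
    linear_combination ((w - x) * (c * w + d) * (c * x + d)) * hd
  rcases sq_eq_sq_iff_eq_or_eq_neg.mp hsq with h | h
  · exact h
  -- the opposite sign is excluded by the quadrants in which the square roots lie
  exfalso
  have A1 := csqrt_re_pos him.ne'
  have A2 := csqrt_im_pos him
  have B1 := csqrt_re_pos him2.ne'
  have B2 := csqrt_im_pos him2
  rw [← hA] at A1 A2
  rw [← hB] at B1 B2
  have hcw : (c * w + d : ℂ).im = c * w.im := lin_im c d w
  rcases lt_or_gt_of_ne hc with hneg | hpos
  · have hcw' : (c * w + d : ℂ).im < 0 := by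
      rw [hcw]; exact mul_neg_of_neg_of_pos (by exact_mod_cast hneg) hw
    have D1 := csqrt_re_pos hcw'.ne
    have D2 := csqrt_im_neg hcw'
    rw [← hD] at D1 D2
    have hAD : 0 < (A * D).re := by
      rw [Complex.mul_re]
      have := mul_pos A1 D1
      have := mul_neg_of_pos_of_neg A2 D2
      linarith
    unfold lowerSqrt at h
    split_ifs at h with h1 h2
    · have := congrArg Complex.re h
      rw [mul_comm, Complex.re_ofReal_mul, Complex.neg_re] at this
      have h3 : 0 ≤ Real.sqrt (c * x + d) := Real.sqrt_nonneg _
      nlinarith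
    · omega
    · have := congrArg Complex.im h
      rw [← mul_assoc, mul_comm, Complex.im_ofReal_mul, Complex.neg_im, Complex.mul_im] at this
      simp only [Complex.I_re, Complex.I_im, mul_one, mul_zero, add_zero] at this
      have h3 : 0 ≤ Real.sqrt (-(c * x + d)) := Real.sqrt_nonneg _
      nlinarith
  · have hcw' : 0 < (c * w + d : ℂ).im := by
      rw [hcw]; exact mul_pos (by exact_mod_cast hpos) hw
    have D1 := csqrt_re_pos hcw'.ne'
    have D2 := csqrt_im_pos hcw'
    rw [← hD] at D1 D2
    have hAD : 0 < (A * D).im := by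
      rw [Complex.mul_im]
      have := mul_pos A1 D2
      have := mul_pos A2 D1
      linarith
    unfold lowerSqrt at h
    split_ifs at h with h1
    · have := congrArg Complex.im h
      rw [mul_comm, Complex.im_ofReal_mul, Complex.neg_im] at this
      have h3 : 0 ≤ Real.sqrt (c * x + d) := Real.sqrt_nonneg _
      nlinarith
    · have := congrArg Complex.re h
      rw [← mul_assoc, mul_comm, Complex.re_ofReal_mul, Complex.neg_re, Complex.mul_re] at this
      simp only [Complex.neg_re, Complex.neg_im, Complex.I_re, Complex.I_im, neg_zero, mul_zero] at this
      have h3 : 0 ≤ Real.sqrt (-(c * x + d)) := Real.sqrt_nonneg _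
      nlinarith

theorem DecaysAtCusp.mul_kernel {m : ℕ} {θ : ℂ → ℂ} {r : ℝ} (h : DecaysAtCusp m θ r) (x : ℝ) (k : ℕ) :
    DecaysAtCusp (m + k) (fun w => θ w * (csqrt (w - x) ^ k)⁻¹) r := by
  obtain ⟨A, δ, hA, hδ, hb⟩ := h
  refine ⟨A, δ, hA, hδ, fun u hu => ?_⟩
  have hu0 : 0 < ‖u‖ := norm_pos_iff.mpr (by rintro rfl; simp at hu; linarith)
  have h1 : ‖(csqrt ((r : ℂ) + -1 / u - x) ^ k)⁻¹‖ ≤ ‖u‖ ^ k := by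
    have h2 : ‖u‖⁻¹ ≤ ‖csqrt ((r : ℂ) + -1 / u - x)‖ := by
      refine le_trans ?_ (sqrt_le_norm_csqrt _)
      apply Real.le_sqrt_of_sq_le
      have : ((r : ℂ) + -1 / u - x).im = u.im / ‖u‖ ^ 2 := by
        simp [Complex.div_im, Complex.normSq_eq_norm_sq]
        ring
      rw [this, abs_of_pos (by positivity), inv_pow, inv_eq_one_div]
      gcongr
    rw [norm_inv, norm_pow, inv_le_comm₀ (by have : 0 < ‖u‖⁻¹ := by positivity
                                             have := this.trans_le h2; positivity) (by positivity),
      ← inv_pow]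
    gcongr
  rw [norm_mul, pow_add]
  calc _ ≤ (A * ‖u‖ ^ m * Real.exp (-δ * u.im)) * ‖u‖ ^ k := by
        gcongr
        exact hb u hu
    _ = _ := by ring

theorem DecaysAtInfty.mul_kernel {θ : ℂ → ℂ} (h : DecaysAtInfty θ) (x : ℝ) (k : ℕ) :
    DecaysAtInfty (fun w => θ w * (csqrt (w - x) ^ k)⁻¹) := by
  obtain ⟨A, δ, hA, hδ, hb⟩ := h
  refine ⟨A, δ, hA, hδ, fun z hz => ?_⟩
  have h1 : ‖(csqrt (z - x) ^ k)⁻¹‖ ≤ 1 := by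
    have h2 : 1 ≤ ‖csqrt (z - x)‖ := by
      refine le_trans ?_ (sqrt_le_norm_csqrt _)
      rw [Real.one_le_sqrt]
      simp
      exact hz.trans (le_abs_self _)
    rw [norm_inv, norm_pow]
    exact inv_le_one_of_one_le₀ (one_le_pow₀ h2)
  rw [norm_mul]
  calc _ ≤ (A * Real.exp (-δ * z.im)) * 1 := by
        gcongr
        exact hb z hz
    _ = _ := by ring

/-! ### The defect of modularity as a contour integral -/

theorem hasDerivAt_vertical {g G : ℂ → ℂ} (hG : ∀ z : ℂ, 0 < z.im → HasDerivAt G (g z) z) (r : ℝ)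
    {y : ℝ} (hy : 0 < y) :
    HasDerivAt (fun y : ℝ => G (r + y * I)) (I * g (r + y * I)) y := by
  have h1 : HasDerivAt (fun y : ℝ => (r : ℂ) + y * I) I y := by
    simpa using ((HasDerivAt.ofReal_comp (hasDerivAt_id y)).mul_const I).const_add (r : ℂ)
  have h2 := hG (r + y * I) (by rw [add_mul_I_im]; exact hy)
  have h3 := HasDerivAt.comp (𝕜 := ℝ) (h₂ := G) (h := fun y : ℝ => (r : ℂ) + y * I) (x := y) h2 h1
  rw [mul_comm] at h3
  exact h3

/-- The contour argument: for `f(x)` the Eichler integral of `θ` over the vertical line over `x`, the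
defect of modularity of `f` under `γ` is the integral over the vertical line over `γ⁻¹(i∞)`. The
image under `γ⁻¹` of the vertical line over `γ x` is a semicircle from `x` to `γ⁻¹(i∞)`. -/
theorem eichler_contour {a b c d : ℤ} (hdet : a * d - b * c = 1) (hc : c ≠ 0) {κ m : ℕ} (hκ : κ ≤ 4)
    {θ : ℂ → ℂ} (hθ : DifferentiableOn ℂ θ {z | 0 < z.im}) {μ : ℂ} (hμ : μ * μ = 1)
    (hlaw : ∀ z : ℂ, 0 < z.im →
      θ ((a * z + b) / (c * z + d)) = μ * csqrt (c * z + d) ^ (4 - κ) * θ z)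
    (hinf : DecaysAtInfty θ) {x x' r : ℝ} (hx : (c : ℝ) * x + d ≠ 0)
    (hx' : x' = (a * x + b) / (c * x + d)) (hr : r = -d / c)
    (hdx : DecaysAtCusp m θ x) (hdx' : DecaysAtCusp m θ x') (hdr : DecaysAtCusp m θ r) :
    eichler κ θ x x - μ * (lowerSqrt c (c * x + d) ^ κ)⁻¹ * eichler κ θ x' x' = eichler κ θ r x := by
  set g : ℂ → ℂ := fun w => θ w * (csqrt (w - x) ^ κ)⁻¹ with hg
  have hgd : DifferentiableOn ℂ g {z | 0 < z.im} := by
    refine hθ.mul fun z hz => ?_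
    have hz' : z - x ∈ slitPlane := upper_mem_slitPlane (by simpa using hz)
    exact ((hasDerivAt_inv_csqrt_pow hz' κ).differentiableAt.comp z
      (differentiableAt_id.sub_const (x : ℂ))).differentiableWithinAt
  obtain ⟨G, hG⟩ := exists_primitive_upperHalfPlane hgd
  have hdet' : (a : ℂ) * d - b * c = 1 := by exact_mod_cast hdet
  have hdetr : (a : ℝ) * d - b * c = 1 := by exact_mod_cast hdet
  have hcR : (c : ℝ) ≠ 0 := by exact_mod_cast hc
  have hcC : (c : ℂ) ≠ 0 := by exact_mod_cast hc
  have hxC : (c : ℂ) * x + d ≠ 0 := by exact_mod_cast hx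
  have hc2 : (0 : ℝ) < (c : ℝ) ^ 2 := by positivity
  have hcx2 : (0 : ℝ) < (c * x + d) ^ 2 := by positivity
  have hvert : ∀ s : ℝ, DecaysAtCusp m θ s →
      IntegrableOn (fun y : ℝ => I * g (s + y * I)) (Ioi 0) ∧
        ∫ y in Ioi (0 : ℝ), I * g (s + y * I) = I * eichler κ θ s x := by
    intro s hs
    have h1 : (fun y : ℝ => I * g (s + y * I)) =
        fun y : ℝ => I * (θ (s + y * I) * (csqrt ((s - x : ℝ) + y * I) ^ κ)⁻¹) := by
      funext y
      simp only [hg]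
      rw [show (s : ℂ) + y * I - x = (s - x : ℝ) + y * I by push_cast; ring]
    rw [h1]
    refine ⟨((rapidDecay_vertical hθ hinf hs).integrableOn (continuousOn_vertical hθ s) (s - x) κ).const_mul I, ?_⟩
    rw [MeasureTheory.integral_const_mul]
    rfl
  -- the vertical lines over `r` and over `x`
  have L1 : Tendsto (fun T : ℝ => G (r + (T : ℝ) * I) - G (r + ((c ^ 2 * T)⁻¹ : ℝ) * I)) atTop
      (𝓝 (I * eichler κ θ r x)) := by
    rw [← (hvert r hdr).2]
    refine tendsto_sub_of_hasDerivAt_Ioi (f := fun y : ℝ => G (r + y * I))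
      (fun y hy => hasDerivAt_vertical hG r hy) (hvert r hdr).1
      (tendsto_inv_atTop_zero.comp (tendsto_id.const_mul_atTop hc2)) tendsto_id ?_
    filter_upwards [eventually_gt_atTop 0] with T hT
    positivity
  have L3 : Tendsto (fun T : ℝ => G (x + (T : ℝ) * I) - G (x + ((((c * x + d) ^ 2)⁻¹ * T)⁻¹ : ℝ) * I))
      atTop (𝓝 (I * eichler κ θ x x)) := by
    rw [← (hvert x hdx).2]
    refine tendsto_sub_of_hasDerivAt_Ioi (f := fun y : ℝ => G (x + y * I))
      (fun y hy => hasDerivAt_vertical hG x hy) (hvert x hdx).1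
      (tendsto_inv_atTop_zero.comp (tendsto_id.const_mul_atTop (inv_pos.mpr hcx2))) tendsto_id ?_
    filter_upwards [eventually_gt_atTop 0] with T hT
    positivity
  -- the semicircle
  have hden : ∀ y : ℝ, 0 < y → (a : ℂ) - c * (x' + y * I) ≠ 0 := by
    intro y hy h
    have := congrArg Complex.im h
    simp at this
    rcases this with h | h
    · exact hc h
    · exact hy.ne' h
  set w : ℝ → ℂ := fun y => (d * (x' + y * I) - b) / (a - c * (x' + y * I)) with hw
  have hwl : ∀ y : ℝ, 0 < y → (c : ℂ) * w y + d = (a - c * (x' + y * I))⁻¹ := by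
    intro y hy
    have := hden y hy
    simp only [hw]
    refine eq_inv_of_mul_eq_one_left ?_
    rw [add_mul, mul_assoc, div_mul_cancel₀ _ this]
    linear_combination hdet'
  have hwm : ∀ y : ℝ, 0 < y → (a * w y + b) / (c * w y + d) = x' + y * I := by
    intro y hy
    have := hden y hy
    rw [hwl y hy, div_inv_eq_mul]
    simp only [hw]
    rw [add_mul, mul_assoc, div_mul_cancel₀ _ this]
    linear_combination ((x' : ℂ) + y * I) * hdet'
  have hwim : ∀ y : ℝ, 0 < y → 0 < (w y).im := by
    intro y hy
    have h1 := moebius_im_pos (a := d) (b := -b) (c := -c) (d := a) (by linarith) (z := (x' : ℂ) + y * I)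
      (by rw [add_mul_I_im]; exact hy)
    convert h1 using 2
    simp only [hw]
    push_cast
    ring
  have hw' : ∀ y : ℝ, 0 < y → HasDerivAt w (I * csqrt (c * w y + d) ^ 4) y := by
    intro y hy
    have h1 : HasDerivAt (fun y : ℝ => (x' : ℂ) + y * I) I y := by
      simpa using ((HasDerivAt.ofReal_comp (hasDerivAt_id y)).mul_const I).const_add (x' : ℂ)
    have h2 := ((h1.const_mul (d : ℂ)).sub_const (b : ℂ)).div ((h1.const_mul (c : ℂ)).const_sub (a : ℂ)) (hden y hy)
    refine h2.congr_deriv ?_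
    rw [show csqrt (c * w y + d) ^ 4 = (csqrt (c * w y + d) ^ 2) ^ 2 by ring, csqrt_sq, hwl y hy, inv_pow,
      ← div_eq_mul_inv]
    congr 1
    linear_combination I * hdet'
  have hwg : ∀ y : ℝ, 0 < y → g (w y) * (I * csqrt (c * w y + d) ^ 4) =
      I * (μ * (lowerSqrt c (c * x + d) ^ κ)⁻¹) * (θ (x' + y * I) * (csqrt ((x' - x' : ℝ) + y * I) ^ κ)⁻¹) := by
    intro y hy
    have h1 := csqrt_moebius_sub hdet hc hx (hwim y hy)
    rw [hwm y hy, ← hx'] at h1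
    have h2 := hlaw (w y) (hwim y hy)
    rw [hwm y hy] at h2
    have h3 : csqrt (c * w y + d) ≠ 0 := csqrt_ne_zero (by rw [hwl y hy]; exact inv_ne_zero (hden y hy))
    have h4 : csqrt (c * w y + d) ^ 4 = csqrt (c * w y + d) ^ (4 - κ) * csqrt (c * w y + d) ^ κ := by
      rw [← pow_add]; congr 1; omega
    have h5 : ((x' - x' : ℝ) : ℂ) + y * I = x' + y * I - x' := by push_cast; ring
    rw [h5]
    simp only [hg]
    rw [← h1, h2, h4, mul_pow, mul_pow, mul_inv, mul_inv]
    have h6 := inv_mul_cancel₀ (pow_ne_zero κ h3)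
    generalize (csqrt (c * w y + d) ^ κ)⁻¹ = D at h6 ⊢
    generalize (csqrt (x' + y * I - x') ^ κ)⁻¹ = E
    linear_combination (θ (w y) * E * (lowerSqrt c (c * x + d) ^ κ)⁻¹ * I * csqrt (c * w y + d) ^ (4 - κ)) *
      (h6 - hμ)
  have L2 : Tendsto (fun T : ℝ => G (w T) - G (w T⁻¹)) atTop
      (𝓝 (I * (μ * (lowerSqrt c (c * x + d) ^ κ)⁻¹) * eichler κ θ x' x')) := by
    rw [eichler, ← MeasureTheory.integral_const_mul]
    refine tendsto_sub_of_hasDerivAt_Ioi (f := fun y : ℝ => G (w y)) (fun y hy => ?_) ?_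
      tendsto_inv_atTop_zero tendsto_id ?_
    · rw [← hwg y hy]
      exact HasDerivAt.comp (𝕜 := ℝ) (h₂ := G) (h := w) (x := y) (hG _ (hwim y hy)) (hw' y hy)
    · exact ((rapidDecay_vertical hθ hinf hdx').integrableOn (continuousOn_vertical hθ x') (x' - x') κ).const_mul _
    · filter_upwards [eventually_gt_atTop 0] with T hT
      positivity
  -- the three pieces match up near the cusps
  have K1 := tendsto_primitive_cusp hG (hdr.mul_kernel x κ) hc2 (c ^ 2 * x' - a * c)
  have K2 := tendsto_primitive_cusp hG (hdx.mul_kernel x κ) (inv_pos.mpr hcx2) (c / (c * x + d))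
  have K3 := tendsto_primitive_infty hG (hinf.mul_kernel x κ) r x
  have hvinv : ∀ y : ℝ, y ≠ 0 → -1 / ((y : ℝ) * I : ℂ) = (y⁻¹ : ℝ) * I := by
    intro y hy
    have : (y : ℂ) ≠ 0 := by exact_mod_cast hy
    push_cast
    field_simp
    rw [Complex.I_sq]
  have hw1 : ∀ T : ℝ, 0 < T →
      (r : ℂ) + -1 / (((c ^ 2 * x' - a * c : ℝ) : ℂ) + (c ^ 2 * T : ℝ) * I) = w T := by
    intro T hT
    have h1 := hden T hT
    have h2 : ((c ^ 2 * x' - a * c : ℝ) : ℂ) + (c ^ 2 * T : ℝ) * I = -c * (a - c * (x' + T * I)) := by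
      push_cast; ring
    rw [h2]
    simp only [hw, hr]
    push_cast
    generalize hq : (a : ℂ) - c * (x' + T * I) = q at h1 ⊢
    generalize (x' : ℂ) + T * I = W at hq ⊢
    field_simp
    linear_combination (d : ℂ) * hq - hdet'
  have hw2 : ∀ T : ℝ, 0 < T →
      (x : ℂ) + -1 / (((c / (c * x + d) : ℝ) : ℂ) + (((c * x + d) ^ 2)⁻¹ * T : ℝ) * I) = w T⁻¹ := by
    intro T hT
    have hTC : (T : ℂ) ≠ 0 := by exact_mod_cast hT.ne'
    generalize hn : (c : ℂ) * x + d = n at hxC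
    have hq : (T : ℂ) - c * n * I ≠ 0 := by
      intro h
      rw [← hn] at h
      have := congrArg Complex.re h
      simp at this
      exact hT.ne' this
    have h1 : (a : ℂ) - c * (x' + (T⁻¹ : ℝ) * I) = (T - c * n * I) / (n * T) := by
      rw [hx', eq_div_iff (mul_ne_zero hxC hTC)]
      push_cast
      rw [hn]
      field_simp
      linear_combination (-a * T : ℂ) * hn + (T : ℂ) * hdet'
    have h2 : (d : ℂ) * (x' + (T⁻¹ : ℝ) * I) - b = (x * T + d * n * I) / (n * T) := by
      rw [hx', eq_div_iff (mul_ne_zero hxC hTC)]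
      push_cast
      rw [hn]
      field_simp
      linear_combination (b * T : ℂ) * hn + (x * T : ℂ) * hdet'
    have h3 : ((c / (c * x + d) : ℝ) : ℂ) + (((c * x + d) ^ 2)⁻¹ * T : ℝ) * I = I * (T - c * n * I) / n ^ 2 := by
      push_cast
      rw [hn]
      field_simp
      linear_combination (c * n : ℂ) * Complex.I_sq
    simp only [hw]
    rw [h1, h2, h3, div_div_div_cancel_right₀ (mul_ne_zero hxC hTC)]
    generalize hQ : (T : ℂ) - c * n * I = Q at hq ⊢
    field_simp
    linear_combination (-(x * I) : ℂ) * hQ - (I ^ 2 * n) * hn - n ^ 2 * Complex.I_sq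
  have K : Tendsto (fun T : ℝ => (0 : ℂ)) atTop (𝓝 (I * eichler κ θ r x - I * eichler κ θ x x +
      I * (μ * (lowerSqrt c (c * x + d) ^ κ)⁻¹) * eichler κ θ x' x' - 0 + 0 - 0)) := by
    refine (((((L1.sub L3).add L2).sub K1).add K2).sub K3).congr' ?_
    filter_upwards [eventually_gt_atTop 0] with T hT
    rw [hw1 T hT, hw2 T hT, hvinv _ (by positivity), hvinv _ (by positivity)]
    ring
  have h0 := tendsto_nhds_unique tendsto_const_nhds K
  refine mul_left_cancel₀ Complex.I_ne_zero ?_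
  linear_combination h0

/-! ### Regularity of Eichler integrals -/

theorem hasDerivAt_eichler {θ : ℂ → ℂ} {r : ℝ} (hg : RapidDecay fun y => θ (r + y * I))
    (hc : ContinuousOn (fun y : ℝ => θ (r + y * I)) (Ioi 0)) (k : ℕ) (x : ℝ) :
    HasDerivAt (eichler k θ r) ((k / 2 : ℂ) * eichler (k + 2) θ r x) x := by
  obtain ⟨A, δ, hA, hδ, h⟩ := hg.exists_bound (k + 2)
  have key := hasDerivAt_integral_of_dominated_loc_of_deriv_le (μ := volume.restrict (Ioi (0 : ℝ)))
    (F := fun (x : ℝ) (y : ℝ) => θ (r + y * I) * (csqrt ((r - x : ℝ) + y * I) ^ k)⁻¹)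
    (F' := fun (x : ℝ) (y : ℝ) =>
      (k / 2 : ℂ) * (θ (r + y * I) * (csqrt ((r - x : ℝ) + y * I) ^ (k + 2))⁻¹))
    (x₀ := x) (s := univ) (bound := fun y => ‖(k / 2 : ℂ)‖ * (A * Real.exp (-δ * y))) univ_mem
    (Eventually.of_forall fun x' => (hg.integrableOn hc (r - x') k).aestronglyMeasurable)
    (hg.integrableOn hc (r - x) k)
    ((hg.integrableOn hc (r - x) (k + 2)).const_mul _).aestronglyMeasurable ?_
    ((integrableOn_exp_neg hδ A).const_mul _) ?_
  · refine key.2.congr_deriv ?_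
    rw [MeasureTheory.integral_const_mul]
    rfl
  · filter_upwards [ae_restrict_mem measurableSet_Ioi] with y hy x' _
    rw [norm_mul, norm_mul]
    refine mul_le_mul_of_nonneg_left (le_trans ?_ (h y hy)) (norm_nonneg _)
    gcongr
    exact norm_inv_csqrt_pow_le _ hy _
  · filter_upwards [ae_restrict_mem measurableSet_Ioi] with y hy x' _
    have h1 : ((r - x' : ℝ) : ℂ) + y * I ∈ slitPlane := upper_mem_slitPlane (by rw [add_mul_I_im]; exact hy)
    have h2 : HasDerivAt (fun x' : ℝ => ((r - x' : ℝ) : ℂ) + y * I) (-1) x' := by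
      have h3 : HasDerivAt (fun x' : ℝ => r - x') (-1) x' := (hasDerivAt_id x').const_sub r
      simpa using h3.ofReal_comp.add_const (y * I : ℂ)
    have h4 := HasDerivAt.comp (𝕜 := ℝ) (x := x') (hasDerivAt_inv_csqrt_pow h1 k) h2
    refine (h4.const_mul (θ (r + y * I))).congr_deriv ?_
    ring

/-- Smoothness holds at `x = r` as well, since the rapid decay of `θ` compensates the singularity of the
kernel. -/
theorem contDiff_eichler {θ : ℂ → ℂ} {r : ℝ} (hg : RapidDecay fun y => θ (r + y * I))
    (hc : ContinuousOn (fun y : ℝ => θ (r + y * I)) (Ioi 0)) (k : ℕ) :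
    ContDiff ℝ ∞ (eichler k θ r) := by
  rw [contDiff_infty]
  intro n
  induction n generalizing k with
  | zero =>
    rw [Nat.cast_zero, contDiff_zero]
    exact continuous_iff_continuousAt.mpr fun x => (hasDerivAt_eichler hg hc k x).continuousAt
  | succ n ih =>
    rw [Nat.cast_succ, contDiff_succ_iff_deriv]
    refine ⟨fun x => (hasDerivAt_eichler hg hc k x).differentiableAt, by simp, ?_⟩
    have : deriv (eichler k θ r) = fun x => (k / 2 : ℂ) * eichler (k + 2) θ r x :=
      funext fun x => (hasDerivAt_eichler hg hc k x).deriv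
    rw [this]
    exact contDiff_const.mul (ih (k + 2))

/-- Off the real point `r` the Eichler integral extends to a holomorphic function of `z = ±(r - x)`
in the right half-plane. -/
theorem differentiableOn_eichler_kernel {g : ℝ → ℂ} (hg : IntegrableOn g (Ioi 0)) (σ : ℝ) (k : ℕ) :
    DifferentiableOn ℂ (fun z : ℂ => ∫ y in Ioi (0 : ℝ), g y * (csqrt (z + (σ * y : ℝ) * I) ^ k)⁻¹)
      {z | 0 < z.re} := by
  have hre : ∀ (z : ℂ) (y : ℝ), (z + (σ * y : ℝ) * I).re = z.re := by intro z y; simp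
  have hslit : ∀ (z : ℂ) (y : ℝ), 0 < z.re → z + (σ * y : ℝ) * I ∈ slitPlane := fun z y hz =>
    mem_slitPlane_iff.mpr (Or.inl (by rwa [hre]))
  have hbd : ∀ (z : ℂ) (y ρ : ℝ) (m : ℕ), 0 < ρ → ρ ^ 2 ≤ z.re →
      ‖(csqrt (z + (σ * y : ℝ) * I) ^ m)⁻¹‖ ≤ (ρ ^ m)⁻¹ := by
    intro z y ρ m hρ hz
    rw [norm_inv, norm_pow]
    have h1 : ρ ≤ ‖csqrt (z + (σ * y : ℝ) * I)‖ := by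
      refine (sq_le_sq₀ hρ.le (norm_nonneg _)).mp ?_
      rw [norm_csqrt]
      refine (hz.trans (le_of_eq (hre z y).symm)).trans (Complex.re_le_norm _)
    gcongr
  have hmeas : ∀ (z : ℂ) (m : ℕ), 0 < z.re → AEStronglyMeasurable
      (fun y : ℝ => g y * (csqrt (z + (σ * y : ℝ) * I) ^ m)⁻¹) (volume.restrict (Ioi 0)) := by
    intro z m hz
    refine hg.aestronglyMeasurable.mul (Continuous.aestronglyMeasurable ?_)
    refine continuous_iff_continuousAt.mpr fun y => ?_
    exact ContinuousAt.comp (f := fun y : ℝ => z + (σ * y : ℝ) * I)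
      (hasDerivAt_inv_csqrt_pow (hslit z y hz) m).continuousAt (by fun_prop)
  intro z hz
  have hz0 : 0 < z.re := hz
  set ρ := Real.sqrt (z.re / 2) with hρd
  have hρ : 0 < ρ := Real.sqrt_pos.mpr (by linarith)
  have hρ2 : ρ ^ 2 = z.re / 2 := Real.sq_sqrt (by linarith)
  have hint : IntegrableOn (fun y : ℝ => g y * (csqrt (z + (σ * y : ℝ) * I) ^ k)⁻¹) (Ioi 0) := by
    refine Integrable.mono' (hg.norm.mul_const (ρ ^ k)⁻¹) (hmeas z k hz) (Eventually.of_forall fun y => ?_)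
    rw [norm_mul]
    gcongr
    exact hbd z y ρ k hρ (by linarith)
  have key := hasDerivAt_integral_of_dominated_loc_of_deriv_le (μ := volume.restrict (Ioi (0 : ℝ)))
    (F := fun (z : ℂ) (y : ℝ) => g y * (csqrt (z + (σ * y : ℝ) * I) ^ k)⁻¹)
    (F' := fun (z : ℂ) (y : ℝ) =>
      (-(k / 2) : ℂ) * (g y * (csqrt (z + (σ * y : ℝ) * I) ^ (k + 2))⁻¹))
    (x₀ := z) (s := {w : ℂ | z.re / 2 < w.re}) (bound := fun y => ‖(-(k / 2) : ℂ)‖ * (‖g y‖ * (ρ ^ (k + 2))⁻¹))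
    ((isOpen_lt continuous_const Complex.continuous_re).mem_nhds
      (show z.re / 2 < z.re by linarith)) ?_ hint
    ((hmeas z (k + 2) hz).const_mul _) ?_ ((hg.norm.mul_const _).const_mul _) ?_
  · exact key.2.differentiableAt.differentiableWithinAt
  · filter_upwards [(isOpen_lt continuous_const Complex.continuous_re).mem_nhds hz0] with w hw
    exact hmeas w k hw
  · refine Eventually.of_forall fun y w hw => ?_
    have hw' : z.re / 2 < w.re := hw
    rw [norm_mul, norm_mul]
    gcongr
    exact hbd w y ρ _ hρ (by linarith)
  · refine Eventually.of_forall fun y w hw => ?_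
    have hw' : z.re / 2 < w.re := hw
    have h1 := (hasDerivAt_inv_csqrt_pow (hslit w y (by linarith)) k).comp_add_const w ((σ * y : ℝ) * I)
    refine (h1.const_mul (g y)).congr_deriv ?_
    ring

theorem csqrt_eq_I_mul {w : ℂ} (hw : 0 < w.im) : csqrt w = I * csqrt (-w) := by
  have h1 : csqrt w ^ 2 = (I * csqrt (-w)) ^ 2 := by
    rw [mul_pow, csqrt_sq, csqrt_sq, Complex.I_sq]; ring
  rcases sq_eq_sq_iff_eq_or_eq_neg.mp h1 with h | h
  · exact h
  · exfalso
    have h2 := csqrt_re_pos hw.ne'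
    have h3 := csqrt_im_neg (z := -w) (by simpa using hw)
    have := congrArg Complex.re h
    simp at this
    linarith

theorem analyticOnNhd_eichler {θ : ℂ → ℂ} {r : ℝ} (hg : RapidDecay fun y => θ (r + y * I))
    (hc : ContinuousOn (fun y : ℝ => θ (r + y * I)) (Ioi 0)) (k : ℕ) :
    AnalyticOnNhd ℝ (eichler k θ r) {x | x ≠ r} := by
  have hint : IntegrableOn (fun y : ℝ => θ (r + y * I)) (Ioi 0) := by
    simpa using hg.integrableOn hc 0 0
  have hopen : IsOpen {z : ℂ | 0 < z.re} := isOpen_lt continuous_const Complex.continuous_re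
  have key : ∀ (C : ℂ) (σ : ℝ) (x s : ℝ), 0 < s * (r - x) →
      (∀ᶠ x' in 𝓝 x, eichler k θ r x' =
        C * ∫ y in Ioi (0 : ℝ), θ (r + y * I) * (csqrt ((s * (r - x') : ℝ) + (σ * y : ℝ) * I) ^ k)⁻¹) →
      AnalyticAt ℝ (eichler k θ r) x := by
    intro C σ x s hs heq
    have h1 := ((differentiableOn_eichler_kernel hint σ k).analyticOnNhd hopen
      ((s * (r - x) : ℝ) : ℂ) (by simpa using hs)).restrictScalars (𝕜 := ℝ)
    have h2 : AnalyticAt ℝ (fun x' : ℝ => ((s * (r - x') : ℝ) : ℂ)) x :=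
      (Complex.ofRealCLM.analyticAt _).comp (analyticAt_const.mul (analyticAt_const.sub analyticAt_id))
    have h3 := analyticAt_const (𝕜 := ℝ) (v := C) (x := x) |>.mul (h1.fun_comp_of_eq h2 rfl)
    exact h3.congr (heq.mono fun x' h => h.symm)
  intro x hx
  rcases lt_or_gt_of_ne (show x ≠ r from hx) with h | h
  · refine key 1 1 x 1 (by linarith) (Eventually.of_forall fun x' => ?_)
    simp [eichler]
  · refine key ((I ^ k)⁻¹) (-1) x (-1) (by linarith) (Eventually.of_forall fun x' => ?_)
    rw [eichler, ← MeasureTheory.integral_const_mul]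
    refine setIntegral_congr_fun measurableSet_Ioi fun y hy => ?_
    have h1 := csqrt_eq_I_mul (w := ((r - x' : ℝ) : ℂ) + y * I) (by rw [add_mul_I_im]; exact hy)
    rw [h1, mul_pow, mul_inv, show -(((r - x' : ℝ) : ℂ) + y * I) = ((-1 * (r - x') : ℝ) : ℂ) + (-1 * y : ℝ) * I by
      push_cast; ring]
    ring

/-! ### Eichler integrals as quantum modular forms -/

theorem SL2Z_det (γ : SL2Z) : γ 0 0 * γ 1 1 - γ 0 1 * γ 1 0 = 1 := by
  have := γ.det_coe
  rwa [Matrix.det_fin_two] at this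

theorem thetaSymbol_mul_self {a b c d : ℤ} (hdet : a * d - b * c = 1) :
    thetaSymbol c d * thetaSymbol c d = 1 := by
  have h1 : IsCoprime c d := ⟨-b, a, by linarith⟩
  have h2 : c.gcd d.natAbs = 1 := by
    rw [Int.isCoprime_iff_gcd_eq_one] at h1
    rw [Int.gcd, Int.natAbs_natCast]
    exact h1
  have h3 := jacobiSym.sq_one h2
  unfold thetaSymbol
  split_ifs <;> linarith [h3, sq (jacobiSym c d.natAbs)]

theorem mem_Gamma_congr {N : ℕ} {γ : SL2Z} (h : γ ∈ CongruenceSubgroup.Gamma N) :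
    γ 0 0 ≡ 1 [ZMOD N] ∧ (N : ℤ) ∣ γ 0 1 ∧ (N : ℤ) ∣ γ 1 0 ∧ γ 1 1 ≡ 1 [ZMOD N] := by
  rw [CongruenceSubgroup.Gamma_mem] at h
  refine ⟨?_, ?_, ?_, ?_⟩
  · rw [← ZMod.intCast_eq_intCast_iff]; simpa using h.1
  · rw [← ZMod.intCast_zmod_eq_zero_iff_dvd]; exact h.2.1
  · rw [← ZMod.intCast_zmod_eq_zero_iff_dvd]; exact h.2.2.1
  · rw [← ZMod.intCast_eq_intCast_iff]; simpa using h.2.2.2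

theorem csqrt_one : csqrt 1 = 1 := by simp [csqrt]

/-- Eichler integrals of theta-like functions are quantum modular forms. The defect of modularity under
`γ` is the Eichler integral with endpoint `γ⁻¹(i∞) = -d / c` if `c ≠ 0`, and vanishes if `c = 0`. -/
theorem isQuantumModularForm_eichler {κ m N : ℕ} (hκ : κ ≤ 4) (hodd : Odd κ) (hN : 4 ∣ N)
    {θ : ℂ → ℂ} (hθ : DifferentiableOn ℂ θ {z | 0 < z.im}) (hinf : DecaysAtInfty θ)
    (hlaw : ∀ γ ∈ CongruenceSubgroup.Gamma N, ∀ z : ℂ, 0 < z.im →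
      θ ((γ 0 0 * z + γ 0 1) / (γ 1 0 * z + γ 1 1)) =
        (thetaSymbol (γ 1 0) (γ 1 1) : ℂ) * csqrt (γ 1 0 * z + γ 1 1) ^ (4 - κ) * θ z)
    {Q : Set ℚ}
    (hQ : ∀ γ ∈ CongruenceSubgroup.Gamma N, ∀ x ∈ Q, (γ 1 0 : ℚ) * x + γ 1 1 ≠ 0 → moebius γ x ∈ Q)
    (hcusp : ∀ x ∈ Q, DecaysAtCusp m θ (x : ℝ))
    (hcusp' : ∀ γ ∈ CongruenceSubgroup.Gamma N, γ 1 0 ≠ 0 →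
      DecaysAtCusp m θ (-(γ 1 1 : ℝ) / (γ 1 0 : ℝ))) (C : ℂ) :
    IsQuantumModularForm κ (fun _ => 1) (CongruenceSubgroup.Gamma N) Q
      (fun x => C * eichler κ θ x x) := by
  refine ⟨hQ, fun γ hγ => ?_⟩
  obtain ⟨ha, hb, hc, hd⟩ := mem_Gamma_congr hγ
  have hdet := SL2Z_det γ
  have hN4 : (4 : ℤ) ∣ N := by exact_mod_cast hN
  have hd4 : γ 1 1 % 4 = 1 := (hd.of_dvd hN4)
  have heps : epsFactor (γ 1 1) = 1 := by rw [epsFactor, if_pos hd4]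
  have hlaw' := hlaw γ hγ
  by_cases hc0 : γ 1 0 = 0
  · refine ⟨fun _ => 0, contDiff_const, fun _ _ => analyticAt_const, fun x hx _ => ?_⟩
    rw [hc0, mul_zero, sub_zero] at hdet
    have hd1 : γ 1 1 = 1 := by
      rcases Int.eq_one_or_neg_one_of_mul_eq_one' hdet with h | h
      · exact h.2
      · rw [h.2] at hd4; norm_num at hd4
    have ha1 : γ 0 0 = 1 := by rw [hd1, mul_one] at hdet; exact hdet
    have hsym : thetaSymbol 0 1 = 1 := by simp [thetaSymbol]
    rw [hc0, hd1, ha1, hsym] at hlaw'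
    have hm : moebius γ x = x + γ 0 1 := by simp [moebius, hc0, hd1, ha1]
    have hL : lowerSqrt 0 1 = 1 := by simp [lowerSqrt]
    have hsl : slash κ (fun x => C * eichler κ θ x x) γ x = C * eichler κ θ x x := by
      rw [slash, if_neg (Nat.not_even_iff_odd.mpr hodd), heps, hc0, hd1, hsym, hm]
      simp only [Int.cast_zero, zero_mul, Int.cast_one, zero_add, hL, one_pow, inv_one, one_mul, mul_one]
      congr 1
      unfold eichler
      refine setIntegral_congr_fun measurableSet_Ioi fun y hy => ?_
      have h1 := hlaw' ((x : ℝ) + y * I) (by rw [add_mul_I_im]; exact hy)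
      simp only [Int.cast_one, one_mul, Int.cast_zero, zero_mul, zero_add, div_one, csqrt_one, one_pow] at h1
      simp only [sub_self]
      rw [← h1]
      push_cast
      ring_nf
    rw [hsl, map_one]
    simp
  · refine ⟨fun x => C * eichler κ θ (-(γ 1 1 : ℝ) / (γ 1 0 : ℝ)) x, ?_, ?_, ?_⟩
    · exact contDiff_const.mul (contDiff_eichler (rapidDecay_vertical hθ hinf (hcusp' γ hγ hc0))
        (continuousOn_vertical hθ _) κ)
    · intro x hx
      refine analyticAt_const.mul (analyticOnNhd_eichler (rapidDecay_vertical hθ hinf (hcusp' γ hγ hc0))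
        (continuousOn_vertical hθ _) κ x fun h => hx ?_)
      have : (γ 1 0 : ℝ) ≠ 0 := by exact_mod_cast hc0
      rw [h, mul_div_cancel₀ _ this]
      ring
    · intro x hx hx0
      have hx0' : (γ 1 0 : ℝ) * (x : ℝ) + γ 1 1 ≠ 0 := by exact_mod_cast hx0
      have hμ : (thetaSymbol (γ 1 0) (γ 1 1) : ℂ) * (thetaSymbol (γ 1 0) (γ 1 1) : ℂ) = 1 := by
        exact_mod_cast thetaSymbol_mul_self hdet
      have key := eichler_contour hdet hc0 hκ hθ hμ hlaw' hinf hx0'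
        (x' := (moebius γ x : ℚ)) (by rw [moebius]; push_cast; rfl) rfl (hcusp x hx)
        (hcusp _ (hQ γ hγ x hx hx0)) (hcusp' γ hγ hc0)
      rw [slash, if_neg (Nat.not_even_iff_odd.mpr hodd), heps, map_one]
      simp only [one_pow, one_mul]
      rw [← key]
      ring

/-! ### Theta series at rational cusps -/

theorem sum_range_periodic_shift {K : ℕ} {f : ℤ → ℂ} (hf : Function.Periodic f (K : ℤ)) (s : ℤ) :
    ∑ r ∈ Finset.range K, f (r + s) = ∑ r ∈ Finset.range K, f r := by
  have step : ∀ {f : ℤ → ℂ}, Function.Periodic f (K : ℤ) →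
      ∑ r ∈ Finset.range K, f (r + 1) = ∑ r ∈ Finset.range K, f r := by
    intro f hf
    have h1 := Finset.sum_range_succ (fun r : ℕ => f r) K
    rw [Finset.sum_range_succ'] at h1
    have h2 : f (K : ℤ) = f ((0 : ℕ) : ℤ) := by simpa using hf 0
    rw [h2] at h1
    simpa using add_right_cancel h1
  have nat : ∀ (s : ℕ) {f : ℤ → ℂ}, Function.Periodic f (K : ℤ) →
      ∑ r ∈ Finset.range K, f (r + s) = ∑ r ∈ Finset.range K, f r := by
    intro s
    induction s with
    | zero => intro f _; simp
    | succ s ih =>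
      intro f hf
      rw [← ih hf, ← step (f := fun r => f (r + s)) fun n => by
        change f (n + K + s) = f (n + s)
        rw [add_right_comm]
        exact hf _]
      refine Finset.sum_congr rfl fun r _ => ?_
      congr 1
      push_cast
      ring
  rcases Int.eq_nat_or_neg s with ⟨m, rfl | rfl⟩
  · exact nat m hf
  · have h := nat m (f := fun r => f (r + -(m : ℤ))) fun n => by
      change f (n + K + -(m : ℤ)) = f (n + -(m : ℤ))
      rw [add_right_comm]
      exact hf _
    simpa using h.symm

theorem sum_range_odd_periodic {K : ℕ} {f : ℤ → ℂ} (hf : Function.Periodic f (K : ℤ))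
    (hodd : Function.Odd f) : ∑ r ∈ Finset.range K, f r = 0 := by
  have h1 := Finset.sum_range_reflect (fun r : ℕ => f r) K
  have h2 := sum_range_periodic_shift hf 1
  have h3 : ∑ r ∈ Finset.range K, f ((K - 1 - r : ℕ) : ℤ) = -∑ r ∈ Finset.range K, f (r + 1) := by
    rw [← Finset.sum_neg_distrib]
    refine Finset.sum_congr rfl fun r hr => ?_
    have hr' := Finset.mem_range.mp hr
    rw [← hodd, ← hf (-((r : ℤ) + 1))]
    congr 1
    omega
  rw [h3, h2] at h1
  exact self_eq_neg.mp h1.symm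

/-- The additive twist `n ↦ e(n² x / 4p)`. -/
def quadTwist (p : ℕ) (x : ℂ) (n : ℤ) : ℂ := cexp (2 * Real.pi * I * ((n : ℂ) ^ 2 * x / (4 * p)))

theorem exp_two_pi_I_mul_eq {z w : ℂ} (m : ℤ) (h : z = w + m) :
    cexp (2 * Real.pi * I * z) = cexp (2 * Real.pi * I * w) := by
  rw [h, mul_add, mul_comm _ (m : ℂ), Complex.exp_add, Complex.exp_int_mul_two_pi_mul_I, mul_one]

theorem quadTwist_periodic {p : ℕ} (hp : 0 < p) (N : ℕ) (x : ℚ) :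
    Function.Periodic (quadTwist p x) ((4 * p * N * x.den : ℕ) : ℤ) := by
  intro n
  unfold quadTwist
  have hp' : (p : ℂ) ≠ 0 := by exact_mod_cast hp.ne'
  have hx : (x : ℂ) * x.den = x.num := by exact_mod_cast Rat.mul_den_eq_num x
  refine exp_two_pi_I_mul_eq (2 * n * (N * x.num) + 4 * p * N * x.den * (N * x.num)) ?_
  push_cast
  rw [← hx]
  field_simp
  ring

/-- Decay at the cusp `x` follows from decay at `0` of the translated series, whose coefficients are the
additive twists by `x`. -/
theorem decaysAtCusp_thetaSeries {p : ℕ} (hp : 0 < p) {ν : ℕ} (hν : ν ≤ 1) {N : ℕ} (hN : 0 < N)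
    {c : ℤ → ℂ} (hc : Function.Periodic c (N : ℤ)) {x : ℚ}
    (h0 : ∑ r ∈ Finset.range (4 * p * N * x.den), c r * quadTwist p x r = 0) :
    DecaysAtCusp 2 (thetaSeries p ν c) (x : ℝ) := by
  have hK : 0 < 4 * p * N * x.den := by have := x.den_pos; positivity
  have hper : Function.Periodic (fun n => c n * quadTwist p x n) ((4 * p * N * x.den : ℕ) : ℤ) := by
    refine Function.Periodic.mul ?_ (quadTwist_periodic hp N x)
    rw [show ((4 * p * N * x.den : ℕ) : ℤ) = (4 * p * x.den : ℤ) * N by push_cast; ring]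
    exact hc.int_mul _
  obtain ⟨A, δ, hA, hδ, h⟩ := thetaSeries_cusp_decay hp hν hK hper h0
  refine ⟨A, δ, hA, hδ, fun u hu => ?_⟩
  rw [thetaSeries_add_real]
  have := h u hu
  simpa [quadTwist] using this

theorem decaysAtCusp_thetaSeries_of_odd {p : ℕ} (hp : 0 < p) {ν : ℕ} (hν : ν ≤ 1) {N : ℕ} (hN : 0 < N)
    {c : ℤ → ℂ} (hc : Function.Periodic c (N : ℤ)) (hodd : Function.Odd c) (x : ℚ) :
    DecaysAtCusp 2 (thetaSeries p ν c) (x : ℝ) := by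
  refine decaysAtCusp_thetaSeries hp hν hN hc (sum_range_odd_periodic (f := fun n => c n * quadTwist p x n) ?_ fun n => ?_)
  · refine Function.Periodic.mul (f := c) ?_ (quadTwist_periodic hp N x)
    rw [show ((4 * p * N * x.den : ℕ) : ℤ) = (4 * p * x.den : ℤ) * N by push_cast; ring]
    exact hc.int_mul _
  · simp only [hodd n]
    simp [quadTwist]

/-- Translation by `4pc` multiplies the twist at the point `a/(4pjc)`, `a ≡ 1`, by the character
`n ↦ e(n/2pj)`, which is trivial only on the class of `0`. -/
theorem decaysAtCusp_thetaSeries_of_cusp {p j : ℕ} (hp : 0 < p) (hj : 0 < j) {ν : ℕ} (hν : ν ≤ 1)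
    {ψ : ℤ → ℂ} (hψ : Function.Periodic ψ ((2 * p * j : ℕ) : ℤ)) (h0 : ψ 0 = 0) {x : ℚ} {a c : ℤ}
    (hc : c ≠ 0) (ha : a ≡ 1 [ZMOD (2 * p * j : ℕ)]) (hx : x = a / (j * (4 * p * j * c))) :
    DecaysAtCusp 2 (thetaSeries p ν ψ) (x : ℝ) := by
  have hN : 0 < 2 * p * j := by positivity
  have hN' : ((2 * p * j : ℕ) : ℂ) ≠ 0 := by exact_mod_cast hN.ne'
  have hpC : (p : ℂ) ≠ 0 := by exact_mod_cast hp.ne'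
  have hjC : (j : ℂ) ≠ 0 := by exact_mod_cast hj.ne'
  have hcC : (c : ℂ) ≠ 0 := by exact_mod_cast hc
  have hxC : (x : ℂ) = a / (j * (4 * p * j * c)) := by rw [hx]; push_cast; rfl
  set e : ℤ → ℂ := fun n => cexp (2 * Real.pi * I * (n / (2 * p * j : ℕ))) with he
  have heper : Function.Periodic e ((2 * p * j : ℕ) : ℤ) := by
    intro n
    refine exp_two_pi_I_mul_eq 1 ?_
    rw [Int.cast_add, add_div, Int.cast_natCast, div_self hN', Int.cast_one]
  have hene : ∀ n : ℤ, ¬ ((2 * p * j : ℕ) : ℤ) ∣ n → 1 - e n ≠ 0 := by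
    intro n hn h
    apply hn
    have h1 : e n = 1 := by linear_combination -h
    obtain ⟨m, hm⟩ := Complex.exp_eq_one_iff.mp h1
    refine ⟨m, ?_⟩
    have h2 : (n : ℂ) / (2 * p * j : ℕ) = m := by
      refine mul_left_cancel₀ Complex.two_pi_I_ne_zero ?_
      rw [hm]; ring
    rw [div_eq_iff hN'] at h2
    have h3 : n = m * (2 * p * j : ℕ) := by exact_mod_cast h2
    rw [h3, mul_comm]
  have hψ0 : ∀ n : ℤ, ((2 * p * j : ℕ) : ℤ) ∣ n → ψ n = 0 := by
    rintro n ⟨m, rfl⟩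
    have := hψ.int_mul m 0
    rw [zero_add, h0] at this
    rw [mul_comm]
    exact this
  set ψ' : ℤ → ℂ := fun n => ψ n / (1 - e n) with hψ'
  have hψ'per : Function.Periodic ψ' ((2 * p * j : ℕ) : ℤ) := by
    intro n; simp only [hψ']; rw [hψ, heper]
  set f : ℤ → ℂ := fun n => ψ' n * quadTwist p x n with hf
  have hfper : Function.Periodic f ((4 * p * (2 * p * j) * x.den : ℕ) : ℤ) := by
    refine Function.Periodic.mul (f := ψ') ?_ (quadTwist_periodic hp _ x)
    rw [show ((4 * p * (2 * p * j) * x.den : ℕ) : ℤ) = (4 * p * x.den : ℤ) * (2 * p * j : ℕ) by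
      push_cast; ring]
    exact hψ'per.int_mul _
  have hshift : ∀ n : ℤ, f (n + 4 * p * j * c) = f n * e n := by
    intro n
    simp only [hf]
    have h1 : ψ' (n + 4 * p * j * c) = ψ' n := by
      have := hψ'per.int_mul (2 * c) n
      rw [← this]; congr 1; push_cast; ring
    have h2 : quadTwist p x (n + 4 * p * j * c) = quadTwist p x n * e n := by
      simp only [quadTwist, he]
      obtain ⟨m, hm⟩ := ha.symm.dvd
      have ha' : (a : ℂ) = 1 + (2 * p * j : ℕ) * m := by
        have : a = 1 + (2 * p * j : ℕ) * m := by linarith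
        exact_mod_cast this
      rw [← Complex.exp_add, ← mul_add]
      refine exp_two_pi_I_mul_eq (n * m + c * a) ?_
      rw [hxC]
      push_cast at ha' ⊢
      field_simp
      linear_combination (16 * n * p * j * c : ℂ) * ha'
    rw [h1, h2, mul_assoc]
  refine decaysAtCusp_thetaSeries hp hν hN hψ ?_
  have h1 := sum_range_periodic_shift hfper (4 * p * j * c)
  simp only [hshift] at h1
  rw [← sub_eq_zero, ← Finset.sum_sub_distrib] at h1
  rw [← neg_eq_zero, ← h1, ← Finset.sum_neg_distrib]
  refine Finset.sum_congr rfl fun r _ => ?_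
  simp only [hf, hψ']
  by_cases hr : ((2 * p * j : ℕ) : ℤ) ∣ (r : ℤ)
  · rw [hψ0 _ hr]; simp
  · have := hene _ hr
    field_simp
    ring

/-- The points `x` for which `jx` is equivalent to `i∞` are stable under `Γ(4pj²)`: conjugation by
`diag(j, 1)` maps this group into `Γ₁(4pj)`. -/
theorem moebius_mem_cuspInfty {p j : ℕ} (hj : 0 < j) {γ : SL2Z}
    (hγ : γ ∈ CongruenceSubgroup.Gamma (4 * p * j ^ 2)) {x : ℚ}
    (hx : (j : ℚ) * x ∈ cuspInfty (4 * p * j)) (h0 : (γ 1 0 : ℚ) * x + γ 1 1 ≠ 0) :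
    (j : ℚ) * moebius γ x ∈ cuspInfty (4 * p * j) := by
  obtain ⟨g, hg, hg0, hgx⟩ := hx
  obtain ⟨ha, -, ⟨c', hc'⟩, hd⟩ := mem_Gamma_congr hγ
  have hdvd : ((4 * p * j : ℕ) : ℤ) ∣ ((4 * p * j ^ 2 : ℕ) : ℤ) := ⟨j, by push_cast; ring⟩
  have ha' := ha.of_dvd hdvd
  have hd' := hd.of_dvd hdvd
  have hdet := SL2Z_det γ
  have hjQ : (j : ℚ) ≠ 0 := by exact_mod_cast hj.ne'
  set γ' : SL2Z := ⟨!![γ 0 0, j * γ 0 1; 4 * p * j * c', γ 1 1], by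
    rw [Matrix.det_fin_two_of]
    push_cast at hc'
    linear_combination hdet + γ 0 1 * hc'⟩ with hγ'
  have hγ'mem : γ' ∈ CongruenceSubgroup.Gamma1 (4 * p * j) := by
    rw [CongruenceSubgroup.Gamma1_mem]
    refine ⟨?_, ?_, ?_⟩
    · have := (ZMod.intCast_eq_intCast_iff _ _ _).mpr ha'
      simpa [hγ'] using this
    · have := (ZMod.intCast_eq_intCast_iff _ _ _).mpr hd'
      simpa [hγ'] using this
    · rw [ZMod.intCast_zmod_eq_zero_iff_dvd]
      exact ⟨c', by simp [hγ']⟩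
  have hg0Q : (g 1 0 : ℚ) ≠ 0 := by exact_mod_cast hg0
  have e0 : (γ' * g) 0 0 = γ 0 0 * g 0 0 + j * γ 0 1 * g 1 0 := by
    rw [Matrix.SpecialLinearGroup.coe_mul, Matrix.mul_apply, Fin.sum_univ_two]
    simp [hγ']
  have e1 : (γ' * g) 1 0 = 4 * p * j * c' * g 0 0 + γ 1 1 * g 1 0 := by
    rw [Matrix.SpecialLinearGroup.coe_mul, Matrix.mul_apply, Fin.sum_univ_two]
    simp [hγ']
  have hcq : (γ 1 0 : ℚ) = 4 * p * j ^ 2 * c' := by rw [hc']; push_cast; ring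
  have hxq : x = g 0 0 / (j * g 1 0) := by
    rw [eq_div_iff (mul_ne_zero hjQ hg0Q)]
    rw [eq_div_iff hg0Q] at hgx
    linear_combination hgx
  have hden : (γ 1 0 : ℚ) * x + γ 1 1 = ((γ' * g) 1 0 : ℚ) / g 1 0 := by
    rw [e1, hcq, hxq]; push_cast; field_simp
  refine ⟨γ' * g, mul_mem hγ'mem hg, fun h => h0 ?_, ?_⟩
  · rw [hden, h]; simp
  · rw [moebius, hden, e0, hxq]
    push_cast
    field_simp

/-! ### Radial limits -/

theorem integral_exp_mul_inv_sqrt {r : ℝ} (hr : 0 < r) :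
    ∫ y in Ioi (0 : ℝ), Real.exp (-(r * y)) * (Real.sqrt y)⁻¹ = Real.sqrt (Real.pi / r) := by
  have h := Real.integral_rpow_mul_exp_neg_mul_Ioi (a := 1 / 2) (by norm_num) hr
  rw [Real.Gamma_one_half_eq, ← Real.sqrt_eq_rpow, ← Real.sqrt_mul (by positivity)] at h
  rw [show Real.pi / r = 1 / r * Real.pi by ring, ← h]
  refine setIntegral_congr_fun measurableSet_Ioi fun y hy => ?_
  have hy0 : 0 < y := hy
  rw [mul_comm, Real.sqrt_eq_rpow, ← Real.rpow_neg hy0.le]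
  norm_num

theorem integrableOn_exp_mul_inv_sqrt {r : ℝ} (hr : 0 < r) :
    IntegrableOn (fun y : ℝ => Real.exp (-(r * y)) * (Real.sqrt y)⁻¹) (Ioi 0) := by
  by_contra h
  have h1 := integral_exp_mul_inv_sqrt hr
  rw [integral_undef h] at h1
  have : 0 < Real.sqrt (Real.pi / r) := Real.sqrt_pos.mpr (div_pos Real.pi_pos hr)
  linarith

/-- A partial theta series as an integral of a full theta series, by
`∫ exp(-π n² y / 2p) dy / √y = √(2p) / |n|`. The parity condition makes the terms of `n` and `-n` in
the full series equal; the term of `0` is lost in the integral, so that it has to vanish on the left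
as well. -/
theorem qSeries_eq_integral {p : ℕ} (hp : 0 < p) (ν : ℕ) {c : ℤ → ℂ} {B : ℝ} (hc : ∀ n, ‖c n‖ ≤ B)
    (heven : ∀ n : ℤ, c (-n) * ((-n : ℤ) : ℂ) ^ (ν + 1) = c n * (n : ℂ) ^ (ν + 1))
    (hc0 : ν = 0 → c 0 = 0)
    {τ : ℂ} (hτ : 0 < τ.im) :
    qSeries p (fun n => (n : ℂ) ^ ν * c n) τ = ((2 * Real.sqrt (2 * p) : ℝ) : ℂ)⁻¹ *
      ∫ y in Ioi (0 : ℝ), thetaSeries p (ν + 1) c (τ + y * I) * ((Real.sqrt y)⁻¹ : ℝ) := by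
  have hB : 0 ≤ B := (norm_nonneg _).trans (hc 0)
  have hπ := Real.pi_pos
  have hpR : (0 : ℝ) < p := by exact_mod_cast hp
  have hpC : (p : ℂ) ≠ 0 := by exact_mod_cast hp.ne'
  set E : ℤ → ℂ := fun n => cexp (2 * Real.pi * I * ((n : ℂ) ^ 2 * τ / (4 * p))) with hE
  set R : ℤ → ℝ := fun n => Real.pi / (2 * p) * (n : ℝ) ^ 2 with hR
  have hR0 : ∀ n : ℤ, n ≠ 0 → 0 < R n := by
    intro n hn
    have : (0 : ℝ) < (n : ℝ) ^ 2 := by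
      have : (n : ℝ) ≠ 0 := by exact_mod_cast hn
      positivity
    simp only [hR]; positivity
  set F : ℤ → ℝ → ℂ := fun n y => c n * ((n : ℂ) ^ (ν + 1) *
    cexp (2 * Real.pi * I * ((n : ℂ) ^ 2 * (τ + y * I) / (4 * p)))) * ((Real.sqrt y)⁻¹ : ℝ) with hF
  have hFeq : ∀ (n : ℤ) (y : ℝ), F n y = c n * (n : ℂ) ^ (ν + 1) * E n *
      ((Real.exp (-(R n * y)) * (Real.sqrt y)⁻¹ : ℝ) : ℂ) := by
    intro n y
    simp only [hF, hE, hR]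
    rw [show 2 * Real.pi * I * ((n : ℂ) ^ 2 * (τ + y * I) / (4 * p)) =
      2 * Real.pi * I * ((n : ℂ) ^ 2 * τ / (4 * p)) + ((-(Real.pi / (2 * p) * (n : ℝ) ^ 2 * y) : ℝ) : ℂ) by
        push_cast
        field_simp
        linear_combination (4 * n ^ 2 * y : ℂ) * Complex.I_sq, Complex.exp_add, ← Complex.ofReal_exp]
    push_cast
    ring
  have hF0 : ∀ y, F 0 y = 0 := by intro y; simp [hF]
  have hsq : ∀ n : ℤ, n ≠ 0 → Real.sqrt (Real.pi / R n) = Real.sqrt (2 * p) / |(n : ℝ)| := by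
    intro n hn
    have hnR : (n : ℝ) ≠ 0 := by exact_mod_cast hn
    rw [← Real.sqrt_sq_eq_abs, ← Real.sqrt_div (by positivity)]
    congr 1
    simp only [hR]
    field_simp
  have hFint : ∀ n, IntegrableOn (F n) (Ioi 0) := by
    intro n
    by_cases hn : n = 0
    · subst hn
      simp only [funext hF0]
      exact integrableOn_zero
    · simp only [funext (hFeq n)]
      exact ((integrableOn_exp_mul_inv_sqrt (hR0 n hn)).ofReal).const_mul _
  have hFval : ∀ n, n ≠ 0 → ∫ y in Ioi (0 : ℝ), F n y =
      c n * (n : ℂ) ^ (ν + 1) * E n * ((Real.sqrt (2 * p) / |(n : ℝ)| : ℝ) : ℂ) := by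
    intro n hn
    simp only [hFeq n]
    rw [MeasureTheory.integral_const_mul, integral_complex_ofReal, integral_exp_mul_inv_sqrt (hR0 n hn), hsq n hn]
  have hEn : ∀ n : ℤ, ‖E n‖ = Real.exp (-(Real.pi / (2 * p) * τ.im) * (n : ℝ) ^ 2) := by
    intro n
    have h1 := norm_thetaTerm p 0 (fun _ => 1) τ n
    simpa [hE] using h1
  have hFnorm : ∀ n, ∫ y in Ioi (0 : ℝ), ‖F n y‖ ≤ B * Real.sqrt (2 * p) *
      (|(n : ℝ)| ^ ν * Real.exp (-(Real.pi / (2 * p) * τ.im) * (n : ℝ) ^ 2)) := by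
    intro n
    by_cases hn : n = 0
    · subst hn
      simp only [hF0, norm_zero, integral_zero]
      positivity
    · have hnR : 0 < |(n : ℝ)| := abs_pos.mpr (by exact_mod_cast hn)
      have h1 : ∀ y, ‖F n y‖ = ‖c n‖ * |(n : ℝ)| ^ (ν + 1) * ‖E n‖ *
          (Real.exp (-(R n * y)) * (Real.sqrt y)⁻¹) := by
        intro y
        rw [hFeq, norm_mul, norm_mul, norm_mul, norm_pow, Complex.norm_intCast, Complex.norm_real,
          Real.norm_eq_abs, abs_of_nonneg (mul_nonneg (Real.exp_pos _).le (inv_nonneg.mpr (Real.sqrt_nonneg _)))]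
      simp only [h1]
      rw [MeasureTheory.integral_const_mul, integral_exp_mul_inv_sqrt (hR0 n hn), hsq n hn, hEn]
      calc _ = ‖c n‖ * Real.sqrt (2 * p) * (|(n : ℝ)| ^ ν *
            Real.exp (-(Real.pi / (2 * p) * τ.im) * (n : ℝ) ^ 2)) := by
            rw [pow_succ]; field_simp
        _ ≤ _ := by gcongr; exact hc n
  have ha : 0 < Real.pi / (2 * p) * τ.im := by positivity
  have hsum : Summable fun n => ∫ y in Ioi (0 : ℝ), ‖F n y‖ :=
    Summable.of_nonneg_of_le (fun n => integral_nonneg fun y => norm_nonneg _) hFnorm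
      ((summable_pow_mul_exp_neg_sq ha ν).mul_left _)
  have key := hasSum_integral_of_summable_integral_norm hFint hsum
  have hθ : ∫ y in Ioi (0 : ℝ), ∑' n, F n y =
      ∫ y in Ioi (0 : ℝ), thetaSeries p (ν + 1) c (τ + y * I) * ((Real.sqrt y)⁻¹ : ℝ) := by
    congr 1
    funext y
    simp only [hF]
    rw [tsum_mul_right]
    rfl
  rw [hθ] at key
  have h2 := key.nat_add_neg
  have h0 : ∫ y in Ioi (0 : ℝ), F 0 y = 0 := by simp [hF0]
  rw [h0, add_zero] at h2
  have h3 := h2.mul_left ((2 * Real.sqrt (2 * p) : ℝ) : ℂ)⁻¹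
  rw [← h3.tsum_eq]
  unfold qSeries
  refine tsum_congr fun n => ?_
  by_cases hn : n = 0
  · subst hn
    have h4 : ((0 : ℕ) : ℂ) ^ ν * c ((0 : ℕ) : ℤ) = 0 := by
      rcases Nat.eq_zero_or_pos ν with h | h
      · rw [Nat.cast_zero, Nat.cast_zero, hc0 h, mul_zero]
      · rw [Nat.cast_zero, zero_pow h.ne', zero_mul]
    beta_reduce
    rw [h4, zero_mul]
    simp [h0]
  · have hn' : (n : ℤ) ≠ 0 := by exact_mod_cast hn
    have hnC : (n : ℂ) ≠ 0 := by exact_mod_cast hn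
    rw [hFval n hn', hFval (-n) (neg_ne_zero.mpr hn')]
    rw [heven n]
    have e1 : E (-n) = E n := by simp [hE]
    have e2 : |((-(n : ℤ) : ℤ) : ℝ)| = n := by simp
    have e3 : |((n : ℤ) : ℝ)| = n := by simp
    have e4 : qpow ((n : ℚ) ^ 2 / (4 * p)) τ = E n := by
      simp only [qpow, hE]
      push_cast
      congr 1
      ring
    have e5 : ((Real.sqrt (2 * p) : ℝ) : ℂ) ≠ 0 := by
      have : 0 < Real.sqrt (2 * p) := by positivity
      exact_mod_cast this.ne'
    rw [e1, e2, e3, e4]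
    push_cast
    rw [pow_succ]
    field_simp
    ring

theorem RapidDecay.integrableOn_sqrt {g : ℝ → ℂ} (hg : RapidDecay g) (hc : ContinuousOn g (Ioi 0))
    (k : ℕ) : IntegrableOn (fun y : ℝ => g y * (((Real.sqrt y) ^ k)⁻¹ : ℝ)) (Ioi 0) := by
  obtain ⟨A, δ, hA, hδ, h⟩ := hg.exists_bound k
  have hk : ContinuousOn (fun y : ℝ => ((((Real.sqrt y) ^ k)⁻¹ : ℝ) : ℂ)) (Ioi 0) := by
    refine Complex.continuous_ofReal.comp_continuousOn (ContinuousOn.inv₀ (by fun_prop) fun y hy => ?_)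
    exact pow_ne_zero _ (Real.sqrt_pos.mpr hy).ne'
  refine Integrable.mono' (integrableOn_exp_neg hδ A)
    ((hc.mul hk).aestronglyMeasurable measurableSet_Ioi) ?_
  filter_upwards [ae_restrict_mem measurableSet_Ioi] with y hy
  rw [norm_mul, Complex.norm_real, Real.norm_eq_abs, abs_of_nonneg (by positivity)]
  exact h y hy

theorem RapidDecay.tendsto_integral {g : ℝ → ℂ} (hg : RapidDecay g) (hc : ContinuousOn g (Ioi 0)) :
    Tendsto (fun s : ℝ => ∫ y in Ioi (0 : ℝ), g (s + y) * ((Real.sqrt y)⁻¹ : ℝ)) (𝓝[>] 0)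
      (𝓝 (∫ y in Ioi (0 : ℝ), g y * ((Real.sqrt y)⁻¹ : ℝ))) := by
  obtain ⟨A, δ, hA, hδ, h⟩ := hg 0
  have hk : ContinuousOn (fun y : ℝ => (((Real.sqrt y)⁻¹ : ℝ) : ℂ)) (Ioi 0) := by
    refine Complex.continuous_ofReal.comp_continuousOn (ContinuousOn.inv₀ (by fun_prop) fun y hy => ?_)
    exact (Real.sqrt_pos.mpr hy).ne'
  refine tendsto_integral_filter_of_dominated_convergence
    (fun y => A * (Real.exp (-(δ * y)) * (Real.sqrt y)⁻¹)) ?_ ?_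
    ((integrableOn_exp_mul_inv_sqrt hδ).const_mul A) ?_
  · filter_upwards [self_mem_nhdsWithin] with s hs
    have hs0 : 0 < s := hs
    refine (ContinuousOn.mul (hc.comp (by fun_prop) fun y hy => ?_) hk).aestronglyMeasurable measurableSet_Ioi
    have hy0 : 0 < y := hy
    exact add_pos hs0 hy0
  · filter_upwards [self_mem_nhdsWithin] with s hs
    filter_upwards [ae_restrict_mem measurableSet_Ioi] with y hy
    have hs0 : 0 < s := hs
    have hy0 : 0 < y := hy
    rw [norm_mul, Complex.norm_real, Real.norm_eq_abs, abs_of_nonneg (by positivity), ← mul_assoc]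
    have h1 := h (s + y) (by positivity)
    rw [pow_zero, mul_one] at h1
    have h2 : Real.exp (-δ * (s + y)) ≤ Real.exp (-(δ * y)) := by
      apply Real.exp_le_exp.mpr; nlinarith
    have h3 := h1.trans (mul_le_mul_of_nonneg_left h2 hA)
    gcongr
  · filter_upwards [ae_restrict_mem measurableSet_Ioi] with y hy
    have h1 : ContinuousAt g y := hc.continuousAt (Ioi_mem_nhds hy)
    refine Tendsto.mul_const _ ?_
    have h2 : Tendsto (fun s : ℝ => s + y) (𝓝[>] 0) (𝓝 y) := by
      have : Continuous fun s : ℝ => s + y := by fun_prop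
      simpa using (this.tendsto 0).mono_left nhdsWithin_le_nhds
    exact h1.tendsto.comp h2

/-- Integration by parts; the boundary terms vanish by the rapid decay. -/
theorem RapidDecay.integral_deriv {g g' : ℝ → ℂ} (hg : RapidDecay g) (hg' : RapidDecay g')
    (hd : ∀ y, 0 < y → HasDerivAt g (g' y) y) (hc' : ContinuousOn g' (Ioi 0)) :
    ∫ y in Ioi (0 : ℝ), g' y * ((Real.sqrt y)⁻¹ : ℝ) =
      1 / 2 * ∫ y in Ioi (0 : ℝ), g y * (((Real.sqrt y) ^ 3)⁻¹ : ℝ) := by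
  have hc : ContinuousOn g (Ioi 0) := fun y hy => (hd y hy).continuousAt.continuousWithinAt
  have i1 : IntegrableOn (fun y : ℝ => g' y * ((Real.sqrt y)⁻¹ : ℝ)) (Ioi 0) := by
    simpa using hg'.integrableOn_sqrt hc' 1
  have i2 := (hg.integrableOn_sqrt hc 3).const_mul (1 / 2)
  set f : ℝ → ℂ := fun y => g y * ((Real.sqrt y)⁻¹ : ℝ) with hf
  have hfd : ∀ y, 0 < y → HasDerivAt f
      (g' y * ((Real.sqrt y)⁻¹ : ℝ) - 1 / 2 * (g y * (((Real.sqrt y) ^ 3)⁻¹ : ℝ))) y := by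
    intro y hy
    have hs : Real.sqrt y ≠ 0 := (Real.sqrt_pos.mpr hy).ne'
    have h1 := ((Real.hasDerivAt_sqrt hy.ne').inv hs).ofReal_comp
    refine ((hd y hy).mul h1).congr_deriv ?_
    have hsC : ((Real.sqrt y : ℝ) : ℂ) ≠ 0 := by exact_mod_cast hs
    simp only [Pi.inv_apply]
    push_cast
    field_simp
    ring
  obtain ⟨A, δ, hA, hδ, hb⟩ := hg 3
  have hfb : ∀ y, 0 < y → ‖f y‖ ≤ A * y * Real.exp (-δ * y) := by
    intro y hy
    have hs : 0 < Real.sqrt y := Real.sqrt_pos.mpr hy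
    simp only [hf]
    rw [norm_mul, Complex.norm_real, Real.norm_eq_abs, abs_of_nonneg (by positivity)]
    calc _ ≤ (A * Real.sqrt y ^ 3 * Real.exp (-δ * y)) * (Real.sqrt y)⁻¹ := by
          gcongr; exact hb y hy
      _ = A * (Real.sqrt y ^ 2) * Real.exp (-δ * y) := by field_simp
      _ = _ := by rw [Real.sq_sqrt hy.le]
  have t0 : Tendsto (fun T : ℝ => f T⁻¹) atTop (𝓝 0) := by
    refine squeeze_zero_norm' ?_ (a := fun T : ℝ => A * T⁻¹ * Real.exp (-δ * T⁻¹)) ?_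
    · filter_upwards [eventually_gt_atTop 0] with T hT
      exact hfb _ (by positivity)
    · have : Continuous fun y : ℝ => A * y * Real.exp (-δ * y) := by fun_prop
      have h2 := (this.tendsto 0).comp tendsto_inv_atTop_zero
      simpa [Function.comp_def] using h2
  have t1 : Tendsto (fun T : ℝ => f T) atTop (𝓝 0) := by
    refine squeeze_zero_norm' ?_ (tendsto_pow_mul_exp_neg A δ 0 1 one_pos hδ 1)
    filter_upwards [eventually_gt_atTop 0] with T hT
    simpa using hfb T hT
  have key := tendsto_sub_of_hasDerivAt_Ioi hfd (i1.sub i2) tendsto_inv_atTop_zero tendsto_id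
    (by filter_upwards [eventually_gt_atTop 0] with T hT; positivity)
  have h0 := tendsto_nhds_unique (t1.sub t0) key
  rw [integral_sub i1 i2, MeasureTheory.integral_const_mul, sub_zero] at h0
  linear_combination -h0

/-! ### Quantum modularity of partial theta series -/

theorem RapidDecay.const_mul {g : ℝ → ℂ} (hg : RapidDecay g) (C : ℂ) : RapidDecay fun y => C * g y := by
  intro M
  obtain ⟨A, δ, hA, hδ, h⟩ := hg M
  refine ⟨‖C‖ * A, δ, by positivity, hδ, fun y hy => ?_⟩
  rw [norm_mul, mul_assoc, mul_assoc, ← mul_assoc A]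
  exact mul_le_mul_of_nonneg_left (h y hy) (norm_nonneg _)

/-- Cauchy's estimate on the disc of radius `y / 2` around `r + iy`. -/
theorem rapidDecay_deriv_vertical {θ : ℂ → ℂ} {m : ℕ} {r : ℝ} (hθ : DifferentiableOn ℂ θ {z | 0 < z.im})
    (h1 : DecaysAtInfty θ) (h2 : DecaysAtCusp m θ r) : RapidDecay fun y => deriv θ (r + y * I) := by
  obtain ⟨A1, δ1, hA1, hδ1, hb1⟩ := h1
  obtain ⟨A2, δ2, hA2, hδ2, hb2⟩ := h2
  have hopen : IsOpen {z : ℂ | 0 < z.im} := isOpen_lt continuous_const Complex.continuous_im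
  have him : ∀ y : ℝ, 0 < y → ∀ z ∈ Metric.closedBall ((r : ℂ) + y * I) (y / 2),
      y / 2 ≤ z.im ∧ ‖z - r‖ ≤ 3 * y / 2 := by
    intro y hy z hz
    rw [mem_closedBall_iff_norm] at hz
    have e1 := Complex.abs_im_le_norm (z - (r + y * I))
    rw [Complex.sub_im, add_mul_I_im] at e1
    have e2 := abs_le.mp (e1.trans hz)
    refine ⟨by linarith [e2.1], ?_⟩
    calc ‖z - r‖ = ‖(z - (r + y * I)) + y * I‖ := by ring_nf
      _ ≤ ‖z - (r + y * I)‖ + ‖(y : ℂ) * I‖ := norm_add_le _ _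
      _ ≤ y / 2 + y := by
        gcongr
        rw [norm_mul, Complex.norm_I, mul_one, Complex.norm_real, Real.norm_eq_abs, abs_of_pos hy]
      _ = _ := by ring
  have cauchy : ∀ y C : ℝ, 0 < y → (∀ z ∈ Metric.closedBall ((r : ℂ) + y * I) (y / 2), ‖θ z‖ ≤ C) →
      ‖deriv θ (r + y * I)‖ ≤ C / (y / 2) := by
    intro y C hy hC
    refine Complex.norm_deriv_le_of_forall_mem_sphere_norm_le (by positivity) ?_
      fun z hz => hC z (Metric.sphere_subset_closedBall hz)
    refine DifferentiableOn.diffContOnCl ?_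
    rw [closure_ball _ (by positivity)]
    refine hθ.mono fun z hz => ?_
    have := (him y hy z hz).1
    exact lt_of_lt_of_le (by positivity) this
  refine rapidDecay_of_bounds (m := m + 1) (y₀ := 2 / 9) (y₁ := 2) (A₁ := A1) (δ₁ := δ1 / 2)
    (A₂ := A2 * 2 ^ (m + 1)) (δ₂ := δ2 * (2 / 9))
    (continuousOn_vertical (hθ.deriv hopen) r) (by norm_num) (by norm_num) (by norm_num) hA1
    (by positivity) (by positivity) (by positivity) (fun y hy => ?_) fun y hy hy1 => ?_
  · have hy0 : 0 < y := by linarith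
    have h3 := cauchy y (A1 * Real.exp (-(δ1 / 2) * y)) hy0 fun z hz => by
      have h4 := (him y hy0 z hz).1
      refine (hb1 z (by linarith)).trans ?_
      have h5 : -δ1 * z.im ≤ -(δ1 / 2) * y := by nlinarith
      gcongr
    refine h3.trans (div_le_self (by positivity) (by linarith))
  · have h3 := cauchy y (A2 * (2 * y⁻¹) ^ m * Real.exp (-(δ2 * (2 / 9)) * y⁻¹)) hy fun z hz => by
      obtain ⟨h4, h5⟩ := him y hy z hz
      set w := z - r with hw
      have hwim : w.im = z.im := by simp [hw]
      have hw0 : w ≠ 0 := by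
        intro h
        rw [h, Complex.zero_im] at hwim
        linarith
      have hwn : 0 < ‖w‖ := norm_pos_iff.mpr hw0
      have h6 : y / 2 ≤ ‖w‖ := h4.trans (hwim ▸ (le_abs_self _).trans (Complex.abs_im_le_norm w))
      have h7 : (-1 / w).im = z.im / ‖w‖ ^ 2 := by
        rw [← hwim, Complex.div_im, Complex.normSq_eq_norm_sq]
        simp
        ring
      have h8 : 2 / 9 * y⁻¹ ≤ (-1 / w).im := by
        rw [h7, le_div_iff₀ (by positivity)]
        calc 2 / 9 * y⁻¹ * ‖w‖ ^ 2 ≤ 2 / 9 * y⁻¹ * (3 * y / 2) ^ 2 := by gcongr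
          _ = y / 2 := by field_simp; norm_num
          _ ≤ _ := h4
      have h9 : (1 : ℝ) ≤ 2 / 9 * y⁻¹ := by
        rw [← div_eq_mul_inv, one_le_div hy]; exact hy1
      have h10 := hb2 (-1 / w) (h9.trans h8)
      have h11 : (r : ℂ) + -1 / (-1 / w) = z := by
        rw [hw]
        field_simp
        ring
      have h12 : ‖-1 / w‖ ≤ 2 * y⁻¹ := by
        rw [norm_div, norm_neg, norm_one, one_div, ← div_eq_mul_inv, ← inv_div]
        gcongr
      rw [h11] at h10
      refine h10.trans ?_
      have h13 : -δ2 * (-1 / w).im ≤ -(δ2 * (2 / 9)) * y⁻¹ := by nlinarith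
      gcongr
    refine h3.trans (le_of_eq ?_)
    rw [mul_pow, pow_succ, pow_succ]
    field_simp

/-- Differentiation in the variable of the upper half-plane raises the power `ν` by two. -/
theorem deriv_thetaSeries {p : ℕ} (hp : 0 < p) {c : ℤ → ℂ} {B : ℝ} (hc : ∀ n, ‖c n‖ ≤ B) {z : ℂ}
    (hz : 0 < z.im) :
    deriv (thetaSeries p 0 c) z = 2 * Real.pi * I / (4 * p) * thetaSeries p 2 c z := by
  have hB : 0 ≤ B := (norm_nonneg _).trans (hc 0)
  have ha : 0 < Real.pi / (2 * p) * (z.im / 2) := by have := Real.pi_pos; positivity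
  have hopen : IsOpen {w : ℂ | z.im / 2 < w.im} := isOpen_lt continuous_const Complex.continuous_im
  have h1 := hasSum_deriv_of_summable_norm (z := z)
    (F := fun (n : ℤ) (z : ℂ) => c n * ((n : ℂ) ^ 0 * cexp (2 * Real.pi * I * ((n : ℂ) ^ 2 * z / (4 * p)))))
    ((summable_pow_mul_exp_neg_sq ha 0).mul_left B) (fun n => by fun_prop) hopen (fun n w hw => by
      have hw' : z.im / 2 < w.im := hw
      rw [norm_thetaTerm]
      gcongr
      exact hc n) (show z.im / 2 < z.im by linarith)
  have h2 := (hasSum_thetaSeries hp 2 hc hz).mul_left (2 * Real.pi * I / (4 * p) : ℂ)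
  refine h1.unique (h2.congr_fun fun n => ?_)
  have h3 : HasDerivAt (fun z : ℂ => cexp (2 * Real.pi * I * ((n : ℂ) ^ 2 * z / (4 * p))))
      (cexp (2 * Real.pi * I * ((n : ℂ) ^ 2 * z / (4 * p))) * (2 * Real.pi * I * ((n : ℂ) ^ 2 * 1 / (4 * p)))) z :=
    ((((hasDerivAt_id z).const_mul ((n : ℂ) ^ 2)).div_const (4 * p : ℂ)).const_mul (2 * Real.pi * I)).cexp
  rw [((h3.const_mul ((n : ℂ) ^ 0)).const_mul (c n)).deriv]
  ring

theorem eichler_self (κ : ℕ) (θ : ℂ → ℂ) (x : ℝ) :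
    eichler κ θ x x =
      (csqrt I ^ κ)⁻¹ * ∫ y in Ioi (0 : ℝ), θ (x + y * I) * (((Real.sqrt y) ^ κ)⁻¹ : ℝ) := by
  rw [← MeasureTheory.integral_const_mul, eichler]
  refine setIntegral_congr_fun measurableSet_Ioi fun y hy => ?_
  have hy0 : 0 < y := hy
  have hs : 0 < Real.sqrt y := Real.sqrt_pos.mpr hy0
  have h1 : csqrt (((x - x : ℝ) : ℂ) + y * I) = csqrt I * (Real.sqrt y : ℝ) := by
    have him : 0 < (((x - x : ℝ) : ℂ) + y * I).im := by rw [add_mul_I_im]; exact hy0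
    have hsq : csqrt (((x - x : ℝ) : ℂ) + y * I) ^ 2 = (csqrt I * (Real.sqrt y : ℝ)) ^ 2 := by
      rw [csqrt_sq, mul_pow, csqrt_sq, ← Complex.ofReal_pow, Real.sq_sqrt hy0.le]
      simp
      ring
    rcases sq_eq_sq_iff_eq_or_eq_neg.mp hsq with h | h
    · exact h
    · exfalso
      have e1 := csqrt_re_pos him.ne'
      have e2 := csqrt_re_pos (z := I) (by simp)
      rw [h, Complex.neg_re, mul_comm, Complex.re_ofReal_mul] at e1
      have := mul_pos hs e2
      linarith
  rw [h1, mul_pow, mul_inv]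
  push_cast
  ring

theorem Gamma_thetaSeries_congr {p j : ℕ} {γ : SL2Z}
    (hγ : γ ∈ CongruenceSubgroup.Gamma (4 * p * j ^ 2)) :
    γ 0 0 ≡ 1 [ZMOD 4 * (p * j ^ 2 : ℕ)] ∧ 4 * ((p * j ^ 2 : ℕ) : ℤ) ∣ γ 0 1 ∧
      4 * ((p * j ^ 2 : ℕ) : ℤ) ∣ γ 1 0 ∧ γ 1 1 ≡ 1 [ZMOD 4 * (p * j ^ 2 : ℕ)] := by
  have h := mem_Gamma_congr hγ
  rwa [show ((4 * p * j ^ 2 : ℕ) : ℤ) = 4 * ((p * j ^ 2 : ℕ) : ℤ) by push_cast; ring] at h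

/-- The partial theta series of an odd periodic sequence. The full theta series with coefficients
`n χ(n)` has weight `3/2` and decays at every cusp, because the twists of an odd sequence have mean
value zero. -/
theorem hasQuantumModularLimits_of_odd {p j : ℕ} (hp : 0 < p) (hj : 0 < j) {χ : ℤ → ℂ}
    (hper : Function.Periodic χ ((2 * p * j : ℕ) : ℤ)) (hodd : Function.Odd χ) :
    HasQuantumModularLimits 1 (fun _ => 1) (CongruenceSubgroup.Gamma (4 * p * j ^ 2)) Set.univ
      (qSeries p fun n => χ n) := by
  have hN : 0 < 2 * p * j := by positivity
  obtain ⟨B, hB, hc⟩ := exists_norm_le_of_periodic hN hper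
  have hχ0 : χ 0 = 0 := by
    have := hodd 0
    rw [neg_zero] at this
    exact self_eq_neg.mp this
  set θ := thetaSeries p 1 χ with hθd
  have hθ : DifferentiableOn ℂ θ {z | 0 < z.im} := differentiableOn_thetaSeries hp 1 hc
  have hinf : DecaysAtInfty θ := thetaSeries_decay hp 1 hc (by simp)
  have hcusp : ∀ x : ℚ, DecaysAtCusp 2 θ (x : ℝ) := fun x =>
    decaysAtCusp_thetaSeries_of_odd hp le_rfl hN hper hodd x
  refine ⟨fun x => ((2 * Real.sqrt (2 * p) : ℝ) : ℂ)⁻¹ * csqrt I * eichler 1 θ x x, fun x _ => ?_, ?_⟩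
  · have h1 := (rapidDecay_vertical hθ hinf (hcusp x)).tendsto_integral (continuousOn_vertical hθ x)
    have h2 := h1.const_mul ((2 * Real.sqrt (2 * p) : ℝ) : ℂ)⁻¹
    beta_reduce
    rw [eichler_self]
    have h3 : csqrt I ≠ 0 := csqrt_ne_zero Complex.I_ne_zero
    have e : ((2 * Real.sqrt (2 * p) : ℝ) : ℂ)⁻¹ * csqrt I * ((csqrt I ^ 1)⁻¹ *
        ∫ y in Ioi (0 : ℝ), θ ((x : ℝ) + y * I) * (((Real.sqrt y) ^ 1)⁻¹ : ℝ)) =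
        ((2 * Real.sqrt (2 * p) : ℝ) : ℂ)⁻¹ *
          ∫ y in Ioi (0 : ℝ), θ ((x : ℝ) + y * I) * ((Real.sqrt y)⁻¹ : ℝ) := by
      simp only [pow_one]
      rw [mul_assoc, mul_inv_cancel_left₀ h3]
    rw [e]
    refine h2.congr' ?_
    filter_upwards [self_mem_nhdsWithin] with s hs
    have h4 := qSeries_eq_integral hp 0 hc (fun n => by rw [hodd]; push_cast; ring) (fun _ => hχ0)
      (τ := (x : ℂ) + s * I) (by simpa using hs)
    simp only [pow_zero, one_mul, zero_add] at h4
    rw [h4]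
    congr 2
    funext y
    congr 2
    push_cast
    ring
  · refine isQuantumModularForm_eichler (m := 2) (by norm_num) odd_one ⟨p * j ^ 2, by ring⟩ hθ hinf ?_
      (fun _ _ _ _ _ => mem_univ _) (fun x _ => hcusp x) (fun γ _ _ => ?_) _
    · intro γ hγ z hz
      obtain ⟨ha, hb, hc, hd⟩ := Gamma_thetaSeries_congr hγ
      exact thetaSeries_one_moebius hp hj hper (SL2Z_det γ) ha hd hb hc hz
    · have := hcusp (-(γ 1 1 : ℚ) / (γ 1 0 : ℚ))
      push_cast at this
      exact this

/-- The partial theta series with coefficients `n ψ(n)`, for an even periodic sequence `ψ`. It is an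
integral of the derivative of the full theta series of weight `1/2` with coefficients `ψ(n)`;
integration by parts turns this into the Eichler integral of weight `3/2`. -/
theorem hasQuantumModularLimits_of_even {p j : ℕ} (hp : 0 < p) (hj : 0 < j) {ψ : ℤ → ℂ}
    (hper : Function.Periodic ψ ((2 * p * j : ℕ) : ℤ)) (heven : Function.Even ψ) (h0 : ψ 0 = 0) :
    HasQuantumModularLimits 3 (fun _ => 1) (CongruenceSubgroup.Gamma (4 * p * j ^ 2))
      {x : ℚ | (j : ℚ) * x ∈ cuspInfty (4 * p * j)} (qSeries p fun n => n * ψ n) := by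
  have hN : 0 < 2 * p * j := by positivity
  have hπ := Real.pi_pos
  have hpC : (p : ℂ) ≠ 0 := by exact_mod_cast hp.ne'
  obtain ⟨B, hB, hc⟩ := exists_norm_le_of_periodic hN hper
  set θ := thetaSeries p 0 ψ with hθd
  have hopen : IsOpen {z : ℂ | 0 < z.im} := isOpen_lt continuous_const Complex.continuous_im
  have hθ : DifferentiableOn ℂ θ {z | 0 < z.im} := differentiableOn_thetaSeries hp 0 hc
  have hinf : DecaysAtInfty θ := thetaSeries_decay hp 0 hc (fun _ => h0)
  have hcusp : ∀ x : ℚ, (j : ℚ) * x ∈ cuspInfty (4 * p * j) → DecaysAtCusp 2 θ (x : ℝ) := by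
    rintro x ⟨g, hg, hg0, hgx⟩
    rw [CongruenceSubgroup.Gamma1_mem] at hg
    obtain ⟨c', hc'⟩ := (ZMod.intCast_zmod_eq_zero_iff_dvd _ _).mp hg.2.2
    have hc0 : c' ≠ 0 := by rintro rfl; rw [mul_zero] at hc'; exact hg0 hc'
    have ha : g 0 0 ≡ 1 [ZMOD (4 * p * j : ℕ)] := by
      rw [← ZMod.intCast_eq_intCast_iff]; simpa using hg.1
    refine decaysAtCusp_thetaSeries_of_cusp hp hj zero_le_one hper h0 hc0
      (ha.of_dvd ⟨2, by push_cast; ring⟩) ?_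
    have hjQ : (j : ℚ) ≠ 0 := by exact_mod_cast hj.ne'
    rw [← div_div, div_right_comm, eq_div_iff hjQ, mul_comm, hgx, hc']
    push_cast
    rfl
  set D : ℂ := 2 * Real.pi * I / (4 * p) with hD
  have hD0 : D ≠ 0 := by
    have : (Real.pi : ℂ) ≠ 0 := by exact_mod_cast hπ.ne'
    simp [hD, this, hpC]
  have hθ2 : ∀ z : ℂ, 0 < z.im → thetaSeries p 2 ψ z = D⁻¹ * deriv θ z := by
    intro z hz
    rw [deriv_thetaSeries hp hc hz, ← hD, inv_mul_cancel_left₀ hD0]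
  refine ⟨fun x => ((2 * Real.sqrt (2 * p) : ℝ) : ℂ)⁻¹ * ((D * I)⁻¹ * (1 / 2 * csqrt I ^ 3)) *
    eichler 3 θ x x, fun x hx => ?_, ?_⟩
  · have hr := rapidDecay_deriv_vertical hθ hinf (hcusp x hx)
    have hcd := continuousOn_vertical (hθ.deriv hopen) x
    have h1 := (hr.const_mul D⁻¹).tendsto_integral (continuousOn_const.mul hcd)
    have h2 := h1.const_mul ((2 * Real.sqrt (2 * p) : ℝ) : ℂ)⁻¹
    have h3 := (rapidDecay_vertical hθ hinf (hcusp x hx)).integral_deriv (hr.const_mul I)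
      (fun y hy => hasDerivAt_vertical (fun z hz =>
        (hθ.differentiableAt (hopen.mem_nhds hz)).hasDerivAt) x hy) (continuousOn_const.mul hcd)
    have h4 : csqrt I ^ 3 ≠ 0 := pow_ne_zero _ (csqrt_ne_zero Complex.I_ne_zero)
    beta_reduce
    rw [eichler_self]
    have e : ((2 * Real.sqrt (2 * p) : ℝ) : ℂ)⁻¹ * ((D * I)⁻¹ * (1 / 2 * csqrt I ^ 3)) *
        ((csqrt I ^ 3)⁻¹ * ∫ y in Ioi (0 : ℝ), θ ((x : ℝ) + y * I) * (((Real.sqrt y) ^ 3)⁻¹ : ℝ)) =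
        ((2 * Real.sqrt (2 * p) : ℝ) : ℂ)⁻¹ *
          ∫ y in Ioi (0 : ℝ), D⁻¹ * deriv θ ((x : ℝ) + y * I) * ((Real.sqrt y)⁻¹ : ℝ) := by
      have e1 : ∫ y in Ioi (0 : ℝ), D⁻¹ * deriv θ ((x : ℝ) + y * I) * ((Real.sqrt y)⁻¹ : ℝ) =
          (D * I)⁻¹ * ∫ y in Ioi (0 : ℝ), I * deriv θ ((x : ℝ) + y * I) * ((Real.sqrt y)⁻¹ : ℝ) := by
        rw [← MeasureTheory.integral_const_mul]
        congr 1
        funext y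
        have := Complex.I_ne_zero
        field_simp
      rw [e1, h3]
      linear_combination (((2 * Real.sqrt (2 * p) : ℝ) : ℂ)⁻¹ * (D * I)⁻¹ * (1 / 2) *
        ∫ y in Ioi (0 : ℝ), θ ((x : ℝ) + y * I) * (((Real.sqrt y) ^ 3)⁻¹ : ℝ)) * mul_inv_cancel₀ h4
    rw [e]
    refine h2.congr' ?_
    filter_upwards [self_mem_nhdsWithin] with s hs
    have hs0 : 0 < s := hs
    have h5 := qSeries_eq_integral hp 1 hc (fun n => by rw [heven]; push_cast; ring)
      (fun h => absurd h one_ne_zero) (τ := (x : ℂ) + s * I) (by simpa using hs0)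
    simp only [pow_one] at h5
    rw [h5]
    congr 1
    refine setIntegral_congr_fun measurableSet_Ioi fun y hy => ?_
    have hy0 : 0 < y := hy
    have e2 : ((x : ℂ) + s * I) + y * I = ((x : ℝ) : ℂ) + ((s + y : ℝ) : ℂ) * I := by push_cast; ring
    rw [e2, hθ2 _ (by rw [add_mul_I_im]; positivity)]
  · refine isQuantumModularForm_eichler (m := 2) (by norm_num) (by decide) ⟨p * j ^ 2, by ring⟩ hθ hinf ?_
      (fun γ hγ x hx h => moebius_mem_cuspInfty hj hγ hx h) (fun x hx => hcusp x hx) (fun γ hγ hγ0 => ?_) _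
    · intro γ hγ z hz
      obtain ⟨ha, hb, hc, hd⟩ := Gamma_thetaSeries_congr hγ
      exact thetaSeries_zero_moebius hp hj hper (SL2Z_det γ) ha hd hb hc hz
    · obtain ⟨-, -, ⟨c', hc'⟩, hd⟩ := mem_Gamma_congr hγ
      have hc0 : c' ≠ 0 := by rintro rfl; rw [mul_zero] at hc'; exact hγ0 hc'
      have key := decaysAtCusp_thetaSeries_of_cusp hp hj (ν := 0) zero_le_one hper h0
        (x := -(γ 1 1 : ℚ) / (γ 1 0 : ℚ)) (a := γ 1 1) (c := -c') (neg_ne_zero.mpr hc0)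
        (hd.of_dvd ⟨2 * j, by push_cast; ring⟩) (by
          rw [hc']
          push_cast
          rw [show (j : ℚ) * (4 * p * j * -c') = -(4 * p * j ^ 2 * c') by ring, div_neg, neg_div])
      push_cast at key
      exact key

end

/-! ### Continued fractions -/

/-- The continuants of the tails of a list: `kSeq l r` is the numerator of the continued fraction of
the list without its first `r` entries; it is `1` at the end of the list and `0` afterwards. -/
def kSeq : List ℤ → ℕ → ℤ
  | [], 0 => 1
  | [], _ + 1 => 0
  | a :: l, 0 => a * kSeq l 0 - kSeq l 1
  | _ :: l, r + 1 => kSeq l r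

theorem kSeq_rec (l : List ℤ) (r : ℕ) (h : r < l.length) :
    kSeq l r = l[r] * kSeq l (r + 1) - kSeq l (r + 2) := by
  induction l generalizing r with
  | nil => simp at h
  | cons a l ih =>
    rcases r with _ | r
    · rfl
    · exact ih r (by simpa using h)

theorem kSeq_length (l : List ℤ) : kSeq l l.length = 1 := by
  induction l with
  | nil => rfl
  | cons a l ih => exact ih

theorem kSeq_of_length_lt (l : List ℤ) {r : ℕ} (h : l.length < r) : kSeq l r = 0 := by
  induction l generalizing r with
  | nil =>
    rcases r with _ | r
    · simp at h
    · rfl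
  | cons a l ih =>
    rcases r with _ | r
    · simp at h
    · exact ih (by simpa using h)

theorem kSeq_one_lt {l : List ℤ} (hl : ∀ a ∈ l, 2 ≤ a) : 0 ≤ kSeq l 1 ∧ kSeq l 1 < kSeq l 0 := by
  induction l with
  | nil => simp [kSeq]
  | cons a l ih =>
    obtain ⟨h1, h2⟩ := ih fun x hx => hl x (List.mem_cons_of_mem _ hx)
    have ha := hl a List.mem_cons_self
    simp only [kSeq]
    constructor
    · linarith
    · nlinarith

theorem kSeq_pos {l : List ℤ} (hl : ∀ a ∈ l, 2 ≤ a) {r : ℕ} (hr : r ≤ l.length) : 0 < kSeq l r := by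
  induction l generalizing r with
  | nil =>
    have : r = 0 := by simpa using hr
    subst this
    exact zero_lt_one
  | cons a l ih =>
    rcases r with _ | r
    · have := kSeq_one_lt hl
      linarith
    · exact ih (fun x hx => hl x (List.mem_cons_of_mem _ hx)) (by simpa using hr)

theorem isCoprime_kSeq (l : List ℤ) : IsCoprime (kSeq l 0) (kSeq l 1) := by
  induction l with
  | nil => exact isCoprime_one_left
  | cons a l ih =>
    simp only [kSeq]
    have h := ih.symm.neg_left
    rw [show a * kSeq l 0 - kSeq l 1 = -kSeq l 1 + a * kSeq l 0 by ring]
    exact IsCoprime.add_mul_right_left h a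

theorem negCF_eq_kSeq {l : List ℤ} (hl : ∀ a ∈ l, 2 ≤ a) : negCF l = (kSeq l 0 : ℚ) / kSeq l 1 := by
  induction l with
  | nil => simp [negCF, kSeq]
  | cons a l ih =>
    have hl' : ∀ x ∈ l, 2 ≤ x := fun x hx => hl x (List.mem_cons_of_mem _ hx)
    have h0 : (kSeq l 0 : ℚ) ≠ 0 := by exact_mod_cast (kSeq_pos hl' (Nat.zero_le _)).ne'
    rw [negCF, ih hl']
    simp only [kSeq]
    push_cast
    rw [inv_div]
    field_simp

/-- The continuants of a leg are the numerator and the denominator of its continued fraction. -/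
theorem eq_kSeq_of_negCF {l : List ℤ} (hl : ∀ a ∈ l, 2 ≤ a) {b w : ℕ} (hb : 0 < b) (hw : 0 < w)
    (hcop : IsCoprime (b : ℤ) (w : ℤ)) (h : negCF l = (b : ℚ) / w) :
    kSeq l 0 = b ∧ kSeq l 1 = w := by
  rw [negCF_eq_kSeq hl] at h
  have h0 := kSeq_pos hl (Nat.zero_le _)
  have h1 := (kSeq_one_lt hl).1
  have hwQ : (w : ℚ) ≠ 0 := by positivity
  have hk1 : kSeq l 1 ≠ 0 := by
    intro hk
    rw [hk, Int.cast_zero, div_zero, eq_comm, div_eq_zero_iff] at h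
    rcases h with h | h
    · exact hb.ne' (by exact_mod_cast h)
    · exact hwQ h
  have hk1Q : (kSeq l 1 : ℚ) ≠ 0 := by exact_mod_cast hk1
  rw [div_eq_div_iff hk1Q hwQ] at h
  have hZ : kSeq l 0 * w = b * kSeq l 1 := by exact_mod_cast h
  have d1 : kSeq l 0 ∣ b := (isCoprime_kSeq l).dvd_of_dvd_mul_right (Dvd.intro _ hZ)
  have d2 : (b : ℤ) ∣ kSeq l 0 := hcop.dvd_of_dvd_mul_right (Dvd.intro _ hZ.symm)
  have e : kSeq l 0 = b := Int.dvd_antisymm h0.le (by positivity) d1 d2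
  refine ⟨e, ?_⟩
  rw [e] at hZ
  have hb' : (b : ℤ) ≠ 0 := by exact_mod_cast hb.ne'
  exact (mul_left_cancel₀ hb' hZ).symm

/-- The solution of the recursion of a leg with given initial values. -/
def fSeq (l : List ℤ) (u v : ℤ) : ℕ → ℤ
  | 0 => u
  | 1 => v
  | r + 2 => l.getD r 0 * fSeq l u v (r + 1) - fSeq l u v r

/-- The Casoratian of two solutions of the recursion is constant. -/
theorem fSeq_casoratian (l : List ℤ) (u v : ℤ) (r : ℕ) (hr : r ≤ l.length) :
    fSeq l u v r * kSeq l (r + 1) - fSeq l u v (r + 1) * kSeq l r = u * kSeq l 1 - v * kSeq l 0 := by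
  induction r with
  | zero => rfl
  | succ r ih =>
    rw [← ih (by omega), fSeq, kSeq_rec l r (by omega), List.getD_eq_getElem _ _ (by omega)]
    ring

theorem fSeq_neg {l : List ℤ} (hl : ∀ a ∈ l, 2 ≤ a) {u v : ℤ} (hu : u < 0)
    (h : u * kSeq l 1 - v * kSeq l 0 = 1) (r : ℕ) (hr : r ≤ l.length + 1) : fSeq l u v r < 0 := by
  induction r with
  | zero => exact hu
  | succ r ih =>
    have h1 := fSeq_casoratian l u v r (by omega)
    have h2 := kSeq_pos hl (r := r) (by omega)
    have h3 : 0 ≤ kSeq l (r + 1) := by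
      rcases Nat.lt_or_ge l.length (r + 1) with h' | h'
      · exact (kSeq_of_length_lt l h').ge
      · exact (kSeq_pos hl h').le
    have h4 := ih (by omega)
    rw [h] at h1
    by_contra hcon
    push Not at hcon
    nlinarith [mul_nonneg hcon h2.le, mul_nonneg (neg_nonneg.mpr h4.le) h3]

/-! ### The plumbing matrix of a star-shaped graph -/

theorem sum_fin_val_eq {n : ℕ} (f : Fin n → ℤ) (m : ℕ) :
    ∑ r : Fin n, (if (r : ℕ) = m then f r else 0) = if h : m < n then f ⟨m, h⟩ else 0 := by
  split_ifs with h
  · rw [Finset.sum_eq_single ⟨m, h⟩]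
    · simp
    · intro r _ hr
      rw [if_neg]
      rintro rfl
      exact hr rfl
    · simp
  · refine Finset.sum_eq_zero fun r _ => if_neg ?_
    rintro rfl
    exact h r.2

namespace Plumbing

variable {V : Type}

theorem mat_symm (G : Plumbing V) (v w : V) : G.mat v w = G.mat w v := by
  by_cases h : v = w
  · rw [h]
  · by_cases h1 : G.graph.Adj v w
    · simp [mat, h, Ne.symm h, h1, h1.symm]
    · have h2 : ¬ G.graph.Adj w v := fun h2 => h1 h2.symm
      simp [mat, h, Ne.symm h, h1, h2]

variable [Fintype V]

theorem matU_eq (G : Plumbing V) (v : V) : G.matU v = G.weight v + G.deg v := by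
  classical
  have h1 : G.matU v = ∑ w, ((if v = w then G.weight v else 0) + if G.graph.Adj v w then 1 else 0) := by
    simp only [matU, Matrix.mulVec, dotProduct, mat, Matrix.of_apply, Pi.one_apply, mul_one]
    refine Finset.sum_congr rfl fun w _ => ?_
    by_cases h : v = w
    · subst h; simp
    · simp [h]
  rw [h1, Finset.sum_add_distrib, Finset.sum_ite_eq, if_pos (Finset.mem_univ v), Finset.sum_boole, deg]
  congr 2
  rw [Set.ncard_eq_toFinset_card']
  congr 1
  ext w
  simp

theorem form_comm (G : Plumbing V) (x y : V → ℤ) : G.form x y = G.form y x := by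
  have h : G.mat.transpose = G.mat := by
    ext v w
    exact G.mat_symm w v
  rw [form, form, Matrix.dotProduct_mulVec, ← Matrix.mulVec_transpose, h, dotProduct_comm]

end Plumbing

namespace BrieskornPlumbing

variable {b : Fin 3 → ℕ}

/-- The values of a vector along a leg, starting with the value at the centre and continued by zero
beyond the end of the leg. -/
def legExt (P : BrieskornPlumbing b) (x : P.Vertex → ℤ) (i : Fin 3) : ℕ → ℤ
  | 0 => x none
  | r + 1 => if h : r < (P.leg i).length then x (some ⟨i, ⟨r, h⟩⟩) else 0

theorem legExt_succ (P : BrieskornPlumbing b) (x : P.Vertex → ℤ) (i : Fin 3) (r : ℕ) :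
    P.legExt x i (r + 1) = if h : r < (P.leg i).length then x (some ⟨i, ⟨r, h⟩⟩) else 0 := rfl

theorem mulVec_none (P : BrieskornPlumbing b) (x : P.Vertex → ℤ) :
    P.plumbing.mat.mulVec x none = P.e * x none + ∑ i, P.legExt x i 1 := by
  simp only [Matrix.mulVec, dotProduct, Fintype.sum_option, Fintype.sum_sigma]
  congr 1
  · simp [Plumbing.mat, plumbing]
  · refine Finset.sum_congr rfl fun i _ => ?_
    rw [legExt, ← sum_fin_val_eq (fun r => x (some ⟨i, r⟩)) 0]
    refine Finset.sum_congr rfl fun r _ => ?_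
    simp [Plumbing.mat, plumbing, Next]

theorem mat_some_some (P : BrieskornPlumbing b) (i i' : Fin 3) (r : Fin (P.leg i).length)
    (r' : Fin (P.leg i').length) : P.plumbing.mat (some ⟨i, r⟩) (some ⟨i', r'⟩) =
      if i = i' then (if (r : ℕ) = r' then -(P.leg i).get r else
        if (r' : ℕ) = r + 1 ∨ (r : ℕ) = r' + 1 then 1 else 0) else 0 := by
  by_cases hi : i = i'
  · subst hi
    simp [Plumbing.mat, plumbing, Next, Fin.ext_iff]
    split_ifs <;> first | rfl | omega
  · have : ¬ i' = i := fun h => hi h.symm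
    simp [Plumbing.mat, plumbing, Next, hi, this]

theorem mulVec_some (P : BrieskornPlumbing b) (x : P.Vertex → ℤ) (i : Fin 3)
    (r : Fin (P.leg i).length) :
    P.plumbing.mat.mulVec x (some ⟨i, r⟩) =
      P.legExt x i r - (P.leg i)[(r : ℕ)] * P.legExt x i (r + 1) + P.legExt x i (r + 2) := by
  simp only [Matrix.mulVec, dotProduct, Fintype.sum_option, Fintype.sum_sigma, mat_some_some]
  have h1 : ∀ i' : Fin 3, i' ≠ i → ∑ r' : Fin (P.leg i').length, (if i = i' then (if (r : ℕ) = r' then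
      -(P.leg i).get r else if (r' : ℕ) = r + 1 ∨ (r : ℕ) = r' + 1 then 1 else 0) else 0) *
      x (some ⟨i', r'⟩) = 0 := by
    intro i' hi'
    refine Finset.sum_eq_zero fun r' _ => ?_
    rw [if_neg (fun h => hi' h.symm), zero_mul]
  rw [Finset.sum_eq_single i (fun i' _ hi' => h1 i' hi') (by simp)]
  have h2 : ∀ r' : Fin (P.leg i).length, (if i = i then (if (r : ℕ) = r' then
      -(P.leg i).get r else if (r' : ℕ) = r + 1 ∨ (r : ℕ) = r' + 1 then 1 else 0) else 0) *
      x (some ⟨i, r'⟩) = -(P.leg i)[(r : ℕ)] * (if (r' : ℕ) = r then x (some ⟨i, r'⟩) else 0) +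
        (if (r' : ℕ) = r + 1 then x (some ⟨i, r'⟩) else 0) +
        (if (r' : ℕ) + 1 = r then x (some ⟨i, r'⟩) else 0) := by
    intro r'
    rw [if_pos rfl]
    split_ifs <;> first | omega | simp
  rw [Finset.sum_congr rfl fun r' _ => h2 r']
  rw [Finset.sum_add_distrib, Finset.sum_add_distrib, ← Finset.mul_sum, sum_fin_val_eq, sum_fin_val_eq]
  have h3 : P.plumbing.mat (some ⟨i, r⟩) none * x none + ∑ r' : Fin (P.leg i).length,
      (if (r' : ℕ) + 1 = r then x (some ⟨i, r'⟩) else 0) = P.legExt x i r := by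
    obtain ⟨r, hr⟩ := r
    rcases r with _ | r
    · simp [Plumbing.mat, plumbing, Next, legExt]
    · have := sum_fin_val_eq (fun r' => x (some ⟨i, r'⟩)) r
      simp only [Nat.add_right_cancel_iff, this]
      simp [Plumbing.mat, plumbing, Next, legExt]
  rw [legExt_succ, legExt_succ]
  linear_combination h3

theorem leg_length_pos (P : BrieskornPlumbing b) (hb : ∀ i, 0 < b i) (i : Fin 3) :
    0 < (P.leg i).length := by
  rw [List.length_pos_iff]
  intro h
  have h1 := P.negCF_leg i
  rw [h, negCF, eq_comm, div_eq_zero_iff] at h1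
  have h2 := hb i
  have h3 := P.om_pos i
  rcases h1 with h1 | h1
  · exact h2.ne' (by exact_mod_cast h1)
  · exact h3.ne' (by exact_mod_cast h1)

theorem deg_none (P : BrieskornPlumbing b) (hb : ∀ i, 0 < b i) : P.plumbing.deg none = 3 := by
  have h1 := P.plumbing.matU_eq none
  rw [Plumbing.matU, mulVec_none] at h1
  simp only [legExt, P.leg_length_pos hb, dif_pos, Pi.one_apply] at h1
  have h2 : P.plumbing.weight none = P.e := rfl
  rw [h2] at h1
  simp at h1
  omega

theorem deg_some (P : BrieskornPlumbing b) (i : Fin 3) (r : Fin (P.leg i).length) :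
    P.plumbing.deg (some ⟨i, r⟩) = if (r : ℕ) + 1 = (P.leg i).length then 1 else 2 := by
  have h1 := P.plumbing.matU_eq (some ⟨i, r⟩)
  rw [Plumbing.matU, mulVec_some] at h1
  have h2 : P.plumbing.weight (some ⟨i, r⟩) = -(P.leg i)[(r : ℕ)] := rfl
  have h3 : P.legExt 1 i r = 1 := by
    obtain ⟨r, hr⟩ := r
    rcases r with _ | r
    · rfl
    · have : r < (P.leg i).length := by omega
      simp [legExt, this]
  rw [h2, h3] at h1
  simp only [legExt, r.2, dif_pos, Pi.one_apply, mul_one] at h1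
  have := r.2
  split_ifs at h1 ⊢ <;> omega

end BrieskornPlumbing

/-! ### The inverse of the plumbing matrix -/

/-- The products `p / bᵢ`. -/
def pOver (b : Fin 3 → ℕ) : Fin 3 → ℤ := ![b 1 * b 2, b 0 * b 2, b 0 * b 1]

/-- The quotients `p / (bᵢ bⱼ)` for `i ≠ j`, and `0` for `i = j`. -/
def pPair (b : Fin 3 → ℕ) (i j : Fin 3) : ℤ :=
  (![![0, b 2, b 1], ![b 2, 0, b 0], ![b 1, b 0, 0]] : Fin 3 → Fin 3 → ℤ) i j

theorem pOver_mul (b : Fin 3 → ℕ) (i : Fin 3) : pOver b i * b i = pNum b := by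
  fin_cases i <;> simp [pOver, pNum] <;> ring

theorem pPair_mul (b : Fin 3 → ℕ) {i j : Fin 3} (h : j ≠ i) : pPair b i j * b j = pOver b i := by
  fin_cases i <;> fin_cases j <;> first | exact absurd rfl h | simp [pOver, pPair]
  all_goals exact mul_comm _ _

theorem pPair_mul' (b : Fin 3 → ℕ) {i j : Fin 3} (h : j ≠ i) : pPair b i j * b i = pOver b j := by
  fin_cases i <;> fin_cases j <;> first | exact absurd rfl h | simp [pOver, pPair]
  all_goals exact mul_comm _ _

theorem pPair_self (b : Fin 3 → ℕ) (i : Fin 3) : pPair b i i = 0 := by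
  fin_cases i <;> simp [pPair]

theorem isCoprime_pOver {b : Fin 3 → ℕ} (hcop : Pairwise fun i i' => Nat.Coprime (b i) (b i'))
    (i : Fin 3) : IsCoprime (b i : ℤ) (pOver b i) := by
  have h : ∀ i j : Fin 3, i ≠ j → IsCoprime (b i : ℤ) (b j : ℤ) := fun i j hij =>
    Nat.isCoprime_iff_coprime.mpr (hcop hij)
  fin_cases i
  · exact (h 0 1 (by decide)).mul_right (h 0 2 (by decide))
  · exact (h 1 0 (by decide)).mul_right (h 1 2 (by decide))
  · exact (h 2 0 (by decide)).mul_right (h 2 1 (by decide))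

namespace BrieskornPlumbing

variable {b : Fin 3 → ℕ}

/-- The relation `e + ∑ ωᵢ / bᵢ = -1 / p` without denominators. It makes the plumbing matrix unimodular. -/
theorem euler_int (P : BrieskornPlumbing b) (hb : ∀ i, 0 < b i) :
    P.e * pNum b + ∑ i, (P.om i : ℤ) * pOver b i = -1 := by
  have h := P.euler
  have hQ : ∀ i, (b i : ℚ) ≠ 0 := fun i => by have := hb i; positivity
  have h0 := hQ 0
  have h1 := hQ 1
  have h2 := hQ 2
  have key : (P.e : ℚ) * pNum b + ∑ i, (P.om i : ℚ) * pOver b i = -1 := by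
    simp only [Fin.sum_univ_three, Fin.prod_univ_three, pNum, pOver, Matrix.cons_val] at h ⊢
    push_cast at h ⊢
    field_simp at h
    linarith
  exact_mod_cast key

theorem isCoprime_om (P : BrieskornPlumbing b) (hb : ∀ i, 0 < b i) (i : Fin 3) :
    IsCoprime (b i : ℤ) (P.om i : ℤ) := by
  have h := P.euler_int hb
  rw [← Finset.add_sum_erase _ _ (Finset.mem_univ i)] at h
  have h1 : ∑ j ∈ Finset.univ.erase i, (P.om j : ℤ) * pOver b j =
      b i * ∑ j ∈ Finset.univ.erase i, (P.om j : ℤ) * pPair b i j := by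
    rw [Finset.mul_sum]
    refine Finset.sum_congr rfl fun j hj => ?_
    rw [← pPair_mul' b (Finset.ne_of_mem_erase hj)]
    ring
  rw [h1, ← pOver_mul b i] at h
  refine ⟨-(P.e * pOver b i + ∑ j ∈ Finset.univ.erase i, (P.om j : ℤ) * pPair b i j), -pOver b i, ?_⟩
  linear_combination -h

theorem kSeq_leg (P : BrieskornPlumbing b) (hb : ∀ i, 0 < b i) (i : Fin 3) :
    kSeq (P.leg i) 0 = b i ∧ kSeq (P.leg i) 1 = P.om i :=
  eq_kSeq_of_negCF (P.two_le i) (hb i) (P.om_pos i) (P.isCoprime_om hb i) (P.negCF_leg i)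

/-- The solution of the recursion of the leg `i` whose values near the centre match a solution of the
recursions of the two other legs. -/
def legSol (P : BrieskornPlumbing b) (i : Fin 3) : ℕ → ℤ :=
  fSeq (P.leg i) (-pOver b i) (P.e * pOver b i + ∑ j, (P.om j : ℤ) * pPair b i j)

/-- The Casoratian of `legSol` and `kSeq` is `1`, which makes the Green function integral. -/
theorem legSol_normalized (P : BrieskornPlumbing b) (hb : ∀ i, 0 < b i) (i : Fin 3) :
    -pOver b i * kSeq (P.leg i) 1 -
      (P.e * pOver b i + ∑ j, (P.om j : ℤ) * pPair b i j) * kSeq (P.leg i) 0 = 1 := by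
  obtain ⟨h0, h1⟩ := P.kSeq_leg hb i
  have h := P.euler_int hb
  rw [h0, h1]
  have h2 : (∑ j, (P.om j : ℤ) * pPair b i j) * b i = (∑ j, (P.om j : ℤ) * pOver b j) - P.om i * pOver b i := by
    rw [Finset.sum_mul, ← Finset.add_sum_erase _ _ (Finset.mem_univ i),
      ← Finset.add_sum_erase _ (fun j => (P.om j : ℤ) * pOver b j) (Finset.mem_univ i), pPair_self,
      add_sub_cancel_left, mul_zero, zero_mul, zero_add]
    refine Finset.sum_congr rfl fun j hj => ?_
    rw [← pPair_mul' b (Finset.ne_of_mem_erase hj)]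
    ring
  linear_combination -h2 - h - P.e * pOver_mul b i

/-- The column of the inverse plumbing matrix that belongs to the centre. -/
def invCentre (P : BrieskornPlumbing b) : P.Vertex → ℤ
  | none => -pNum b
  | some ⟨i, r⟩ => -pOver b i * kSeq (P.leg i) (r + 1)

/-- The column of the inverse plumbing matrix that belongs to the vertex number `r` on the leg `i`:
a discrete Green function. -/
def invLeg (P : BrieskornPlumbing b) (i : Fin 3) (r : ℕ) : P.Vertex → ℤ
  | none => -pOver b i * kSeq (P.leg i) (r + 1)
  | some ⟨j, s⟩ =>
    if j = i then
      if (s : ℕ) ≤ r then kSeq (P.leg i) (r + 1) * P.legSol i (s + 1)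
      else P.legSol i (r + 1) * kSeq (P.leg i) (s + 1)
    else -kSeq (P.leg i) (r + 1) * pPair b i j * kSeq (P.leg j) (s + 1)

theorem legExt_invCentre (P : BrieskornPlumbing b) (hb : ∀ i, 0 < b i) (i : Fin 3) (r : ℕ) :
    P.legExt P.invCentre i r = -pOver b i * kSeq (P.leg i) r := by
  rcases r with _ | r
  · rw [(P.kSeq_leg hb i).1, neg_mul, pOver_mul]
    rfl
  · rw [legExt_succ]
    split_ifs with h
    · rfl
    · rw [kSeq_of_length_lt _ (by omega), mul_zero]

theorem mulVec_invCentre (P : BrieskornPlumbing b) (hb : ∀ i, 0 < b i) :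
    P.plumbing.mat.mulVec P.invCentre = Pi.single none 1 := by
  funext v
  rcases v with _ | ⟨i, r⟩
  · rw [mulVec_none, Pi.single_eq_same]
    simp only [P.legExt_invCentre hb, (P.kSeq_leg hb _).2]
    have h := P.euler_int hb
    have h2 : ∑ i, -pOver b i * (P.om i : ℤ) = -∑ i, (P.om i : ℤ) * pOver b i := by
      rw [← Finset.sum_neg_distrib]
      exact Finset.sum_congr rfl fun _ _ => by ring
    rw [h2]
    simp only [invCentre]
    linear_combination -h
  · rw [mulVec_some, Pi.single_eq_of_ne (by simp)]
    simp only [P.legExt_invCentre hb]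
    rw [kSeq_rec _ _ r.2]
    ring

theorem legExt_invLeg_ne (P : BrieskornPlumbing b) (hb : ∀ i, 0 < b i) {i j : Fin 3} (hij : j ≠ i)
    (r s : ℕ) : P.legExt (P.invLeg i r) j s =
      -kSeq (P.leg i) (r + 1) * pPair b i j * kSeq (P.leg j) s := by
  rcases s with _ | s
  · rw [(P.kSeq_leg hb j).1, mul_assoc, pPair_mul b hij]
    simp only [legExt, invLeg]
    ring
  · rw [legExt_succ]
    split_ifs with h
    · simp [invLeg, hij]
    · rw [kSeq_of_length_lt (P.leg j) (by omega), mul_zero]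

theorem legExt_invLeg_self (P : BrieskornPlumbing b) (i : Fin 3) {r : ℕ} (hr : r < (P.leg i).length)
    (s : ℕ) : P.legExt (P.invLeg i r) i s =
      if s ≤ r + 1 then kSeq (P.leg i) (r + 1) * P.legSol i s
      else P.legSol i (r + 1) * kSeq (P.leg i) s := by
  rcases s with _ | s
  · rw [if_pos (Nat.zero_le _)]
    simp only [legExt, invLeg, legSol, fSeq]
    ring
  · rw [legExt_succ]
    split_ifs with h h' h'
    · simp [invLeg, show s ≤ r by omega]
    · simp [invLeg, show ¬ s ≤ r by omega]
    · omega
    · rw [kSeq_of_length_lt _ (by omega), mul_zero]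

theorem mulVec_invLeg (P : BrieskornPlumbing b) (hb : ∀ i, 0 < b i) (i : Fin 3)
    (r : Fin (P.leg i).length) :
    P.plumbing.mat.mulVec (P.invLeg i r) = Pi.single (some ⟨i, r⟩) 1 := by
  funext v
  rcases v with _ | ⟨j, s⟩
  · rw [mulVec_none, Pi.single_eq_of_ne (by simp), ← Finset.add_sum_erase _ _ (Finset.mem_univ i),
      P.legExt_invLeg_self i r.2, if_pos (by omega)]
    have h2 : ∑ j ∈ Finset.univ.erase i, P.legExt (P.invLeg i r) j 1 =
        -kSeq (P.leg i) (r + 1) * ∑ j, (P.om j : ℤ) * pPair b i j := by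
      rw [← Finset.add_sum_erase _ (fun j => (P.om j : ℤ) * pPair b i j) (Finset.mem_univ i),
        pPair_self, mul_zero, zero_add, Finset.mul_sum]
      refine Finset.sum_congr rfl fun j hj => ?_
      rw [P.legExt_invLeg_ne hb (Finset.ne_of_mem_erase hj), (P.kSeq_leg hb j).2]
      ring
    rw [h2]
    simp only [invLeg, legSol, fSeq]
    ring
  · rw [mulVec_some]
    by_cases hij : j = i
    · subst hij
      simp only [P.legExt_invLeg_self j r.2]
      have hs := s.2
      have hrec : P.legSol j (s + 2) = (P.leg j)[(s : ℕ)] * P.legSol j (s + 1) - P.legSol j s := by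
        simp only [legSol, fSeq]
        rw [List.getD_eq_getElem _ _ hs]
      have hk := kSeq_rec (P.leg j) s hs
      rcases lt_trichotomy (s : ℕ) (r : ℕ) with h | h | h
      · rw [Pi.single_eq_of_ne (by simp only [ne_eq, Option.some.injEq, Sigma.mk.injEq, heq_eq_eq, true_and]
                                   rintro rfl; exact lt_irrefl _ h),
          if_pos (by omega), if_pos (by omega), if_pos (by omega), hrec]
        ring
      · have hsr : s = r := Fin.ext h
        subst hsr
        rw [Pi.single_eq_same, if_pos (by omega), if_pos (by omega), if_neg (by omega)]
        have hW := fSeq_casoratian (P.leg j) (-pOver b j)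
          (P.e * pOver b j + ∑ i, (P.om i : ℤ) * pPair b j i) s hs.le
        rw [P.legSol_normalized hb] at hW
        simp only [legSol] at *
        rw [hk] at hW
        linear_combination hW
      · rw [Pi.single_eq_of_ne (by simp only [ne_eq, Option.some.injEq, Sigma.mk.injEq, heq_eq_eq, true_and]
                                   rintro rfl; exact lt_irrefl _ h),
          if_neg (by omega : ¬ (s : ℕ) + 1 ≤ r + 1), if_neg (by omega : ¬ (s : ℕ) + 2 ≤ r + 1)]
        split_ifs with h'
        · have h1 : (s : ℕ) = r + 1 := by omega
          rw [← h1] at *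
          linear_combination P.legSol j s * hk
        · linear_combination P.legSol j (r + 1) * hk
    · rw [Pi.single_eq_of_ne (by
        intro h
        simp only [Option.some.injEq, Sigma.mk.injEq] at h
        exact hij h.1)]
      simp only [P.legExt_invLeg_ne hb hij]
      rw [kSeq_rec _ _ s.2]
      ring

/-- The inverse of the plumbing matrix, which is integral. -/
def invMat (P : BrieskornPlumbing b) : Matrix P.Vertex P.Vertex ℤ :=
  Matrix.of fun w v => match v with
    | none => P.invCentre w
    | some ⟨i, r⟩ => P.invLeg i r w

theorem mat_mul_invMat (P : BrieskornPlumbing b) (hb : ∀ i, 0 < b i) :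
    P.plumbing.mat * P.invMat = 1 := by
  ext w v
  rcases v with _ | ⟨i, r⟩
  · refine (congrFun (P.mulVec_invCentre hb) w).trans ?_
    rw [Pi.single_apply, Matrix.one_apply]
  · refine (congrFun (P.mulVec_invLeg hb i r) w).trans ?_
    rw [Pi.single_apply, Matrix.one_apply]

theorem invMat_mul_mat (P : BrieskornPlumbing b) (hb : ∀ i, 0 < b i) :
    P.invMat * P.plumbing.mat = 1 := mul_eq_one_comm.mp (P.mat_mul_invMat hb)

end BrieskornPlumbing

/-! ### The exponents in terms of the inverse matrix -/

namespace Plumbing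

variable {V : Type} [Fintype V]

/-- Removing a vertex from a unimodular graph leaves a graph whose first homology is cyclic, of the
order given by the diagonal entry of the inverse matrix. -/
theorem homologyCard_ne [DecidableEq V] (G : Plumbing V) {B : Matrix V V ℤ} (h1 : G.mat * B = 1)
    (h2 : B * G.mat = 1) (e : V) : G.homologyCard {v | v ≠ e} = (B e e).natAbs := by
  unfold homologyCard
  set S : Set V := {v | v ≠ e} with hS
  set n := (B e e).natAbs with hn
  have hsplit : ∀ f : V → ℤ, ∑ v, f v = f e + ∑ v : S, f v := by
    intro f
    rw [Fintype.sum_eq_add_sum_subtype_ne f e]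
    congr 1
  have hBM : ∀ w : V → ℤ, B.mulVec (G.mat.mulVec w) = w := by
    intro w; rw [Matrix.mulVec_mulVec, h2, Matrix.one_mulVec]
  have hMB : ∀ w : V → ℤ, G.mat.mulVec (B.mulVec w) = w := by
    intro w; rw [Matrix.mulVec_mulVec, h1, Matrix.one_mulVec]
  set ext : (S → ℤ) → ℤ → V → ℤ := fun z t v => if h : v = e then t else z ⟨v, h⟩ with hext
  have ext_e : ∀ z t, ext z t e = t := by intro z t; simp [hext]
  have ext_S : ∀ z t (v : S), ext z t v = z v := by
    intro z t v
    have : (v : V) ≠ e := v.2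
    simp [hext, this]
  -- the functional `z ↦ ∑ B e v * z v` modulo `B e e` identifies the cokernel with `ℤ / B e e`
  set φ : (S → ℤ) →ₗ[ℤ] ZMod n :=
    { toFun := fun z => ((∑ v : S, B e v * z v : ℤ) : ZMod n)
      map_add' := fun x y => by
        simp only [Pi.add_apply, mul_add, Finset.sum_add_distrib, Int.cast_add]
      map_smul' := fun c x => by
        simp only [Pi.smul_apply, smul_eq_mul, RingHom.id_apply, zsmul_eq_mul]
        rw [← Int.cast_mul, Finset.mul_sum]
        congr 1
        exact Finset.sum_congr rfl fun _ _ => by ring } with hφ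
  have hφ_apply : ∀ z, φ z = ((∑ v : S, B e v * z v : ℤ) : ZMod n) := fun z => rfl
  have hker : LinearMap.range (G.mat.submatrix (Subtype.val : S → V) (Subtype.val : S → V)).mulVecLin =
      LinearMap.ker φ := by
    ext z
    rw [LinearMap.mem_range, LinearMap.mem_ker, hφ_apply, ZMod.intCast_zmod_eq_zero_iff_dvd, hn,
      Int.natAbs_dvd]
    constructor
    · rintro ⟨w, rfl⟩
      have h3 := congrFun (hBM (ext w 0)) e
      rw [ext_e, Matrix.mulVec, dotProduct, hsplit] at h3
      have h4 : ∀ u : S, G.mat.mulVec (ext w 0) u =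
          (G.mat.submatrix (Subtype.val : S → V) (Subtype.val : S → V)).mulVecLin w u := by
        intro u
        rw [Matrix.mulVec, dotProduct, hsplit, ext_e, mul_zero, zero_add]
        exact Finset.sum_congr rfl fun v _ => by rw [ext_S]; rfl
      simp only [h4] at h3
      exact ⟨-(G.mat.mulVec (ext w 0) e), by linear_combination h3⟩
    · rintro ⟨s, hs⟩
      set z' := ext z (-s) with hz'
      have h3 : B.mulVec z' e = 0 := by
        rw [Matrix.mulVec, dotProduct, hsplit, hz', ext_e]
        simp only [ext_S]
        rw [hs]
        ring
      refine ⟨fun v => B.mulVec z' v, ?_⟩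
      funext u
      have h4 := congrFun (hMB z') u
      rw [Matrix.mulVec, dotProduct, hsplit, h3, mul_zero, zero_add, hz', ext_S] at h4
      exact h4
  have hsurj : Function.Surjective φ := by
    intro a
    obtain ⟨s, rfl⟩ := ZMod.intCast_surjective a
    set z' := G.mat.mulVec (Pi.single e s) with hz'
    refine ⟨fun v => z' v, ?_⟩
    have h3 := congrFun (hBM (Pi.single e s)) e
    rw [← hz', Matrix.mulVec, dotProduct, hsplit, Pi.single_eq_same] at h3
    rw [hφ_apply, ← h3, ZMod.intCast_eq_intCast_iff_dvd_sub, hn, Int.natAbs_dvd]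
    exact ⟨z' e, by ring⟩
  convert (Nat.card_congr ((Submodule.quotEquivOfEq _ _ hker).trans
    (φ.quotKerEquivOfSurjective hsurj)).toEquiv).trans (Nat.card_zmod n)

theorem dualSq_eq [DecidableEq V] (G : Plumbing V) {B : Matrix V V ℤ} (h1 : G.mat * B = 1) (a : V → ℤ) :
    G.dualSq a = ((dotProduct a (B.mulVec a) : ℤ) : ℚ) := by
  have h2 : (G.mat.map (Int.cast : ℤ → ℚ)) * (B.map (Int.cast : ℤ → ℚ)) = 1 := by
    have h := Matrix.map_mul (f := Int.castRingHom ℚ) (L := G.mat) (M := B)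
    rw [h1, Matrix.map_one _ (map_zero _) (map_one _)] at h
    exact h.symm
  have h3 := Matrix.inv_eq_right_inv h2
  unfold dualSq
  have h4 : ∀ inst : DecidableEq V, (@Inv.inv _ (@Matrix.inv V ℚ _ inst _) (G.mat.map (Int.cast : ℤ → ℚ))) =
      B.map (Int.cast : ℤ → ℚ) := by
    intro inst
    rw [← h3]
    congr!
  rw [h4]
  simp only [dotProduct, Matrix.mulVec, Matrix.map_apply]
  push_cast
  rfl

/-- Completing the square in the exponent of `q`. -/
theorem qExp_eq [DecidableEq V] (G : Plumbing V) {B : Matrix V V ℤ} (h1 : G.mat * B = 1)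
    (h2 : B * G.mat = 1) (k x l : V → ℤ) (hl : ∀ v, l v = 2 * G.mat.mulVec x v + k v - G.matU v) :
    G.qExp k x = -(3 * (Fintype.card V : ℚ) + ((∑ v, G.weight v : ℤ) : ℚ)) / 4 -
      ((dotProduct l (B.mulVec l) : ℤ) : ℚ) / 4 := by
  set a := k - G.matU with ha
  have hl' : l = (2 : ℤ) • G.mat.mulVec x + a := by
    funext v; rw [hl, ha]; simp; ring
  have hBM : B.mulVec (G.mat.mulVec x) = x := by rw [Matrix.mulVec_mulVec, h2, Matrix.one_mulVec]
  have hMB : ∀ w : V → ℤ, G.mat.mulVec (B.mulVec w) = w := by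
    intro w; rw [Matrix.mulVec_mulVec, h1, Matrix.one_mulVec]
  have e1 : dotProduct (G.mat.mulVec x) x = G.form x x := by rw [form, dotProduct_comm]
  have e2 : dotProduct (G.mat.mulVec x) (B.mulVec a) = dotProduct x a := by
    have := G.form_comm x (B.mulVec a)
    rw [form, form, hMB, dotProduct_comm (B.mulVec a)] at this
    exact this.symm
  have e3 : dotProduct x a = dotProduct k x - G.form x 1 := by
    rw [ha, dotProduct_sub, dotProduct_comm, form, matU]
  have e4 : dotProduct l (B.mulVec l) =
      4 * G.form x x + 4 * (dotProduct k x - G.form x 1) + dotProduct a (B.mulVec a) := by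
    rw [hl', Matrix.mulVec_add, Matrix.mulVec_smul, hBM, dotProduct_add, add_dotProduct, add_dotProduct,
      smul_dotProduct, smul_dotProduct, dotProduct_smul, dotProduct_smul, e1, e2, dotProduct_comm a x, e3]
    simp only [smul_eq_mul]
    ring
  rw [qExp, chi, dualSq_eq G h1, e4]
  push_cast
  ring

theorem tExp_eq (G : Plumbing V) (k x l : V → ℤ)
    (hl : ∀ v, l v = 2 * G.mat.mulVec x v + k v - G.matU v) : G.tExp k x = (∑ v, l v) / 2 := by
  have h1 : ∑ v, l v = 2 * G.form x 1 + (dotProduct k 1 - G.form 1 1) := by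
    rw [form_comm, form, form, dotProduct, dotProduct, dotProduct, Finset.mul_sum, ← Finset.sum_sub_distrib,
      ← Finset.sum_add_distrib]
    refine Finset.sum_congr rfl fun v _ => ?_
    rw [hl, matU]
    simp only [Pi.one_apply]
    ring
  rw [tExp, h1]
  omega

end Plumbing

namespace BrieskornPlumbing

variable {b : Fin 3 → ℕ}

/-- The last vertex of the leg `i`. -/
def endVertex (P : BrieskornPlumbing b) (hb : ∀ i, 0 < b i) (i : Fin 3) : P.Vertex :=
  some ⟨i, ⟨(P.leg i).length - 1, Nat.sub_lt (P.leg_length_pos hb i) one_pos⟩⟩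

theorem length_sub_add (P : BrieskornPlumbing b) (hb : ∀ i, 0 < b i) (i : Fin 3) :
    (P.leg i).length - 1 + 1 = (P.leg i).length :=
  Nat.sub_add_cancel (P.leg_length_pos hb i)

theorem isEnd_iff (P : BrieskornPlumbing b) (hb : ∀ i, 0 < b i) (i : Fin 3) (v : P.Vertex) :
    P.IsEnd i v ↔ v = P.endVertex hb i := by
  have hn := P.leg_length_pos hb i
  constructor
  · rintro ⟨r, hr, rfl⟩
    have : r = ⟨(P.leg i).length - 1, Nat.sub_lt (P.leg_length_pos hb i) one_pos⟩ := Fin.ext (by simp; omega)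
    rw [endVertex, ← this]
  · rintro rfl
    exact ⟨_, P.length_sub_add hb i, rfl⟩

theorem invMat_none_none (P : BrieskornPlumbing b) : P.invMat none none = -pNum b := rfl

theorem invMat_end_none (P : BrieskornPlumbing b) (hb : ∀ i, 0 < b i) (i : Fin 3) :
    P.invMat (P.endVertex hb i) none = -pOver b i := by
  have hn := P.leg_length_pos hb i
  change -pOver b i * kSeq (P.leg i) ((P.leg i).length - 1 + 1) = -pOver b i
  rw [P.length_sub_add hb i, kSeq_length, mul_one]

theorem invMat_none_end (P : BrieskornPlumbing b) (hb : ∀ i, 0 < b i) (i : Fin 3) :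
    P.invMat none (P.endVertex hb i) = -pOver b i := by
  have hn := P.leg_length_pos hb i
  change -pOver b i * kSeq (P.leg i) ((P.leg i).length - 1 + 1) = -pOver b i
  rw [P.length_sub_add hb i, kSeq_length, mul_one]

theorem invMat_end_end_ne (P : BrieskornPlumbing b) (hb : ∀ i, 0 < b i) {i j : Fin 3} (hij : j ≠ i) :
    P.invMat (P.endVertex hb j) (P.endVertex hb i) = -pPair b i j := by
  have hn := P.leg_length_pos hb i
  have hn' := P.leg_length_pos hb j
  simp only [invMat, Matrix.of_apply, endVertex, invLeg, hij, if_false]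
  rw [P.length_sub_add hb i, P.length_sub_add hb j, kSeq_length, kSeq_length]
  ring

/-- The integers `hᵢ` are, up to sign, the diagonal entries of the inverse plumbing matrix. -/
theorem invMat_end_end (P : BrieskornPlumbing b) (hb : ∀ i, 0 < b i) (i : Fin 3) :
    P.invMat (P.endVertex hb i) (P.endVertex hb i) = -(P.h i : ℤ) := by
  have hn := P.leg_length_pos hb i
  have h1 : P.invMat (P.endVertex hb i) (P.endVertex hb i) = P.legSol i (P.leg i).length := by
    simp only [invMat, Matrix.of_apply, endVertex, invLeg, if_true, le_refl]
    rw [P.length_sub_add hb i, kSeq_length, one_mul]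
  have hp : -pOver b i < 0 := by
    have h := pOver_mul b i
    have hpos : (0 : ℤ) < pNum b := by
      have := hb 0; have := hb 1; have := hb 2
      unfold pNum; positivity
    have hbi : (0 : ℤ) < b i := by exact_mod_cast hb i
    rw [← h] at hpos
    have := (pos_iff_pos_of_mul_pos hpos).mpr hbi
    linarith
  have h2 : P.legSol i (P.leg i).length < 0 :=
    fSeq_neg (P.two_le i) hp (P.legSol_normalized hb i) _ (by omega)
  have h3 : P.h i = (P.invMat (P.endVertex hb i) (P.endVertex hb i)).natAbs := by
    rw [← P.plumbing.homologyCard_ne (P.mat_mul_invMat hb) (P.invMat_mul_mat hb), h]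
    congr 1
    ext v
    rw [Set.mem_ofPred_eq, Set.mem_ofPred_eq, P.isEnd_iff hb]
  rw [h3, h1]
  omega

end BrieskornPlumbing

/-! ### Coordinates on the support of the coefficients -/

/-- The integers `p (2l + 1) + ∑ ηᵢ p / bᵢ`, for an integer `l` and three signs `η`. -/
def latN (b : Fin 3 → ℕ) (u : ℤ × (Fin 3 → ℤˣ)) : ℤ :=
  pNum b * (2 * u.1 + 1) + ∑ i, (u.2 i : ℤ) * pOver b i

/-- The exponent `(2l + 1 + ∑ ηᵢ) / 2` of `t`; the division is exact. -/
def latE (u : ℤ × (Fin 3 → ℤˣ)) : ℤ := (2 * u.1 + 1 + ∑ i, (u.2 i : ℤ)) / 2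

/-- The product of the three signs. -/
def latSign (u : ℤ × (Fin 3 → ℤˣ)) : ℤ := ∏ i, (u.2 i : ℤ)

/-- The summand of the two-variable series in terms of the coordinates `(l, η)`, without the factor
`q ^ Δ`. -/
def latTerm (b : Fin 3 → ℕ) (t τ : ℂ) (u : ℤ × (Fin 3 → ℤˣ)) : ℂ :=
  -(1 / 2) * latSign u * (2 * u.1 + 1).sign * qpow ((latN b u : ℚ) ^ 2 / (4 * pNum b)) τ * t ^ latE u

theorem two_mul_latE (u : ℤ × (Fin 3 → ℤˣ)) : 2 * latE u = 2 * u.1 + 1 + ∑ i, (u.2 i : ℤ) := by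
  rw [latE, Fin.sum_univ_three]
  rcases Int.units_eq_one_or (u.2 0) with h0 | h0 <;> rcases Int.units_eq_one_or (u.2 1) with h1 | h1 <;>
    rcases Int.units_eq_one_or (u.2 2) with h2 | h2 <;> simp only [h0, h1, h2] <;> push_cast <;> omega

namespace Plumbing

theorem Fhat_one_unit (η : ℤˣ) : Fhat 1 (η : ℤ) = -((η : ℤ) : ℚ) := by
  rcases Int.units_eq_one_or η with h | h <;> simp [h, Fhat]

theorem Fhat_three_odd (l : ℤ) : Fhat 3 (2 * l + 1) = 1 / 2 * ((2 * l + 1).sign : ℚ) := by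
  have h1 : (1 : ℤ) ≤ |2 * l + 1| := Int.one_le_abs (by omega)
  have h2 : 2 * l + 1 ≡ 3 [ZMOD 2] := by unfold Int.ModEq; omega
  have h3 : ∀ s : ℤ, (s.sign : ℚ) ^ 3 = s.sign := by
    intro s
    rcases lt_trichotomy s 0 with h | h | h
    · rw [Int.sign_eq_neg_one_of_neg h]; norm_num
    · rw [h]; norm_num
    · rw [Int.sign_eq_one_of_pos h]; norm_num
  simp only [Fhat]
  rw [if_pos ⟨by simpa using h1, by simpa using h2⟩]
  simp [h3]

theorem Fhat_three_ne_zero {r : ℤ} (h : Fhat 3 r ≠ 0) : ∃ l, r = 2 * l + 1 := by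
  simp only [Fhat] at h
  split_ifs at h with h1
  · have := h1.2
    unfold Int.ModEq at this
    exact ⟨r / 2, by omega⟩
  · exact absurd rfl h

theorem exists_mulVec_eq {V : Type} [Fintype V] [DecidableEq V] (G : Plumbing V) {B : Matrix V V ℤ}
    (h1 : G.mat * B = 1) {k l : V → ℤ} (hk : G.IsSpinc k) (hl : ∀ v, l v ≡ G.deg v [ZMOD 2]) :
    ∃ x : V → ℤ, ∀ v, l v = 2 * G.mat.mulVec x v + k v - G.matU v := by
  refine ⟨B.mulVec fun v => (l v - k v + G.matU v) / 2, fun v => ?_⟩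
  rw [Matrix.mulVec_mulVec, h1, Matrix.one_mulVec, G.matU_eq]
  have h2 := hk v
  have h3 := hl v
  unfold Int.ModEq at h2 h3
  omega

end Plumbing

namespace BrieskornPlumbing

variable {b : Fin 3 → ℕ}

/-- The values of `2Mx + k - Mu` at the vertices for those `x` whose summand does not vanish: `2l + 1`
at the centre, `ηᵢ` at the end of the leg `i`, and `0` elsewhere. -/
def latVec (P : BrieskornPlumbing b) (u : ℤ × (Fin 3 → ℤˣ)) : P.Vertex → ℤ
  | none => 2 * u.1 + 1
  | some ⟨i, r⟩ => if (r : ℕ) + 1 = (P.leg i).length then (u.2 i : ℤ) else 0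

theorem latVec_end (P : BrieskornPlumbing b) (hb : ∀ i, 0 < b i) (u : ℤ × (Fin 3 → ℤˣ)) (i : Fin 3) :
    P.latVec u (P.endVertex hb i) = u.2 i := by
  simp only [latVec, endVertex]
  rw [if_pos (P.length_sub_add hb i)]

theorem sum_latVec_mul (P : BrieskornPlumbing b) (hb : ∀ i, 0 < b i) (u : ℤ × (Fin 3 → ℤˣ))
    (f : P.Vertex → ℤ) : ∑ v, P.latVec u v * f v =
      (2 * u.1 + 1) * f none + ∑ i, (u.2 i : ℤ) * f (P.endVertex hb i) := by
  rw [Fintype.sum_option, Fintype.sum_sigma]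
  congr 1
  refine Finset.sum_congr rfl fun i _ => ?_
  rw [Finset.sum_eq_single (⟨(P.leg i).length - 1, Nat.sub_lt (P.leg_length_pos hb i) one_pos⟩ :
    Fin (P.leg i).length)]
  · rw [← P.latVec_end hb u i]
    rfl
  · intro r _ hr
    have : (r : ℕ) + 1 ≠ (P.leg i).length := fun h => hr (Fin.ext (by simp; omega))
    simp [latVec, this]
  · intro h
    exact absurd (Finset.mem_univ _) h

theorem latVec_injective (P : BrieskornPlumbing b) (hb : ∀ i, 0 < b i) : Function.Injective P.latVec := by
  intro u u' h
  have h1 := congrFun h none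
  simp only [latVec] at h1
  refine Prod.ext (by omega) (funext fun i => Units.ext ?_)
  rw [← P.latVec_end hb u i, h, P.latVec_end hb]

theorem latVec_parity (P : BrieskornPlumbing b) (hb : ∀ i, 0 < b i) (u : ℤ × (Fin 3 → ℤˣ))
    (v : P.Vertex) : P.latVec u v ≡ P.plumbing.deg v [ZMOD 2] := by
  rcases v with _ | ⟨i, r⟩
  · rw [P.deg_none hb]
    simp only [latVec, Int.ModEq]
    push_cast
    omega
  · rw [P.deg_some]
    simp only [latVec]
    split_ifs
    · rcases Int.units_eq_one_or (u.2 i) with h | h <;> rw [h] <;> decide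
    · decide

/-- The pairing of `latVec` with itself under the inverse plumbing matrix. -/
theorem dotProduct_latVec (P : BrieskornPlumbing b) (hb : ∀ i, 0 < b i) (u : ℤ × (Fin 3 → ℤˣ)) :
    ((dotProduct (P.latVec u) (P.invMat.mulVec (P.latVec u)) : ℤ) : ℚ) =
      -((latN b u : ℚ) ^ 2 / pNum b) - ∑ i, (P.h i : ℚ) + (b 1 * b 2 : ℚ) / b 0 +
        (b 0 * b 2 : ℚ) / b 1 + (b 0 * b 1 : ℚ) / b 2 := by
  have hq : ∀ i, (b i : ℚ) ≠ 0 := fun i => by have := hb i; positivity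
  have h0 := hq 0
  have h1 := hq 1
  have h2 := hq 2
  have hsq : ∀ i, ((u.2 i : ℤ) : ℚ) ^ 2 = 1 := by
    intro i
    rcases Int.units_eq_one_or (u.2 i) with h | h <;> simp [h]
  have s0 := hsq 0
  have s1 := hsq 1
  have s2 := hsq 2
  have hB : ∀ v, P.invMat.mulVec (P.latVec u) v =
      (2 * u.1 + 1) * P.invMat v none + ∑ i, (u.2 i : ℤ) * P.invMat v (P.endVertex hb i) := by
    intro v
    rw [Matrix.mulVec, dotProduct_comm, dotProduct, P.sum_latVec_mul hb]
  rw [dotProduct, P.sum_latVec_mul hb]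
  simp only [hB, Fin.sum_univ_three, P.invMat_end_end, P.invMat_none_none, P.invMat_none_end,
    P.invMat_end_none, P.invMat_end_end_ne hb (show (0 : Fin 3) ≠ 1 by decide),
    P.invMat_end_end_ne hb (show (0 : Fin 3) ≠ 2 by decide),
    P.invMat_end_end_ne hb (show (1 : Fin 3) ≠ 0 by decide),
    P.invMat_end_end_ne hb (show (1 : Fin 3) ≠ 2 by decide),
    P.invMat_end_end_ne hb (show (2 : Fin 3) ≠ 0 by decide),
    P.invMat_end_end_ne hb (show (2 : Fin 3) ≠ 1 by decide), latN, pOver, pPair, pNum, Matrix.cons_val]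
  push_cast
  generalize ((u.2 0 : ℤ) : ℚ) = x at *
  generalize ((u.2 1 : ℤ) : ℚ) = y at *
  generalize ((u.2 2 : ℤ) : ℚ) = z at *
  linear_combination (norm := (field_simp; ring)) ((b 1 * b 2 : ℚ) / b 0 - P.h 0) * s0 +
    ((b 0 * b 2 : ℚ) / b 1 - P.h 1) * s1 + ((b 0 * b 1 : ℚ) / b 2 - P.h 2) * s2

theorem FhatProd_latVec (P : BrieskornPlumbing b) (hb : ∀ i, 0 < b i) {k x : P.Vertex → ℤ}
    (u : ℤ × (Fin 3 → ℤˣ))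
    (hx : ∀ v, P.latVec u v = 2 * P.plumbing.mat.mulVec x v + k v - P.plumbing.matU v) :
    P.plumbing.FhatProd k x = -(1 / 2) * latSign u * (2 * u.1 + 1).sign := by
  unfold Plumbing.FhatProd
  simp only [← hx]
  rw [Fintype.prod_option, Fintype.prod_sigma, P.deg_none hb]
  have h1 : ∀ i, ∏ r : Fin (P.leg i).length,
      Plumbing.Fhat (P.plumbing.deg (some ⟨i, r⟩)) (P.latVec u (some ⟨i, r⟩)) = -((u.2 i : ℤ) : ℚ) := by
    intro i
    rw [Finset.prod_eq_single (⟨(P.leg i).length - 1, Nat.sub_lt (P.leg_length_pos hb i) one_pos⟩ :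
      Fin (P.leg i).length)]
    · rw [P.deg_some]
      simp only [latVec]
      rw [if_pos (P.length_sub_add hb i), if_pos (P.length_sub_add hb i), Plumbing.Fhat_one_unit]
    · intro r _ hr
      have : (r : ℕ) + 1 ≠ (P.leg i).length := fun h => hr (Fin.ext (by simp; omega))
      rw [P.deg_some]
      simp [latVec, this, Plumbing.Fhat]
    · intro h
      exact absurd (Finset.mem_univ _) h
  simp only [h1]
  have h2 : P.latVec u none = 2 * u.1 + 1 := rfl
  rw [h2, Plumbing.Fhat_three_odd, latSign]
  simp only [Fin.prod_univ_three]
  push_cast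
  ring

/-- The support of the coefficients. -/
theorem exists_latVec_of_FhatProd_ne_zero (P : BrieskornPlumbing b) (hb : ∀ i, 0 < b i)
    {k x : P.Vertex → ℤ} (h : P.plumbing.FhatProd k x ≠ 0) :
    ∃ u, ∀ v, P.latVec u v = 2 * P.plumbing.mat.mulVec x v + k v - P.plumbing.matU v := by
  unfold Plumbing.FhatProd at h
  rw [Finset.prod_ne_zero_iff] at h
  obtain ⟨l, hl⟩ := Plumbing.Fhat_three_ne_zero (P.deg_none hb ▸ h none (Finset.mem_univ _))
  have h1 : ∀ (i : Fin 3) (r : Fin (P.leg i).length), (r : ℕ) + 1 = (P.leg i).length → ∃ η : ℤˣ,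
      2 * P.plumbing.mat.mulVec x (some ⟨i, r⟩) + k (some ⟨i, r⟩) - P.plumbing.matU (some ⟨i, r⟩) = η := by
    intro i r hr
    have h2 := h (some ⟨i, r⟩) (Finset.mem_univ _)
    rw [P.deg_some, if_pos hr] at h2
    simp only [Plumbing.Fhat] at h2
    split_ifs at h2 with h3
    · rcases h3 with h3 | h3
      · exact ⟨1, by simpa using h3⟩
      · exact ⟨-1, by simpa using h3⟩
    · exact absurd rfl h2
  choose η hη using fun i => h1 i ⟨(P.leg i).length - 1, Nat.sub_lt (P.leg_length_pos hb i) one_pos⟩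
    (P.length_sub_add hb i)
  refine ⟨(l, η), fun v => ?_⟩
  rcases v with _ | ⟨i, r⟩
  · exact hl.symm
  · simp only [latVec]
    split_ifs with hr
    · have : r = ⟨(P.leg i).length - 1, Nat.sub_lt (P.leg_length_pos hb i) one_pos⟩ :=
        Fin.ext (by simp; omega)
      rw [this, hη]
    · have h2 := h (some ⟨i, r⟩) (Finset.mem_univ _)
      rw [P.deg_some, if_neg hr] at h2
      simp only [Plumbing.Fhat] at h2
      split_ifs at h2 with h3
      · exact h3.symm
      · exact absurd rfl h2

/-- The reindexing of the two-variable series by the coordinates `(l, η)`. -/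
theorem exists_reindex (P : BrieskornPlumbing b) (hb : ∀ i, 0 < b i) {k : P.Vertex → ℤ}
    (hk : P.plumbing.IsSpinc k) : ∃ g : ℤ × (Fin 3 → ℤˣ) → (P.Vertex → ℤ), Function.Injective g ∧
      (∀ x ∉ Set.range g, ∀ t τ, P.plumbing.term k t τ x = 0) ∧
      ∀ u t τ, P.plumbing.term k t τ (g u) = qpow P.Delta τ * latTerm b t τ u := by
  have hM := P.mat_mul_invMat hb
  have hB := P.invMat_mul_mat hb
  choose g hg using fun u => P.plumbing.exists_mulVec_eq hM hk (P.latVec_parity hb u)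
  refine ⟨g, ?_, ?_, ?_⟩
  · intro u u' h
    refine P.latVec_injective hb (funext fun v => ?_)
    rw [hg u v, hg u' v, h]
  · intro x hx t τ
    have h0 : P.plumbing.FhatProd k x = 0 := by
      by_contra hne
      obtain ⟨u, hu⟩ := P.exists_latVec_of_FhatProd_ne_zero hb hne
      refine hx ⟨u, ?_⟩
      have h1 : P.plumbing.mat.mulVec (g u) = P.plumbing.mat.mulVec x := by
        funext v
        have := hu v
        have := hg u v
        omega
      have h2 := congrArg P.invMat.mulVec h1
      rwa [Matrix.mulVec_mulVec, Matrix.mulVec_mulVec, hB, Matrix.one_mulVec, Matrix.one_mulVec] at h2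
    simp [Plumbing.term, h0]
  · intro u t τ
    have hE : P.plumbing.tExp k (g u) = latE u := by
      rw [P.plumbing.tExp_eq k (g u) _ (hg u)]
      have := P.sum_latVec_mul hb u 1
      simp only [Pi.one_apply, mul_one] at this
      rw [this, latE]
    have hQ : P.plumbing.qExp k (g u) = P.Delta + (latN b u : ℚ) ^ 2 / (4 * pNum b) := by
      rw [P.plumbing.qExp_eq hM hB k (g u) _ (hg u), P.dotProduct_latVec hb, Delta]
      ring
    have hadd : ∀ r s : ℚ, qpow (r + s) τ = qpow r τ * qpow s τ := by
      intro r s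
      simp only [qpow]
      rw [← Complex.exp_add]
      congr 1
      push_cast
      ring
    rw [Plumbing.term, P.FhatProd_latVec hb u (hg u), hE, hQ, hadd, latTerm]
    push_cast
    ring

end BrieskornPlumbing

section

/-! ### Arithmetic of the exponents, and convergence -/

variable {b : Fin 3 → ℕ}

theorem pNum_pos (hb : ∀ i, 2 ≤ b i) : 0 < pNum b := by
  have := hb 0; have := hb 1; have := hb 2
  unfold pNum; positivity

/-- The residue class of `latN` modulo `2p` determines the three signs. -/
theorem latN_modEq_iff (hb : ∀ i, 2 ≤ b i) (hcop : Pairwise fun i i' => Nat.Coprime (b i) (b i'))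
    (u u' : ℤ × (Fin 3 → ℤˣ)) : latN b u ≡ latN b u' [ZMOD 2 * pNum b] ↔ u.2 = u'.2 := by
  constructor
  · intro h
    obtain ⟨m, hm⟩ := h.symm.dvd
    have hδ : ∀ i, ∃ δ : ℤ, (u.2 i : ℤ) - u'.2 i = 2 * δ ∧ |δ| ≤ 1 := by
      intro i
      rcases Int.units_eq_one_or (u.2 i) with h | h <;> rcases Int.units_eq_one_or (u'.2 i) with h' | h' <;>
        rw [h, h']
      exacts [⟨0, by simp⟩, ⟨1, by norm_num⟩, ⟨-1, by norm_num⟩, ⟨0, by simp⟩]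
    choose δ hδ1 hδ2 using hδ
    have hsum : ∑ i, δ i * pOver b i = pNum b * (m - u.1 + u'.1) := by
      simp only [latN, Fin.sum_univ_three] at hm ⊢
      have e0 := hδ1 0
      have e1 := hδ1 1
      have e2 := hδ1 2
      have : 2 * (δ 0 * pOver b 0 + δ 1 * pOver b 1 + δ 2 * pOver b 2) = 2 * (pNum b * (m - u.1 + u'.1)) := by
        linear_combination hm - pOver b 0 * e0 - pOver b 1 * e1 - pOver b 2 * e2
      linarith
    funext i
    -- reduction modulo `bᵢ` leaves only the term of `i`
    have hd : (b i : ℤ) ∣ δ i * pOver b i := by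
      have h1 : (b i : ℤ) ∣ ∑ j ∈ Finset.univ.erase i, δ j * pOver b j := by
        refine Finset.dvd_sum fun j hj => Dvd.dvd.mul_left ?_ _
        rw [← pPair_mul' b (Finset.ne_of_mem_erase hj)]
        exact dvd_mul_left _ _
      rw [← Finset.add_sum_erase _ _ (Finset.mem_univ i), ← pOver_mul b i] at hsum
      refine (dvd_add_left h1).mp ?_
      rw [hsum]
      exact ⟨pOver b i * (m - u.1 + u'.1), by ring⟩
    have hd' : (b i : ℤ) ∣ δ i := (isCoprime_pOver hcop i).dvd_of_dvd_mul_right hd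
    have h0 : δ i = 0 := by
      refine Int.eq_zero_of_abs_lt_dvd hd' ((hδ2 i).trans_lt ?_)
      have := hb i
      omega
    have := hδ1 i
    rw [h0] at this
    exact Units.ext (by linarith)
  · intro h
    refine Int.modEq_iff_dvd.mpr ⟨u'.1 - u.1, ?_⟩
    rw [latN, latN, h]
    ring

theorem latN_injective (hb : ∀ i, 2 ≤ b i) (hcop : Pairwise fun i i' => Nat.Coprime (b i) (b i')) :
    Function.Injective (latN b) := by
  intro u u' h
  have h2 := (latN_modEq_iff hb hcop u u').mp (h ▸ Int.ModEq.refl _)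
  refine Prod.ext ?_ h2
  rw [latN, latN, h2] at h
  have hp : (pNum b : ℤ) ≠ 0 := by have := pNum_pos hb; omega
  have := mul_left_cancel₀ hp (add_right_cancel h)
  omega

/-- The involution `(l, η) ↦ (-l - 1, -η)` of the index set, which changes the sign of `latN`. -/
def latNeg (u : ℤ × (Fin 3 → ℤˣ)) : ℤ × (Fin 3 → ℤˣ) := (-u.1 - 1, fun i => -u.2 i)

theorem latN_latNeg (u : ℤ × (Fin 3 → ℤˣ)) : latN b (latNeg u) = -latN b u := by
  simp only [latN, latNeg, Fin.sum_univ_three]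
  push_cast
  ring

theorem latE_latNeg (u : ℤ × (Fin 3 → ℤˣ)) : latE (latNeg u) = -latE u := by
  have h1 := two_mul_latE u
  have h2 := two_mul_latE (latNeg u)
  simp only [latNeg, Fin.sum_univ_three] at h1 h2 ⊢
  push_cast at h2
  linarith

theorem latSign_latNeg (u : ℤ × (Fin 3 → ℤˣ)) : latSign (latNeg u) = -latSign u := by
  simp only [latSign, latNeg, Fin.prod_univ_three]
  push_cast
  ring

theorem latN_ne_zero (hb : ∀ i, 2 ≤ b i) (hcop : Pairwise fun i i' => Nat.Coprime (b i) (b i'))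
    (u : ℤ × (Fin 3 → ℤˣ)) : latN b u ≠ 0 := by
  intro h
  have h1 : latN b (latNeg u) = latN b u := by rw [latN_latNeg, h, neg_zero]
  have h2 := congrArg Prod.fst (latN_injective hb hcop h1)
  simp only [latNeg] at h2
  omega

theorem abs_latE_le (hb : ∀ i, 2 ≤ b i) (u : ℤ × (Fin 3 → ℤˣ)) : |latE u| ≤ |latN b u| + 3 := by
  have hp := pNum_pos hb
  have hη : ∀ i, |(u.2 i : ℤ)| = 1 := fun i => by
    rcases Int.units_eq_one_or (u.2 i) with h | h <;> simp [h]
  have h1 := two_mul_latE u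
  have hP : ∀ i, |(u.2 i : ℤ) * pOver b i| ≤ pNum b := by
    intro i
    rw [abs_mul, hη, one_mul, ← pOver_mul b i]
    have h0 : 0 ≤ pOver b i := by
      fin_cases i <;> simp [pOver] <;> positivity
    rw [abs_of_nonneg h0]
    have : (1 : ℤ) ≤ b i := by have := hb i; omega
    nlinarith
  have h2 : pNum b * |2 * u.1 + 1| ≤ |latN b u| + 3 * pNum b := by
    have e : (pNum b : ℤ) * (2 * u.1 + 1) = latN b u - ∑ i, (u.2 i : ℤ) * pOver b i := by rw [latN]; ring
    rw [← abs_of_pos (show (0 : ℤ) < pNum b by omega), ← abs_mul, e, abs_of_pos (show (0 : ℤ) < pNum b by omega)]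
    refine (abs_sub _ _).trans (add_le_add_right ?_ _)
    rw [Fin.sum_univ_three]
    have := abs_add_three ((u.2 0 : ℤ) * pOver b 0) (u.2 1 * pOver b 1) (u.2 2 * pOver b 2)
    have := hP 0
    have := hP 1
    have := hP 2
    linarith
  have h3 : |2 * u.1 + 1| ≤ |latN b u| + 3 := by
    by_contra hcon
    have hp' : (1 : ℤ) ≤ pNum b := by omega
    have := abs_nonneg (latN b u)
    nlinarith [not_le.mp hcon]
  rw [Fin.sum_univ_three] at h1
  have a0 := abs_le.mp (hη 0).le
  have a1 := abs_le.mp (hη 1).le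
  have a2 := abs_le.mp (hη 2).le
  have h4 := abs_le.mp h3
  have := abs_nonneg (latN b u)
  rw [abs_le]
  constructor <;> linarith [h4.1, h4.2, a0.1, a0.2, a1.1, a1.2, a2.1, a2.2]

theorem norm_qpow_sq (p : ℕ) (n : ℤ) (τ : ℂ) :
    ‖qpow ((n : ℚ) ^ 2 / (4 * p)) τ‖ = Real.exp (-(2 * Real.pi * τ.im / (4 * p)) * (n : ℝ) ^ 2) := by
  rw [qpow, Complex.norm_exp]
  congr 1
  have : (2 * Real.pi * Complex.I * (((n : ℚ) ^ 2 / (4 * p) : ℚ) : ℂ) * τ) =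
      ((2 * Real.pi * ((n : ℝ) ^ 2 / (4 * p)) : ℝ) : ℂ) * (Complex.I * τ) := by
    push_cast
    ring
  rw [this, Complex.re_ofReal_mul]
  simp
  ring

/-- On every annulus around the origin the summands are dominated by a convergent series: by
`|N| L ≤ L² / 2a + a N² / 2` the Gaussian factor `exp (-a N²)` absorbs the powers of `t`. -/
theorem exists_summable_bound_latTerm (hb : ∀ i, 2 ≤ b i)
    (hcop : Pairwise fun i i' => Nat.Coprime (b i) (b i')) {τ : ℂ} (hτ : 0 < τ.im) (L : ℝ) :
    ∃ F : ℤ × (Fin 3 → ℤˣ) → ℝ, Summable F ∧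
      ∀ t : ℂ, t ≠ 0 → |Real.log ‖t‖| ≤ L → ∀ u, ‖latTerm b t τ u‖ ≤ F u := by
  set a : ℝ := 2 * Real.pi * τ.im / (4 * pNum b) with ha
  have hp : (0 : ℝ) < pNum b := by exact_mod_cast pNum_pos hb
  have ha0 : 0 < a := by have := Real.pi_pos; positivity
  have hs := ((summable_pow_mul_exp_neg_sq (half_pos ha0) 0).mul_left
    (Real.exp (3 * L + L ^ 2 / (2 * a)))).comp_injective (latN_injective hb hcop)
  refine ⟨_, hs, fun t ht hL u => ?_⟩
  have hL0 : 0 ≤ L := (abs_nonneg _).trans hL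
  have h1 : ‖t ^ latE u‖ ≤ Real.exp ((|(latN b u : ℝ)| + 3) * L) := by
    have ht' : 0 < ‖t‖ := norm_pos_iff.mpr ht
    rw [norm_zpow, ← Real.exp_log (zpow_pos ht' _), Real.log_zpow, Real.exp_le_exp]
    refine (le_abs_self _).trans ?_
    rw [abs_mul]
    have h2 : |((latE u : ℤ) : ℝ)| ≤ |(latN b u : ℝ)| + 3 := by exact_mod_cast abs_latE_le hb u
    exact mul_le_mul h2 hL (abs_nonneg _) (by positivity)
  have h3 : ‖(-(1 / 2) * latSign u * (2 * u.1 + 1).sign : ℂ)‖ ≤ 1 := by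
    have e1 : |latSign u| = 1 := by
      rw [latSign, Finset.abs_prod]
      refine Finset.prod_eq_one fun i _ => ?_
      rcases Int.units_eq_one_or (u.2 i) with h | h <;> simp [h]
    have e2 : |(2 * u.1 + 1).sign| ≤ 1 := by
      rcases lt_trichotomy (2 * u.1 + 1) 0 with h | h | h
      · rw [Int.sign_eq_neg_one_of_neg h]; norm_num
      · rw [h]; norm_num
      · rw [Int.sign_eq_one_of_pos h]; norm_num
    have e1' : ‖(latSign u : ℂ)‖ = 1 := by rw [Complex.norm_intCast]; exact_mod_cast e1
    have e2' : ‖((2 * u.1 + 1).sign : ℂ)‖ ≤ 1 := by rw [Complex.norm_intCast]; exact_mod_cast e2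
    rw [norm_mul, norm_mul, e1', mul_one]
    have e3 : ‖(-(1 / 2) : ℂ)‖ = 1 / 2 := by norm_num
    rw [e3]
    linarith
  rw [latTerm, norm_mul, norm_mul, norm_qpow_sq, ← ha]
  simp only [Function.comp, pow_zero, one_mul]
  have h4 : Real.exp (-a * (latN b u : ℝ) ^ 2) * Real.exp ((|(latN b u : ℝ)| + 3) * L) ≤
      Real.exp (3 * L + L ^ 2 / (2 * a)) * Real.exp (-(a / 2) * (latN b u : ℝ) ^ 2) := by
    rw [← Real.exp_add, ← Real.exp_add, Real.exp_le_exp]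
    have e : |(latN b u : ℝ)| * L ≤ L ^ 2 / (2 * a) + a / 2 * (latN b u : ℝ) ^ 2 := by
      rw [← sq_abs (latN b u : ℝ)]
      have : L ^ 2 / (2 * a) + a / 2 * |(latN b u : ℝ)| ^ 2 - |(latN b u : ℝ)| * L =
          (L - a * |(latN b u : ℝ)|) ^ 2 / (2 * a) := by field_simp; ring
      have h5 : 0 ≤ (L - a * |(latN b u : ℝ)|) ^ 2 / (2 * a) := by positivity
      linarith
    linarith
  calc _ ≤ 1 * Real.exp (-a * (latN b u : ℝ) ^ 2) * Real.exp ((|(latN b u : ℝ)| + 3) * L) := by gcongr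
    _ ≤ _ := by rw [one_mul]; exact h4

theorem summable_latTerm (hb : ∀ i, 2 ≤ b i) (hcop : Pairwise fun i i' => Nat.Coprime (b i) (b i'))
    {τ : ℂ} (hτ : 0 < τ.im) {t : ℂ} (ht : t ≠ 0) : Summable (latTerm b t τ) := by
  obtain ⟨F, hF, h⟩ := exists_summable_bound_latTerm hb hcop hτ |Real.log ‖t‖|
  exact Summable.of_norm_bounded hF (h t ht le_rfl)

theorem hasDerivAt_latTerm (τ : ℂ) (u : ℤ × (Fin 3 → ℤˣ)) {t : ℂ} (ht : t ≠ 0) :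
    HasDerivAt (fun t => latTerm b t τ u) (latE u * latTerm b t τ u / t) t := by
  have h := (hasDerivAt_zpow (latE u) t (Or.inl ht)).const_mul
    (-(1 / 2) * latSign u * (2 * u.1 + 1).sign * qpow ((latN b u : ℚ) ^ 2 / (4 * pNum b)) τ)
  refine h.congr_deriv ?_
  simp only [latTerm]
  rw [zpow_sub_one₀ ht]
  field_simp

/-- The series may be differentiated summand by summand on the annulus `1/2 < |t| < 2`. -/
theorem hasSum_deriv_latTerm (hb : ∀ i, 2 ≤ b i)
    (hcop : Pairwise fun i i' => Nat.Coprime (b i) (b i')) {τ : ℂ} (hτ : 0 < τ.im) {t : ℂ} (ht : ‖t‖ = 1) :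
    DifferentiableAt ℂ (fun t => ∑' u, latTerm b t τ u) t ∧
      HasSum (fun u => latE u * latTerm b t τ u) (t * deriv (fun t => ∑' u, latTerm b t τ u) t) := by
  obtain ⟨F, hF, h⟩ := exists_summable_bound_latTerm hb hcop hτ (Real.log 2)
  set U : Set ℂ := {z | 1 / 2 < ‖z‖} ∩ {z | ‖z‖ < 2} with hU
  have hUo : IsOpen U := (isOpen_lt continuous_const continuous_norm).inter
    (isOpen_lt continuous_norm continuous_const)
  have hU0 : ∀ z ∈ U, z ≠ 0 := by
    rintro z ⟨hz, -⟩ rfl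
    simp at hz
    linarith
  have htU : t ∈ U := by
    constructor <;> simp only [Set.mem_ofPred_eq, ht] <;> norm_num
  have hbd : ∀ u, ∀ z ∈ U, ‖latTerm b z τ u‖ ≤ F u := by
    intro u z hz
    refine h z (hU0 z hz) ?_ u
    have hz0 : 0 < ‖z‖ := norm_pos_iff.mpr (hU0 z hz)
    have h1 : (1 / 2 : ℝ) < ‖z‖ := hz.1
    have h2 : ‖z‖ < 2 := hz.2
    rw [abs_le]
    constructor
    · rw [← Real.log_inv]
      exact Real.log_le_log (by norm_num) (by norm_num at h1 ⊢; linarith)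
    · exact Real.log_le_log hz0 h2.le
  have hdiff : ∀ u, DifferentiableOn ℂ (fun z => latTerm b z τ u) U := fun u z hz =>
    (hasDerivAt_latTerm τ u (hU0 z hz)).differentiableAt.differentiableWithinAt
  have h1 := (differentiableOn_tsum_of_summable_norm hF hdiff hUo hbd).differentiableAt (hUo.mem_nhds htU)
  have h2 := (hasSum_deriv_of_summable_norm hF hdiff hUo hbd htU).mul_left t
  refine ⟨h1, ?_⟩
  refine h2.congr_fun fun u => ?_
  rw [(hasDerivAt_latTerm τ u (hU0 t htU)).deriv, mul_div_cancel₀ _ (hU0 t htU)]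

/-! ### The coefficients of the false theta series -/

theorem tSum_two_mul (hb : ∀ i, 2 ≤ b i) (m : ℤ) (t : ℂ) :
    tSum b (2 * pNum b * m) t = t ^ m + t ^ (-m) := by
  have hp : (2 * pNum b : ℤ) ≠ 0 := by have := pNum_pos hb; omega
  rw [tSum, Int.mul_ediv_cancel_left _ hp]

theorem exists_latN_eq_of_modEq {n : ℤ} {u : ℤ × (Fin 3 → ℤˣ)}
    (h : n ≡ latN b u [ZMOD 2 * pNum b]) : n ∈ Set.range (latN b) := by
  obtain ⟨m, hm⟩ := h.symm.dvd
  refine ⟨(u.1 + m, u.2), ?_⟩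
  rw [latN] at hm ⊢
  linear_combination -hm

/-- The residue classes `±αᵢ` modulo `2p` correspond to the eight choices of the signs `η`. -/
theorem alpha_eq_latN (b : Fin 3 → ℕ) : alpha b 0 = latN b (0, ![-1, -1, -1]) ∧
    -alpha b 0 = latN b (-1, ![1, 1, 1]) ∧ alpha b 1 = latN b (0, ![-1, -1, 1]) ∧
    -alpha b 1 = latN b (-1, ![1, 1, -1]) ∧ alpha b 2 = latN b (0, ![-1, 1, -1]) ∧
    -alpha b 2 = latN b (-1, ![1, -1, 1]) ∧ alpha b 3 = latN b (0, ![-1, 1, 1]) ∧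
    -alpha b 3 = latN b (-1, ![1, -1, -1]) := by
  refine ⟨?_, ?_, ?_, ?_, ?_, ?_, ?_, ?_⟩ <;>
    simp [alpha, latN, pNum, pOver, Fin.sum_univ_three] <;> ring

theorem phi_eq_zero {n : ℤ} (hn : n ∉ Set.range (latN b)) (t : ℂ) : phi b n t = 0 := by
  have h : ∀ u, ¬ n ≡ latN b u [ZMOD 2 * pNum b] := fun u hu => hn (exists_latN_eq_of_modEq hu)
  obtain ⟨a0, a0', a1, a1', a2, a2', a3, a3'⟩ := alpha_eq_latN b
  unfold phi
  rw [a0', a1', a2', a3']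
  simp only [a0, a1, a2, a3, h, if_false]

/-- The coefficient `φ(N; t)` in the coordinates `(l, η)`; the shifts by `β` in its definition produce
exactly the exponents `± latE`. -/
theorem phi_latN (hb : ∀ i, 2 ≤ b i) (hcop : Pairwise fun i i' => Nat.Coprime (b i) (b i'))
    (u : ℤ × (Fin 3 → ℤˣ)) (t : ℂ) :
    phi b (latN b u) t = 1 / 2 * latSign u * (t ^ latE u + t ^ (-latE u)) := by
  obtain ⟨a0, a0', a1, a1', a2, a2', a3, a3'⟩ := alpha_eq_latN b
  have hE := two_mul_latE u
  obtain ⟨l, η⟩ := u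
  have hη : η = ![η 0, η 1, η 2] := by
    funext i; fin_cases i <;> rfl
  have hm : ∀ m n : ℤ, n = 2 * pNum b * m → tSum b n t = t ^ m + t ^ (-m) := by
    rintro m n rfl
    rw [tSum_two_mul hb]
  unfold phi
  rw [a0', a1', a2', a3']
  simp only [a0, a1, a2, a3, latN_modEq_iff hb hcop]
  rw [hη] at hE ⊢
  rcases Int.units_eq_one_or (η 0) with h0 | h0 <;> rcases Int.units_eq_one_or (η 1) with h1 | h1 <;>
    rcases Int.units_eq_one_or (η 2) with h2 | h2 <;> rw [h0, h1, h2] at hE ⊢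
  all_goals
    simp only [Fin.sum_univ_three, Matrix.cons_val] at hE
    push_cast at hE
    repeat rw [if_neg (by decide)]
    rw [if_pos rfl, hm (latE _) _ (by
      simp only [latN, beta, alpha, pNum, pOver, Fin.sum_univ_three, Matrix.cons_val]
      push_cast
      linear_combination -(b 0 * b 1 * b 2 : ℤ) * hE)]
    simp [latSign, Fin.prod_univ_three]

theorem phiDeriv_eq_zero {n : ℤ} (hn : n ∉ Set.range (latN b)) (t : ℂ) : phiDeriv b n t = 0 := by
  simp [phiDeriv, phi_eq_zero hn]

theorem phiDeriv_latN (hb : ∀ i, 2 ≤ b i) (hcop : Pairwise fun i i' => Nat.Coprime (b i) (b i'))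
    (u : ℤ × (Fin 3 → ℤˣ)) {t : ℂ} (ht : t ≠ 0) :
    phiDeriv b (latN b u) t = 1 / 2 * latSign u * latE u * (t ^ latE u - t ^ (-latE u)) := by
  have h := (((hasDerivAt_zpow (latE u) t (Or.inl ht)).add
    (hasDerivAt_zpow (-latE u) t (Or.inl ht))).const_mul (1 / 2 * latSign u : ℂ)).deriv
  simp only [phiDeriv, phi_latN hb hcop]
  have h' : deriv (fun t : ℂ => 1 / 2 * (latSign u : ℂ) * (t ^ latE u + t ^ (-latE u))) t = _ := h
  rw [h', zpow_sub_one₀ ht, zpow_sub_one₀ ht]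
  push_cast
  field_simp
  ring

theorem latN_poincare (h0 : b 0 = 2) (h1 : b 1 = 3) (h2 : b 2 = 5) :
    latN b (-1, fun _ => 1) = 1 := by
  simp [latN, pNum, pOver, Fin.sum_univ_three, h0, h1, h2]

/-- A negative index `l` with `latN > 0` occurs for `Σ(2, 3, 5)` only: it requires
`1 / b₀ + 1 / b₁ + 1 / b₂ > 1`. -/
theorem eq_poincare_of_latN_pos (hb : 2 ≤ b 0) (hlt : StrictMono b)
    (hcop : Pairwise fun i i' => Nat.Coprime (b i) (b i')) {u : ℤ × (Fin 3 → ℤˣ)}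
    (hu : 2 * u.1 + 1 < 0) (hN : 0 < latN b u) :
    (b 0 = 2 ∧ b 1 = 3 ∧ b 2 = 5) ∧ u = (-1, fun _ => 1) := by
  have h01 : b 0 < b 1 := hlt (by decide)
  have h12 : b 1 < b 2 := hlt (by decide)
  have hη : ∀ i, (u.2 i : ℤ) ≤ 1 := fun i => by
    rcases Int.units_eq_one_or (u.2 i) with h | h <;> simp [h]
  have e0 := hη 0
  have e1 := hη 1
  have e2 := hη 2
  have hbig : ((b 0 * b 1 * b 2 : ℕ) : ℤ) < (b 1 * b 2 + b 0 * b 2 + b 0 * b 1 : ℕ) := by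
    simp only [latN, pNum, pOver, Fin.sum_univ_three, Matrix.cons_val] at hN
    have p0 : (0 : ℤ) ≤ b 1 * b 2 := by positivity
    have p1 : (0 : ℤ) ≤ b 0 * b 2 := by positivity
    have p2 : (0 : ℤ) ≤ b 0 * b 1 := by positivity
    have p3 : (0 : ℤ) ≤ b 0 * b 1 * b 2 := by positivity
    push_cast at hN ⊢
    have q0 := mul_le_mul_of_nonneg_right e0 p0
    have q1 := mul_le_mul_of_nonneg_right e1 p1
    have q2 := mul_le_mul_of_nonneg_right e2 p2
    have q3 := mul_le_mul_of_nonneg_left (show 2 * u.1 + 1 ≤ -1 by omega) p3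
    linarith
  have hbig' : b 0 * b 1 * b 2 < b 1 * b 2 + b 0 * b 2 + b 0 * b 1 := by exact_mod_cast hbig
  have hb0 : b 0 = 2 := by
    by_contra hne
    have h3 : 3 ≤ b 0 := by omega
    have : 3 * (b 1 * b 2) ≤ b 0 * b 1 * b 2 := by rw [mul_assoc]; exact Nat.mul_le_mul_right _ h3
    have : b 0 * b 2 ≤ b 1 * b 2 := Nat.mul_le_mul_right _ h01.le
    have : b 0 * b 1 ≤ b 1 * b 2 := by rw [mul_comm]; exact Nat.mul_le_mul_left _ (h01.trans h12).le
    omega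
  have hc1 : Nat.Coprime 2 (b 1) := by
    have : Nat.Coprime (b 0) (b 1) := hcop (by decide)
    rwa [hb0] at this
  have hc2 : Nat.Coprime 2 (b 2) := by
    have : Nat.Coprime (b 0) (b 2) := hcop (by decide)
    rwa [hb0] at this
  rw [Nat.coprime_two_left, Nat.odd_iff] at hc1 hc2
  rw [hb0] at hbig'
  have hb1 : b 1 = 3 := by
    by_contra hne
    have h4 : 4 < b 1 := by omega
    nlinarith
  have hb2 : b 2 = 5 := by
    rw [hb1] at hbig'
    omega
  refine ⟨⟨hb0, hb1, hb2⟩, ?_⟩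
  simp only [latN, pNum, pOver, Fin.sum_univ_three, Matrix.cons_val, hb0, hb1, hb2] at hN
  push_cast at hN
  obtain ⟨l, η⟩ := u
  simp only at *
  have hu0 : ∀ i, (η i : ℤ) = 1 ∨ (η i : ℤ) = -1 := fun i => by
    rcases Int.units_eq_one_or (η i) with h | h <;> simp [h]
  have h0 := hu0 0
  have h1 := hu0 1
  have h2 := hu0 2
  refine Prod.ext (by simp only; omega) (funext fun i => Units.ext ?_)
  push_cast
  fin_cases i
  · change (η 0 : ℤ) = 1; omega
  · change (η 1 : ℤ) = 1; omega
  · change (η 2 : ℤ) = 1; omega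

/-! ### The derivative at a root of unity -/

theorem latTerm_latNeg (t τ : ℂ) (u : ℤ × (Fin 3 → ℤˣ)) : latTerm b t τ (latNeg u) =
    -(1 / 2) * latSign u * (2 * u.1 + 1).sign * qpow ((latN b u : ℚ) ^ 2 / (4 * pNum b)) τ *
      t ^ (-latE u) := by
  have h : 2 * (latNeg u).1 + 1 = -(2 * u.1 + 1) := by simp only [latNeg]; ring
  rw [latTerm, latN_latNeg, latE_latNeg, latSign_latNeg, h, Int.sign_neg]
  push_cast
  rw [neg_sq]
  ring

/-- Adding up the contributions of `n` and `-n`. The sign of `2l + 1` is that of `latN`, up to the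
exceptional index of the Poincaré sphere. -/
theorem hasSum_phiDeriv (hb : 2 ≤ b 0) (hlt : StrictMono b)
    (hcop : Pairwise fun i i' => Nat.Coprime (b i) (b i')) {ζ : ℂ} (hζ : ζ ≠ 0) {τ S : ℂ}
    (hS : HasSum (fun u => latE u * latTerm b ζ τ u) S) :
    HasSum (fun n : ℕ => phiDeriv b n ζ * qpow ((n : ℚ) ^ 2 / (4 * pNum b)) τ) (CDeriv b ζ τ - S) := by
  have hb' : ∀ i, 2 ≤ b i := fun i => hb.trans (hlt.monotone (Fin.zero_le i))
  have hinj := latN_injective hb' hcop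
  set h : ℤ × (Fin 3 → ℤˣ) → ℂ := fun u => latE u * latTerm b ζ τ u with hh
  -- the sum over `(l, η)` as a sum over all integers `n = latN b (l, η)`
  set G : ℤ → ℂ := Function.extend (latN b) h 0 with hG
  have hG1 : ∀ u, G (latN b u) = h u := fun u => hinj.extend_apply _ _ u
  have hG0 : ∀ n ∉ Set.range (latN b), G n = 0 := fun n hn => by
    rw [hG, Function.extend_apply' _ _ _ hn]
    rfl
  have h0 : (0 : ℤ) ∉ Set.range (latN b) := by
    rintro ⟨u, hu⟩
    exact latN_ne_zero hb' hcop u hu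
  have hC : ∀ u : ℤ × (Fin 3 → ℤˣ), u ≠ (-1, fun _ => 1) → latN b u = 1 → CDeriv b ζ τ = 0 := by
    intro u hu hu1
    rw [CDeriv, if_neg]
    rintro ⟨e0, e1, e2⟩
    exact hu (hinj (hu1.trans (latN_poincare e0 e1 e2).symm))
  have hpair : ∀ n : ℕ, G n + G (-n) = -(phiDeriv b n ζ * qpow ((n : ℚ) ^ 2 / (4 * pNum b)) τ) +
      if n = 1 then CDeriv b ζ τ else 0 := by
    intro n
    by_cases hn : (n : ℤ) ∈ Set.range (latN b)
    · obtain ⟨u, hu⟩ := hn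
      have hu' : (latN b u : ℚ) = n := by rw [hu]; simp
      rw [← hu, phiDeriv_latN hb' hcop u hζ, ← latN_latNeg, hG1, hG1]
      simp only [hh, latTerm_latNeg, latE_latNeg]
      simp only [latTerm]
      rw [hu']
      rcases lt_or_gt_of_ne (show 2 * u.1 + 1 ≠ 0 by omega) with hl | hl
      · have hpos : 0 < latN b u := by
          have := latN_ne_zero hb' hcop u
          omega
        obtain ⟨⟨e0, e1, e2⟩, rfl⟩ := eq_poincare_of_latN_pos hb hlt hcop hl hpos
        have hn1 : n = 1 := by
          have := latN_poincare e0 e1 e2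
          omega
        have hE : latE (-1, fun _ => 1) = 1 := by simp [latE]
        have hs : latSign (-1, fun _ => 1) = 1 := by simp [latSign]
        rw [if_pos hn1, CDeriv, if_pos ⟨e0, e1, e2⟩, hE, hs, hn1, pNum, e0, e1, e2]
        norm_num
        ring
      · have : (if n = 1 then CDeriv b ζ τ else 0) = 0 := by
          split_ifs with h1
          · refine hC u ?_ (by omega)
            rintro rfl
            simp at hl
          · rfl
        rw [this, Int.sign_eq_one_of_pos hl]
        push_cast
        ring
    · have hn' : -(n : ℤ) ∉ Set.range (latN b) := by
        rintro ⟨u, hu⟩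
        exact hn ⟨latNeg u, by rw [latN_latNeg, hu, neg_neg]⟩
      have : (if n = 1 then CDeriv b ζ τ else 0) = 0 := by
        split_ifs with h1
        · rw [CDeriv, if_neg]
          rintro ⟨e0, e1, e2⟩
          exact hn ⟨_, by rw [latN_poincare e0 e1 e2, h1]; rfl⟩
        · rfl
      rw [hG0 _ hn, hG0 _ hn', phiDeriv_eq_zero hn, this]
      ring
  have h1 := ((hasSum_extend_zero hinj).mpr hS).nat_add_neg
  -- the pairing of `n` and `-n` counts `0` twice, but `G 0 = 0`
  rw [← hG, hG0 0 h0, add_zero] at h1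
  have h2 := (hasSum_ite_eq 1 (CDeriv b ζ τ)).sub h1
  refine h2.congr_fun fun n => ?_
  rw [hpair]
  ring

/-- The even function `ψ` in the decomposition `φ'(n) = n ψ(n) + χ(n)`, which comes from
`2p latE = latN + ∑ ηᵢ (p - p / bᵢ)`. It vanishes off the residue classes `±αᵢ`. -/
def psiFun (b : Fin 3 → ℕ) (ζ : ℂ) : ℤ → ℂ :=
  Function.extend (latN b) (fun u => latSign u * (ζ ^ latE u - ζ ^ (-latE u)) / (4 * pNum b)) 0

/-- The odd function `χ` in the decomposition `φ'(n) = n ψ(n) + χ(n)`. -/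
def chiFun (b : Fin 3 → ℕ) (ζ : ℂ) : ℤ → ℂ :=
  Function.extend (latN b) (fun u => (∑ i, (u.2 i : ℤ) * (pNum b - pOver b i) : ℤ) *
    (latSign u * (ζ ^ latE u - ζ ^ (-latE u)) / (4 * pNum b))) 0

theorem extend_latN_neg (hinj : Function.Injective (latN b)) {f : ℤ × (Fin 3 → ℤˣ) → ℂ} {c : ℂ}
    (hf : ∀ u, f (latNeg u) = c * f u) (n : ℤ) :
    Function.extend (latN b) f 0 (-n) = c * Function.extend (latN b) f 0 n := by
  by_cases hn : n ∈ Set.range (latN b)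
  · obtain ⟨u, rfl⟩ := hn
    rw [← latN_latNeg, hinj.extend_apply, hinj.extend_apply, hf]
  · have hn' : -n ∉ Set.range (latN b) := by
      rintro ⟨u, hu⟩
      exact hn ⟨latNeg u, by rw [latN_latNeg, hu, neg_neg]⟩
    rw [Function.extend_apply' _ _ _ hn, Function.extend_apply' _ _ _ hn']
    simp

theorem extend_latN_periodic (hinj : Function.Injective (latN b)) {f : ℤ × (Fin 3 → ℤˣ) → ℂ} {j : ℤ}
    (hf : ∀ u : ℤ × (Fin 3 → ℤˣ), f (u.1 + j, u.2) = f u) :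
    Function.Periodic (Function.extend (latN b) f 0) (2 * pNum b * j) := by
  have hN : ∀ (u : ℤ × (Fin 3 → ℤˣ)) (m : ℤ), latN b u + 2 * pNum b * m = latN b (u.1 + m, u.2) := by
    intro u m
    simp only [latN]
    ring
  intro n
  by_cases hn : n ∈ Set.range (latN b)
  · obtain ⟨u, rfl⟩ := hn
    rw [hN, hinj.extend_apply, hinj.extend_apply, hf]
  · have hn' : n + 2 * pNum b * j ∉ Set.range (latN b) := by
      rintro ⟨u, hu⟩
      refine hn ⟨(u.1 + -j, u.2), ?_⟩
      rw [← hN, hu]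
      ring
    rw [Function.extend_apply' _ _ _ hn, Function.extend_apply' _ _ _ hn']
    rfl

theorem latE_add (u : ℤ × (Fin 3 → ℤˣ)) (j : ℤ) : latE (u.1 + j, u.2) = latE u + j := by
  have h1 := two_mul_latE u
  have h2 := two_mul_latE (u.1 + j, u.2)
  simp only at h2
  linarith

theorem psiFun_even (hinj : Function.Injective (latN b)) (ζ : ℂ) : Function.Even (psiFun b ζ) := by
  intro n
  have h := extend_latN_neg hinj (c := 1)
    (f := fun u => latSign u * (ζ ^ latE u - ζ ^ (-latE u)) / (4 * pNum b)) (fun u => by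
      rw [latE_latNeg, latSign_latNeg, neg_neg]
      push_cast
      ring) n
  rwa [one_mul] at h

theorem chiFun_odd (hinj : Function.Injective (latN b)) (ζ : ℂ) : Function.Odd (chiFun b ζ) := by
  intro n
  have h := extend_latN_neg hinj (c := -1)
    (f := fun u => (∑ i, (u.2 i : ℤ) * (pNum b - pOver b i) : ℤ) *
      (latSign u * (ζ ^ latE u - ζ ^ (-latE u)) / (4 * pNum b))) (fun u => by
      rw [latE_latNeg, latSign_latNeg, neg_neg]
      simp only [latNeg, Fin.sum_univ_three]
      push_cast
      ring) n
  rwa [neg_one_mul] at h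

theorem zpow_latE_add {ζ : ℂ} {j : ℕ} (hj : 0 < j) (hζ : ζ ^ j = 1) (u : ℤ × (Fin 3 → ℤˣ)) :
    ζ ^ latE (u.1 + j, u.2) = ζ ^ latE u ∧ ζ ^ (-latE (u.1 + j, u.2)) = ζ ^ (-latE u) := by
  have h0 : ζ ≠ 0 := by
    rintro rfl
    rw [zero_pow hj.ne'] at hζ
    exact zero_ne_one hζ
  have h1 : ζ ^ latE (u.1 + j, u.2) = ζ ^ latE u := by
    rw [latE_add, zpow_add₀ h0, zpow_natCast, hζ, mul_one]
  refine ⟨h1, ?_⟩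
  rw [zpow_neg, zpow_neg, h1]

theorem psiFun_periodic (hinj : Function.Injective (latN b)) {ζ : ℂ} {j : ℕ} (hj : 0 < j)
    (hζ : ζ ^ j = 1) : Function.Periodic (psiFun b ζ) (2 * pNum b * j) :=
  extend_latN_periodic hinj fun u => by
    rw [(zpow_latE_add hj hζ u).1, (zpow_latE_add hj hζ u).2]
    rfl

theorem chiFun_periodic (hinj : Function.Injective (latN b)) {ζ : ℂ} {j : ℕ} (hj : 0 < j)
    (hζ : ζ ^ j = 1) : Function.Periodic (chiFun b ζ) (2 * pNum b * j) :=
  extend_latN_periodic hinj fun u => by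
    rw [(zpow_latE_add hj hζ u).1, (zpow_latE_add hj hζ u).2]
    rfl

theorem psiFun_zero (hb : ∀ i, 2 ≤ b i) (hcop : Pairwise fun i i' => Nat.Coprime (b i) (b i')) (ζ : ℂ) :
    psiFun b ζ 0 = 0 := by
  rw [psiFun, Function.extend_apply']
  · rfl
  · rintro ⟨u, hu⟩
    exact latN_ne_zero hb hcop u hu

theorem phiDeriv_eq_chiFun_add (hb : ∀ i, 2 ≤ b i)
    (hcop : Pairwise fun i i' => Nat.Coprime (b i) (b i')) {ζ : ℂ} (hζ : ζ ≠ 0) (n : ℤ) :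
    phiDeriv b n ζ = chiFun b ζ n + n * psiFun b ζ n := by
  have hinj := latN_injective hb hcop
  by_cases hn : n ∈ Set.range (latN b)
  · obtain ⟨u, rfl⟩ := hn
    have hp : (pNum b : ℂ) ≠ 0 := by exact_mod_cast (pNum_pos hb).ne'
    have hE : (2 * pNum b * latE u : ℂ) =
        (∑ i, (u.2 i : ℤ) * (pNum b - pOver b i) : ℤ) + latN b u := by
      have := two_mul_latE u
      have h1 : 2 * pNum b * latE u = (∑ i, (u.2 i : ℤ) * (pNum b - pOver b i) : ℤ) + latN b u := by
        simp only [latN, Fin.sum_univ_three] at this ⊢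
        linear_combination (pNum b : ℤ) * this
      exact_mod_cast h1
    rw [phiDeriv_latN hb hcop u hζ, chiFun, psiFun, hinj.extend_apply, hinj.extend_apply, ← add_mul, ← hE]
    field_simp
    ring
  · rw [phiDeriv_eq_zero hn, chiFun, psiFun, Function.extend_apply' _ _ _ hn,
      Function.extend_apply' _ _ _ hn]
    simp

theorem summable_pow_mul_periodic_qpow {p K : ℕ} (hp : 0 < p) (hK : 0 < K) {c : ℤ → ℂ}
    (hc : Function.Periodic c (K : ℤ)) {τ : ℂ} (hτ : 0 < τ.im) (m : ℕ) :
    Summable fun n : ℕ => (n : ℂ) ^ m * c n * qpow ((n : ℚ) ^ 2 / (4 * p)) τ := by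
  obtain ⟨B, hB0, hB⟩ := exists_norm_le_of_periodic hK hc
  have ha : 0 < 2 * Real.pi * τ.im / (4 * p) := by
    have := Real.pi_pos
    have : (0 : ℝ) < p := by exact_mod_cast hp
    positivity
  have hs := ((summable_pow_mul_exp_neg_sq ha m).comp_injective Nat.cast_injective).mul_left B
  refine Summable.of_norm_bounded hs fun n => ?_
  have h := norm_qpow_sq p n τ
  rw [Int.cast_natCast] at h
  rw [norm_mul, h, norm_mul, norm_pow, Complex.norm_natCast]
  simp only [Function.comp, Int.cast_natCast, Nat.abs_cast]
  have := hB n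
  calc (n : ℝ) ^ m * ‖c n‖ * Real.exp (-(2 * Real.pi * τ.im / (4 * p)) * (n : ℝ) ^ 2)
      ≤ (n : ℝ) ^ m * B * Real.exp (-(2 * Real.pi * τ.im / (4 * p)) * (n : ℝ) ^ 2) := by gcongr
    _ = _ := by ring

end

end BrieskornQM

end

open BrieskornQM in
theorem theorem1p3 (b : Fin 3 → ℕ) (hb : 2 ≤ b 0) (hlt : StrictMono b)
    (hcop : Pairwise fun i i' => Nat.Coprime (b i) (b i'))
    (P : BrieskornPlumbing b) (k : P.Vertex → ℤ) (hk : P.plumbing.IsSpinc k)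
    (j : ℕ) (hj : 0 < j) (ζ : ℂ) (hζ : ζ ^ j = 1) :
    (∀ τ : ℂ, 0 < τ.im →
      (∀ t : ℂ, t ≠ 0 → Summable (P.plumbing.term k t τ)) ∧
      DifferentiableAt ℂ (fun t => P.plumbing.series k t τ) ζ ∧
      P.plumbing.seriesDeriv k ζ τ = qpow P.Delta τ * (CDeriv b ζ τ - ADeriv b ζ τ) ∧
      HasSum (fun x => ζ * deriv (fun t => P.plumbing.term k t τ x) ζ)
        (qpow P.Delta τ * (CDeriv b ζ τ - ADeriv b ζ τ))) ∧
    ∃ ψ χ : ℤ → ℂ,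
      (Function.Periodic ψ (2 * pNum b * j : ℤ) ∧ Function.Even ψ) ∧
      (Function.Periodic χ (2 * pNum b * j : ℤ) ∧ Function.Odd χ) ∧
      (∀ τ : ℂ, 0 < τ.im →
        ADeriv b ζ τ = qSeries (pNum b) (fun n => χ n) τ + qSeries (pNum b) (fun n => n * ψ n) τ) ∧
      HasQuantumModularLimits 1 (fun _ => 1) (CongruenceSubgroup.Gamma (4 * pNum b * j ^ 2))
        Set.univ (qSeries (pNum b) fun n => χ n) ∧
      HasQuantumModularLimits 3 (fun _ => 1) (CongruenceSubgroup.Gamma (4 * pNum b * j ^ 2))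
        {x : ℚ | (j : ℚ) * x ∈ cuspInfty (4 * pNum b * j)}
        (qSeries (pNum b) fun n => n * ψ n) := by
  have hb2 : ∀ i, 2 ≤ b i := fun i => hb.trans (hlt.monotone (Fin.zero_le i))
  have hb0 : ∀ i, 0 < b i := fun i => two_pos.trans_le (hb2 i)
  have hp := pNum_pos hb2
  have hinj := latN_injective hb2 hcop
  have hζ0 : ζ ≠ 0 := by
    rintro rfl
    rw [zero_pow hj.ne'] at hζ
    exact zero_ne_one hζ
  have hψ := psiFun_periodic hinj hj hζ
  have hχ := chiFun_periodic hinj hj hζ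
  have hψ' : Function.Periodic (psiFun b ζ) ((2 * pNum b * j : ℕ) : ℤ) := by exact_mod_cast hψ
  have hχ' : Function.Periodic (chiFun b ζ) ((2 * pNum b * j : ℕ) : ℤ) := by exact_mod_cast hχ
  refine ⟨fun τ hτ => ?_, psiFun b ζ, chiFun b ζ, ⟨hψ, psiFun_even hinj ζ⟩, ⟨hχ, chiFun_odd hinj ζ⟩,
    fun τ hτ => ?_, hasQuantumModularLimits_of_odd hp hj hχ' (chiFun_odd hinj ζ),
    hasQuantumModularLimits_of_even hp hj hψ' (psiFun_even hinj ζ) (psiFun_zero hb2 hcop ζ)⟩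
  · obtain ⟨g, hg, hg0, hterm⟩ := P.exists_reindex hb0 hk
    have hseries : ∀ t, P.plumbing.series k t τ = qpow P.Delta τ * ∑' u, latTerm b t τ u := by
      intro t
      rw [Plumbing.series, ← tsum_mul_left, ← hg.tsum_eq]
      · exact tsum_congr fun u => hterm u t τ
      · intro x hx
        by_contra hx'
        exact hx (hg0 x hx' t τ)
    obtain ⟨hdiff, hsum⟩ := hasSum_deriv_latTerm hb2 hcop hτ (norm_eq_one_of_pow_eq_one hζ hj.ne')
    have hA : ADeriv b ζ τ = CDeriv b ζ τ - ζ * deriv (fun t => ∑' u, latTerm b t τ u) ζ :=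
      (hasSum_phiDeriv hb hlt hcop hζ0 hsum).tsum_eq
    have hA' : CDeriv b ζ τ - ADeriv b ζ τ = ζ * deriv (fun t => ∑' u, latTerm b t τ u) ζ := by
      rw [hA, sub_sub_cancel]
    rw [hA']
    refine ⟨fun t ht => ?_, ?_, ?_, ?_⟩
    · rw [← hg.summable_iff fun x hx => hg0 x hx t τ]
      exact ((summable_latTerm hb2 hcop hτ ht).mul_left (qpow P.Delta τ)).congr fun u =>
        (hterm u t τ).symm
    · simp only [hseries]
      exact hdiff.const_mul _
    · rw [Plumbing.seriesDeriv]
      simp only [hseries]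
      rw [deriv_const_mul _ hdiff]
      ring
    · rw [← hg.hasSum_iff]
      · refine (hsum.mul_left (qpow P.Delta τ)).congr_fun fun u => ?_
        have h1 : (fun t => P.plumbing.term k t τ (g u)) = fun t => qpow P.Delta τ * latTerm b t τ u :=
          funext fun t => hterm u t τ
        have h2 := hasDerivAt_latTerm (b := b) τ u hζ0
        simp only [Function.comp]
        rw [h1, deriv_const_mul _ h2.differentiableAt, h2.deriv]
        field_simp
      · intro x hx
        have h1 : (fun t => P.plumbing.term k t τ x) = fun _ => 0 := funext fun t => hg0 x hx t τ
        rw [h1, deriv_const, mul_zero]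
  · have hK : 0 < 2 * pNum b * j := by positivity
    have s0 := summable_pow_mul_periodic_qpow hp hK hχ' hτ 0
    have s1 := summable_pow_mul_periodic_qpow hp hK hψ' hτ 1
    simp only [pow_zero, one_mul, pow_one] at s0 s1
    rw [ADeriv, qSeries, qSeries, qSeries, ← s0.tsum_add s1]
    refine tsum_congr fun n => ?_
    rw [phiDeriv_eq_chiFun_add hb2 hcop hζ0, add_mul, Int.cast_natCast]
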